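/- Let $d\ge 1$, $\mathcal S_d=\{s\in[0,1]^d: s_1+\dots+s_d\le 1\}$ and $s_{d+1}=1-(s_1+\dots+s_d)$. For $\alpha\in(0,\infty)^d$, $\beta>0$ let $$K_{\alpha,\beta}(s)=\frac{\Gamma(\alpha_1+\dots+\alpha_d+\beta)}{\Gamma(\beta)\prod_{i=1}^d\Gamma(\alpha_i)}\,s_{d+1}^{\beta-1}\prod_{i=1}^d s_i^{\alpha_i-1}$$ be the Dirichlet density on $\mathcal S_d$, and for $s\in\mathcal S_d$, $b>0$ put $\kappa_{s,b}=K_{(s_1/b+1,\dots,s_d/b+1),\,s_{d+1}/b+1}$. For each sample size $n\ge1$ let $Y_i=m(x_i)+\varepsilon_i$, $i=1,\dots,n$, where $x_i=x_{n,i}\in\mathcal S_d$ are fixed design points and $\varepsilon_i=\varepsilon_{n,i}$ are uncorrelated square-integrable errors with mean $0$ and variance $\sigma^2(x_i)$. The design density $f$ satisfies $\frac1n\sum_{i=1}^n\mathbf 1_A(x_i)\to\int_{A\cap\mathcal S_d} f$ as $n\to\infty$ for every Borel set $A\subseteq\mathbb R^d$ with Lebesgue-null boundary. Assume: (A1) $f$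 and $\sigma^2$ are Lipschitz on $\mathcal S_d$ and $m$ is twice continuously differentiable on $\mathcal S_d$. (A2) $f\ge f_0$ and $\sigma^2\le\sigma_0^2$ on $\mathcal S_d$ for some constants $f_0,\sigma_0^2\in(0,\infty)$. (A3) $b=b(n)>0$, $b\to0$ and $b^{-1}n^{-1/d}\to0$ as $n\to\infty$. (A4) For each $n\ge1$ there are convex compact sets $B_1,\dots,B_n$ with pairwise disjoint interiors, union $\mathcal S_d$ and Lebesgue-null boundaries, such that $x_i\in\mathrm{Int}(B_i)$ for all $i$ and, as $n\to\infty$ and uniformly in $i$, $\max_{x,s\in B_i}\|x-s\|_2=O(n^{-1/d})$ and $\int_{B_i}f=n^{-1}+O(n^{-1-1/d})$. Let $\hat m_{n,b}(s)=\sum_{i=1}^nY_i\int_{B_i}\kappa_{s,b}(x)\,dx$ be the Gasser–Müller estimator with Dirichlet kernel, $\mathrm{MISE}(\hat m_{n,b})=\int_{\mathcal S_d}E\{|\hat m_{n,b}(s)-m(s)|^2\}\,ds$, $$g(s)=\sum_{i=1}^d\{1-(d+1)s_i\}\frac{\partial m}{\partial s_i}(s)+\frac12\sum_{i,j=1}^d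 s_i(\mathbf 1_{\{i=j\}}-s_j)\frac{\partial^2m}{\partial s_i\partial s_j}(s),\qquad \psi(s)=\Big\{(4\pi)^d s_{d+1}\prod_{i=1}^d s_i\Big\}^{-1/2},$$ $G=\int_{\mathcal S_d}g^2(s)\,ds$ and $V=\int_{\mathcal S_d}\psi(s)\sigma^2(s)/f(s)\,ds$. All these integrals are finite and, as $n\to\infty$, $$\mathrm{MISE}(\hat m_{n,b})=b^2G+n^{-1}b^{-d/2}V+o(b^2)+o(n^{-1/d}b)+O(n^{-2/d})+o(n^{-1}b^{-d/2}),$$ where the constant in $O(n^{-2/d})$ depends only on $d$, $m$, $\sigma^2$, $f$ and the implied constants in (A4). If moreover $d\in\{1,2,3\}$, $G\in(0,\infty)$ and $V>0$, then the asymptotically MISE-optimal bandwidth is $$b_{\mathrm{opt}}=n^{-2/(d+4)}\Big[\frac d4\cdot\frac VG\Big]^{2/(d+4)},$$ that is: $b_{\mathrm{opt}}$ satisfies (A3); for every $b$ satisfying (A3) and every $\delta>0$, $\mathrm{MISE}(\hat m_{n,b_{\mathrm{opt}}})\le(1+\delta)\,\mathrm{MISE}(\hat m_{n,b})$ for all large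 $n$; and if $b$ satisfies (A3) and $\mathrm{MISE}(\hat m_{n,b})/\mathrm{MISE}(\hat m_{n,b_{\mathrm{opt}}})\to1$, then $b/b_{\mathrm{opt}}\to1$. Furthermore, $$\mathrm{MISE}(\hat m_{n,b_{\mathrm{opt}}})=n^{-4/(d+4)}\Big\{\frac{1+d/4}{(d/4)^{d/(d+4)}}\Big\}\frac{V^{4/(d+4)}}{G^{-d/(d+4)}}+o(n^{-4/(d+4)}).$$ -/

import Mathlib

open MeasureTheory ProbabilityTheory Filter Topology Asymptotics

noncomputable section

/-- The closed simplex `{s ∈ [0,1]^d : s₁ + ⋯ + s_d ≤ 1}` (on `[0,1]^d` the sum is the ℓ¹ norm). -/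
def simplex (d : ℕ) : Set (EuclideanSpace ℝ (Fin d)) :=
  {s | (∀ i, s i ∈ Set.Icc (0 : ℝ) 1) ∧ ∑ i, s i ≤ 1}

/-- The last barycentric coordinate `s_{d+1} = 1 - (s₁ + ⋯ + s_d)`. -/
def lastCoord {d : ℕ} (s : EuclideanSpace ℝ (Fin d)) : ℝ := 1 - ∑ i, s i

/-- The density of the Dirichlet distribution with parameters `α`, `β` on the simplex. -/
def dirichletDensity {d : ℕ} (α : Fin d → ℝ) (β : ℝ) (s : EuclideanSpace ℝ (Fin d)) : ℝ :=
  Real.Gamma (∑ i, α i + β) / (Real.Gamma β * ∏ i, Real.Gamma (α i))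
    * lastCoord s ^ (β - 1) * ∏ i, s i ^ (α i - 1)

/-- The Dirichlet kernel with estimation point `s` and bandwidth `b`. -/
def dirichletKernel {d : ℕ} (s : EuclideanSpace ℝ (Fin d)) (b : ℝ)
    (x : EuclideanSpace ℝ (Fin d)) : ℝ :=
  dirichletDensity (fun i => s i / b + 1) (lastCoord s / b + 1) x

/-- The Gasser–Müller estimator with Dirichlet kernel, computed from the regions `B` and the
responses `Y`, with bandwidth `b`, at the point `s`. -/
def gmEstimator {d n : ℕ} (B : Fin n → Set (EuclideanSpace ℝ (Fin d))) (Y : Fin n → ℝ)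
    (b : ℝ) (s : EuclideanSpace ℝ (Fin d)) : ℝ :=
  ∑ i, Y i * ∫ x in B i, dirichletKernel s b x

/-- The responses `Y_i = m(x_i) + ε_i` for sample size `n`. -/
def response {d : ℕ} {Ω : Type*} (m : EuclideanSpace ℝ (Fin d) → ℝ)
    (x : (n : ℕ) → Fin n → EuclideanSpace ℝ (Fin d)) (ε : (n : ℕ) → Fin n → Ω → ℝ)
    (n : ℕ) (ω : Ω) (i : Fin n) : ℝ :=
  m (x n i) + ε n i ω

/-- The squared error of the estimator at the point `s`, as a random variable. -/
def squaredError {d : ℕ} {Ω : Type*} (m : EuclideanSpace ℝ (Fin d) → ℝ)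
    (x : (n : ℕ) → Fin n → EuclideanSpace ℝ (Fin d))
    (B : (n : ℕ) → Fin n → Set (EuclideanSpace ℝ (Fin d))) (ε : (n : ℕ) → Fin n → Ω → ℝ)
    (n : ℕ) (b : ℝ) (s : EuclideanSpace ℝ (Fin d)) (ω : Ω) : ℝ :=
  |gmEstimator (B n) (response m x ε n ω) b s - m s| ^ 2

/-- The mean squared error at the point `s`, for sample size `n` and bandwidth `b`. -/
def mse {d : ℕ} {Ω : Type*} [MeasurableSpace Ω] (P : Measure Ω)
    (m : EuclideanSpace ℝ (Fin d) → ℝ) (x : (n : ℕ) → Fin n → EuclideanSpace ℝ (Fin d))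
    (B : (n : ℕ) → Fin n → Set (EuclideanSpace ℝ (Fin d))) (ε : (n : ℕ) → Fin n → Ω → ℝ)
    (n : ℕ) (b : ℝ) (s : EuclideanSpace ℝ (Fin d)) : ℝ :=
  ∫ ω, squaredError m x B ε n b s ω ∂P

/-- The mean integrated squared error for sample size `n` and bandwidth `b`. -/
def mise {d : ℕ} {Ω : Type*} [MeasurableSpace Ω] (P : Measure Ω)
    (m : EuclideanSpace ℝ (Fin d) → ℝ) (x : (n : ℕ) → Fin n → EuclideanSpace ℝ (Fin d))
    (B : (n : ℕ) → Fin n → Set (EuclideanSpace ℝ (Fin d))) (ε : (n : ℕ) → Fin n → Ω → ℝ)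
    (n : ℕ) (b : ℝ) : ℝ :=
  ∫ s in simplex d, mse P m x B ε n b s

/-- The partial derivative `∂h/∂s_i` on the simplex (one-sided at boundary points). -/
def partialDeriv {d : ℕ} (i : Fin d) (h : EuclideanSpace ℝ (Fin d) → ℝ)
    (s : EuclideanSpace ℝ (Fin d)) : ℝ :=
  fderivWithin ℝ h (simplex d) s (EuclideanSpace.single i 1)

/-- The function `g` which gives the leading term `b g(s)` of the pointwise bias. -/
def biasFun {d : ℕ} (m : EuclideanSpace ℝ (Fin d) → ℝ) (s : EuclideanSpace ℝ (Fin d)) : ℝ :=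
  ∑ i, (1 - ((d : ℝ) + 1) * s i) * partialDeriv i m s
    + (1 / 2) * ∑ i, ∑ j, s i * ((if i = j then (1 : ℝ) else 0) - s j)
        * partialDeriv i (partialDeriv j m) s

/-- The function `ψ(s) = {(4π)^d s_{d+1} s₁ ⋯ s_d}^{-1/2}`. -/
def psi {d : ℕ} (s : EuclideanSpace ℝ (Fin d)) : ℝ :=
  ((4 * Real.pi) ^ d * lastCoord s * ∏ i, s i) ^ (-(1 / 2) : ℝ)

/-- The integral of `g²` over the simplex. -/
def biasConst {d : ℕ} (m : EuclideanSpace ℝ (Fin d) → ℝ) : ℝ :=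
  ∫ s in simplex d, biasFun m s ^ 2

/-- The integral of `ψ σ² / f` over the simplex. -/
def varConst {d : ℕ} (f σ : EuclideanSpace ℝ (Fin d) → ℝ) : ℝ :=
  ∫ s in simplex d, psi s * σ s ^ 2 / f s

/-- Regularity: `f` and `σ²` are Lipschitz and `m` is twice continuously differentiable
on the closed simplex. -/
structure RegularityAssumption {d : ℕ} (f σ m : EuclideanSpace ℝ (Fin d) → ℝ) : Prop where
  lipschitz_f : ∃ L, LipschitzOnWith L f (simplex d)
  lipschitz_variance : ∃ L, LipschitzOnWith L (fun x => σ x ^ 2) (simplex d)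
  contDiff_m : ContDiffOn ℝ 2 m (simplex d)

/-- Bounds: `f` is bounded away from zero and `σ²` is bounded on the simplex. -/
structure BoundsAssumption {d : ℕ} (f σ : EuclideanSpace ℝ (Fin d) → ℝ) : Prop where
  lower_f : ∃ f₀ : ℝ, 0 < f₀ ∧ ∀ x ∈ simplex d, f₀ ≤ f x
  upper_variance : ∃ v₀ : ℝ, 0 < v₀ ∧ ∀ x ∈ simplex d, σ x ^ 2 ≤ v₀

/-- Bandwidths: `b(n) > 0`, `b(n) → 0` and `b(n)⁻¹ n^{-1/d} → 0`. -/
structure BandwidthAssumption (d : ℕ) (b : ℕ → ℝ) : Prop where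
  pos : ∀ n, 0 < n → 0 < b n
  tendsto_zero : Tendsto b atTop (𝓝 0)
  inv_mul_tendsto_zero :
    Tendsto (fun n : ℕ => (b n)⁻¹ * (n : ℝ) ^ (-(1 / (d : ℝ)))) atTop (𝓝 0)

/-- Regions: for every `n ≥ 1`, the `B n i` are convex compact sets that partition the simplex
up to boundaries, with `x n i` in the interior of `B n i`; their diameters are `O(n^{-1/d})` and
their `f`-masses are `1/n + O(n^{-1-1/d})`, uniformly in `i`, with implied constant `C₀`. -/
structure PartitionAssumption {d : ℕ} (f : EuclideanSpace ℝ (Fin d) → ℝ) (C₀ : ℝ)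
    (x : (n : ℕ) → Fin n → EuclideanSpace ℝ (Fin d))
    (B : (n : ℕ) → Fin n → Set (EuclideanSpace ℝ (Fin d))) : Prop where
  convex : ∀ n, 0 < n → ∀ i, Convex ℝ (B n i)
  compact : ∀ n, 0 < n → ∀ i, IsCompact (B n i)
  disjoint_interior : ∀ n, 0 < n → ∀ i j, i ≠ j → interior (B n i) ∩ interior (B n j) = ∅
  cover : ∀ n, 0 < n → ⋃ i, B n i = simplex d
  mem_interior : ∀ n, 0 < n → ∀ i, x n i ∈ interior (B n i)
  frontier_null : ∀ n, 0 < n → ∀ i, volume (frontier (B n i)) = 0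
  diam_le : ∀ᶠ n : ℕ in atTop, ∀ i, ∀ y ∈ B n i, ∀ z ∈ B n i,
    ‖y - z‖ ≤ C₀ * (n : ℝ) ^ (-(1 / (d : ℝ)))
  mass : ∀ᶠ n : ℕ in atTop, ∀ i,
    |(∫ t in B n i, f t) - (n : ℝ)⁻¹| ≤ C₀ * (n : ℝ) ^ (-1 - 1 / (d : ℝ))

/-- `f` is the limiting density of the design points: the empirical measures converge to
`f` times Lebesgue measure on the simplex, on all Borel sets with Lebesgue-null boundary. -/
def IsDesignDensity {d : ℕ} (f : EuclideanSpace ℝ (Fin d) → ℝ)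
    (x : (n : ℕ) → Fin n → EuclideanSpace ℝ (Fin d)) : Prop :=
  ∀ A : Set (EuclideanSpace ℝ (Fin d)), MeasurableSet A → volume (frontier A) = 0 →
    Tendsto (fun n : ℕ => (n : ℝ)⁻¹ * ∑ i, A.indicator (fun _ => (1 : ℝ)) (x n i)) atTop
      (𝓝 (∫ t in A ∩ simplex d, f t))

/-- Errors: for every `n`, they are square integrable, centred, uncorrelated, and the `i`th one
has variance `σ²(x_i)`. -/
structure ErrorAssumption {d : ℕ} {Ω : Type*} [MeasurableSpace Ω] (P : Measure Ω)
    (σ : EuclideanSpace ℝ (Fin d) → ℝ) (x : (n : ℕ) → Fin n → EuclideanSpace ℝ (Fin d))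
    (ε : (n : ℕ) → Fin n → Ω → ℝ) : Prop where
  memLp : ∀ n i, MemLp (ε n i) 2 P
  mean_zero : ∀ n i, ∫ ω, ε n i ω ∂P = 0
  variance_eq : ∀ n i, variance (ε n i) P = σ (x n i) ^ 2
  uncorrelated : ∀ n i j, i ≠ j → covariance (ε n i) (ε n j) P = 0

/-- The bandwidth `n^{-2/(d+4)} {(d/4) V / G}^{2/(d+4)}`. -/
def optBandwidth (d : ℕ) (G V : ℝ) (n : ℕ) : ℝ :=
  (n : ℝ) ^ (-(2 / ((d : ℝ) + 4))) * ((d : ℝ) / 4 * (V / G)) ^ (2 / ((d : ℝ) + 4))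

/-- `bo` is asymptotically optimal for the criterion `R n b` (sample size `n`, bandwidth `b`):
it is an admissible bandwidth sequence, no admissible sequence does asymptotically better, and
every admissible sequence that does asymptotically as well is asymptotically equivalent to it. -/
structure IsAsymptoticallyOptimal (d : ℕ) (R : ℕ → ℝ → ℝ) (bo : ℕ → ℝ) : Prop where
  admissible : BandwidthAssumption d bo
  optimal : ∀ b : ℕ → ℝ, BandwidthAssumption d b → ∀ δ : ℝ, 0 < δ →
    ∀ᶠ n in atTop, R n (bo n) ≤ (1 + δ) * R n (b n)
  unique : ∀ b : ℕ → ℝ, BandwidthAssumption d b →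
    Tendsto (fun n => R n (b n) / R n (bo n)) atTop (𝓝 1) →
    Tendsto (fun n => b n / bo n) atTop (𝓝 1)

end

noncomputable section

/-! ### The Dirichlet integral -/

/-! The mean squared error at a point is squared bias plus variance (`mse_eq`), and each part,
suitably normalized, converges pointwise under a dominating function, so the expansion is two
applications of dominated convergence.

Bias: the weights of the cells sum to one, so replacing `m (x i)` by `m` inside each cell costs
`O(n^{-1/d})`, which is `o(b)` for an admissible bandwidth. What remains is the smoothing bias, the
integral of `m` against the Dirichlet kernel minus `m s`. Exact Dirichlet moments have mean
displacement and second central moments of order `b`, with exactly the coefficients occurring in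
`biasFun`, and fourth central moments of order `b^2`. A second order Taylor expansion, valid up to
the boundary of the simplex, gives the limit (`tendsto_smoothing_bias_div`), and a first order one
gives a bound uniform in `s` (`exists_abs_smoothing_bias_le`).

Variance: the square of the kernel with bandwidth `b` is its energy times the kernel with bandwidth
`b / 2` (`dirichletKernel_sq`). Cauchy-Schwarz on a cell bounds the squared weight by the volume of
the cell times the energy times the `b / 2`-mass of the cell. In the interior this is nearly an
equality, because the kernel is almost constant, in ratio, on cells of diameter `o(b)`. As `n` times
the volume of a cell near `s` is close to `1 / f s`, the normalized variance is an average of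
approximately `σ^2 / f` under a probability density concentrating at `s`
(`abs_sum_cellTerm_sub_le`). The energy is a quotient of Gamma functions; duplication and
log-convexity show that `b^{d/2}` times it tends to `psi s` and is bounded by a multiple of `psi s`,
which is integrable, being proportional to a Dirichlet density.

Optimization: in the scale `b = u * optBandwidth` the leading risk is a multiple of `u^2 + (4/d)
u^{-d/2}`, which exceeds its minimum, at `u = 1`, by at least `(log u)^2 / 2` (`sq_log_div_two_le`).
This one inequality gives both optimality and asymptotic uniqueness, and both pass to the true risk,
whose ratio to the leading risk tends to one. -/

lemma lintegral_Ioo_beta {a c r : ℝ} (ha : 0 < a) (hc : 0 < c) (hr : 0 < r) :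
    ∫⁻ t in Set.Ioo 0 r, ENNReal.ofReal (t ^ (a - 1) * (r - t) ^ (c - 1)) =
      ENNReal.ofReal (r ^ (a + c - 1) * beta a c) := by
  have hbp := beta_pos ha hc
  have h1 : ∫⁻ t in Set.Ioo (0 : ℝ) 1, ENNReal.ofReal (t ^ (a - 1) * (1 - t) ^ (c - 1)) =
      ENNReal.ofReal (beta a c) := by
    have h := lintegral_betaPDF_eq_one ha hc
    rw [lintegral_betaPDF] at h
    have h2 : ∫⁻ t in Set.Ioo (0 : ℝ) 1, ENNReal.ofReal (t ^ (a - 1) * (1 - t) ^ (c - 1)) =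
        ∫⁻ t in Set.Ioo (0 : ℝ) 1, ENNReal.ofReal (beta a c) *
          ENNReal.ofReal (1 / beta a c * t ^ (a - 1) * (1 - t) ^ (c - 1)) := by
      refine lintegral_congr fun t => ?_
      rw [← ENNReal.ofReal_mul hbp.le]
      congr 1
      field_simp
    rw [h2, lintegral_const_mul _ (by fun_prop), h, mul_one]
  have himg : (fun t => r * t) '' Set.Ioo (0 : ℝ) 1 = Set.Ioo 0 r := by
    rw [Set.image_mul_left_Ioo hr]
    simp
  rw [← himg, lintegral_image_eq_lintegral_abs_deriv_mul (f' := fun _ => r) measurableSet_Ioo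
    (fun t _ => by simpa using ((hasDerivAt_id t).const_mul r).hasDerivWithinAt)
    (fun x _ y _ h => mul_left_cancel₀ hr.ne' h)]
  have h3 : ∀ t ∈ Set.Ioo (0 : ℝ) 1, ENNReal.ofReal |r| *
      ENNReal.ofReal ((r * t) ^ (a - 1) * (r - r * t) ^ (c - 1)) =
      ENNReal.ofReal (r ^ (a + c - 1)) *
        ENNReal.ofReal (t ^ (a - 1) * (1 - t) ^ (c - 1)) := by
    intro t ht
    rw [← ENNReal.ofReal_mul (abs_nonneg r), ← ENNReal.ofReal_mul (by positivity)]
    congr 1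
    rw [abs_of_pos hr, show r - r * t = r * (1 - t) by ring, Real.mul_rpow hr.le ht.1.le,
      Real.mul_rpow hr.le (by linarith [ht.2]),
      show a + c - 1 = 1 + (a - 1) + (c - 1) by ring, Real.rpow_add hr, Real.rpow_add hr,
      Real.rpow_one]
    ring
  rw [setLIntegral_congr_fun measurableSet_Ioo h3, lintegral_const_mul _ (by fun_prop), h1,
    ← ENNReal.ofReal_mul (by positivity)]

/-- The corner `{y : yᵢ ≥ 0, ∑ yᵢ ≤ r}` of the orthant. -/
def corner (d : ℕ) (r : ℝ) : Set (Fin d → ℝ) := {y | (∀ i, 0 ≤ y i) ∧ ∑ i, y i ≤ r}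

lemma measurableSet_corner (d : ℕ) (r : ℝ) : MeasurableSet (corner d r) := by
  have : corner d r = (⋂ i, {y : Fin d → ℝ | 0 ≤ y i}) ∩ {y | ∑ i, y i ≤ r} := by
    ext y; simp [corner]
  rw [this]
  refine (MeasurableSet.iInter fun i => measurableSet_le measurable_const (by fun_prop)).inter
    (measurableSet_le (by fun_prop) measurable_const)

/-- Induction on the dimension: fixing the first coordinate at `t` leaves a corner of size `r - t`,
whose integral is a power of `r - t`, and the outer integral is then a beta integral. The size `r`
is kept general for this reason. Lower integrals make integrability a consequence rather than a
prerequisite. -/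
lemma lintegral_corner (d : ℕ) : ∀ (α : Fin d → ℝ) (β r : ℝ), (∀ i, 0 < α i) → 0 < β → 0 < r →
    ∫⁻ y in corner d r, ENNReal.ofReal ((∏ i, y i ^ (α i - 1)) * (r - ∑ i, y i) ^ (β - 1)) =
      ENNReal.ofReal (r ^ (∑ i, α i + β - 1) *
        ((∏ i, Real.Gamma (α i)) * Real.Gamma β / Real.Gamma (∑ i, α i + β))) := by
  induction d with
  | zero =>
    intro α β r _ hβ hr
    have hc : corner 0 r = Set.univ := by
      ext y; simp [corner, hr.le]
    rw [hc, Measure.restrict_univ, volume_pi, Measure.pi_of_empty]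
    simp [(Real.Gamma_pos_of_pos hβ).ne']
  | succ d ih =>
    intro α β r hα hβ hr
    have hsum : 0 < ∑ i, α (Fin.succ i) + β :=
      add_pos_of_nonneg_of_pos (Finset.sum_nonneg fun i _ => (hα _).le) hβ
    rw [← lintegral_indicator (measurableSet_corner _ _)]
    have hmp := (volume_preserving_piFinSuccAbove (fun _ : Fin (d + 1) => ℝ) 0).symm
    rw [← hmp.lintegral_comp_emb (MeasurableEquiv.measurableEmbedding _)]
    rw [Measure.volume_eq_prod, lintegral_prod]
    swap
    · have hind : Measurable ((corner (d + 1) r).indicator (fun y => ENNReal.ofReal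
          ((∏ i, y i ^ (α i - 1)) * (r - ∑ i, y i) ^ (β - 1)))) :=
        Measurable.indicator (by fun_prop) (measurableSet_corner _ _)
      exact (hind.comp (MeasurableEquiv.measurable _)).aemeasurable
    set c : ℝ := (∏ i, Real.Gamma (α (Fin.succ i))) * Real.Gamma β /
      Real.Gamma (∑ i, α (Fin.succ i) + β) with hc
    have hcpos : 0 < c := by
      refine div_pos (mul_pos (Finset.prod_pos fun i _ => Real.Gamma_pos_of_pos (hα _))
        (Real.Gamma_pos_of_pos hβ)) (Real.Gamma_pos_of_pos hsum)
    -- At `t = 0` and `t = r` the slice integral need not vanish, while the indicator of the open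
    -- interval does; these two points form a null set and are discarded.
    have key : ∀ t ∉ ({0, r} : Set ℝ), ∫⁻ z : Fin d → ℝ, (corner (d + 1) r).indicator
          (fun y => ENNReal.ofReal ((∏ i, y i ^ (α i - 1)) * (r - ∑ i, y i) ^ (β - 1)))
          ((MeasurableEquiv.piFinSuccAbove (fun _ => ℝ) 0).symm (t, z)) =
        (Set.Ioo 0 r).indicator (fun t => ENNReal.ofReal c *
          ENNReal.ofReal (t ^ (α 0 - 1) * (r - t) ^ (∑ i, α (Fin.succ i) + β - 1))) t := by
      intro t ht
      simp only [Set.mem_insert_iff, Set.mem_singleton_iff, not_or] at ht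
      have hcons : ∀ z : Fin d → ℝ, (MeasurableEquiv.piFinSuccAbove (fun _ => ℝ) 0).symm (t, z) =
          Fin.cons t z := by
        intro z
        simp [MeasurableEquiv.piFinSuccAbove, Fin.insertNthEquiv]
      simp_rw [hcons]
      by_cases hmem : t ∈ Set.Ioo 0 r
      · rw [Set.indicator_of_mem hmem]
        have h1 : ∀ z : Fin d → ℝ, (corner (d + 1) r).indicator
          (fun y => ENNReal.ofReal ((∏ i, y i ^ (α i - 1)) * (r - ∑ i, y i) ^ (β - 1)))
          (Fin.cons t z : Fin (d + 1) → ℝ) = (corner d (r - t)).indicator (fun z =>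
            ENNReal.ofReal (t ^ (α 0 - 1)) * ENNReal.ofReal
              ((∏ i, z i ^ (α (Fin.succ i) - 1)) * (r - t - ∑ i, z i) ^ (β - 1))) z := by
          intro z
          have hiff : (Fin.cons t z : Fin (d + 1) → ℝ) ∈ corner (d + 1) r ↔
              z ∈ corner d (r - t) := by
            simp only [corner, Set.mem_ofPred_eq, Fin.forall_fin_succ, Fin.cons_zero, Fin.cons_succ,
              Fin.sum_univ_succ]
            constructor
            · rintro ⟨⟨_, h2⟩, h3⟩; exact ⟨h2, by linarith⟩
            · rintro ⟨h2, h3⟩; exact ⟨⟨hmem.1.le, h2⟩, by linarith⟩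
          by_cases hz : z ∈ corner d (r - t)
          · rw [Set.indicator_of_mem hz, Set.indicator_of_mem (hiff.2 hz),
              ← ENNReal.ofReal_mul (Real.rpow_nonneg hmem.1.le _)]
            simp only [Fin.prod_univ_succ, Fin.sum_univ_succ, Fin.cons_zero, Fin.cons_succ]
            rw [mul_assoc, sub_sub]
          · rw [Set.indicator_of_notMem hz, Set.indicator_of_notMem (fun h => hz (hiff.1 h))]
        simp_rw [h1]
        rw [lintegral_indicator (measurableSet_corner _ _), lintegral_const_mul _ (by fun_prop),
          ih _ β (r - t) (fun i => hα _) hβ (by linarith [hmem.2]),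
          ← ENNReal.ofReal_mul (Real.rpow_nonneg hmem.1.le _), ← ENNReal.ofReal_mul hcpos.le]
        congr 1
        ring
      · rw [Set.indicator_of_notMem hmem]
        refine (lintegral_congr fun z => ?_).trans lintegral_zero
        refine Set.indicator_of_notMem (fun h => hmem ?_) _
        simp only [corner, Set.mem_ofPred_eq, Fin.forall_fin_succ, Fin.cons_zero, Fin.cons_succ,
              Fin.sum_univ_succ] at h
        have : 0 ≤ ∑ i, z i := Finset.sum_nonneg fun i _ => h.1.2 i
        exact ⟨lt_of_le_of_ne h.1.1 (Ne.symm ht.1), lt_of_le_of_ne (by linarith [h.2]) ht.2⟩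
    have hae : ∀ᵐ t : ℝ, t ∉ ({0, r} : Set ℝ) :=
      measure_eq_zero_iff_ae_notMem.1 ((Set.toFinite {0, r}).measure_zero _)
    rw [lintegral_congr_ae (hae.mono key), lintegral_indicator measurableSet_Ioo,
      lintegral_const_mul _ (by fun_prop), lintegral_Ioo_beta (hα 0) hsum hr,
      ← ENNReal.ofReal_mul hcpos.le]
    congr 1
    have hg := (Real.Gamma_pos_of_pos hsum).ne'
    rw [hc, beta, Fin.sum_univ_succ, Fin.prod_univ_succ, add_assoc, add_sub_assoc]
    field_simp

/-! ### The simplex -/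

variable {d : ℕ}

lemma lastCoord_nonneg {s : EuclideanSpace ℝ (Fin d)} (hs : s ∈ simplex d) : 0 ≤ lastCoord s := by
  simpa [lastCoord] using hs.2

lemma simplex_coord_nonneg {s : EuclideanSpace ℝ (Fin d)} (hs : s ∈ simplex d) (i : Fin d) :
    0 ≤ s i := (hs.1 i).1

lemma simplex_coord_le_one {s : EuclideanSpace ℝ (Fin d)} (hs : s ∈ simplex d) (i : Fin d) :
    s i ≤ 1 := (hs.1 i).2

lemma mem_simplex_iff {s : EuclideanSpace ℝ (Fin d)} :
    s ∈ simplex d ↔ (∀ i, 0 ≤ s i) ∧ ∑ i, s i ≤ 1 := by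
  refine ⟨fun h => ⟨fun i => (h.1 i).1, h.2⟩, fun h => ⟨fun i => ⟨h.1 i, ?_⟩, h.2⟩⟩
  exact (Finset.single_le_sum (fun j _ => h.1 j) (Finset.mem_univ i)).trans h.2

@[fun_prop]
lemma continuous_lastCoord : Continuous (lastCoord : EuclideanSpace ℝ (Fin d) → ℝ) := by
  unfold lastCoord; fun_prop

@[fun_prop]
lemma measurable_lastCoord : Measurable (lastCoord : EuclideanSpace ℝ (Fin d) → ℝ) :=
  continuous_lastCoord.measurable

lemma isClosed_simplex : IsClosed (simplex d) := by
  have : simplex d = (⋂ i, {y : EuclideanSpace ℝ (Fin d) | 0 ≤ y i}) ∩ {y | ∑ i, y i ≤ 1} := by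
    ext y; simp [mem_simplex_iff]
  rw [this]
  exact (isClosed_iInter fun i => isClosed_le continuous_const (by fun_prop)).inter
    (isClosed_le (by fun_prop) continuous_const)

lemma measurableSet_simplex : MeasurableSet (simplex d) := isClosed_simplex.measurableSet

lemma simplex_norm_sub_le {x y : EuclideanSpace ℝ (Fin d)} (hx : x ∈ simplex d)
    (hy : y ∈ simplex d) : ‖x - y‖ ≤ Real.sqrt d := by
  rw [EuclideanSpace.norm_eq]
  refine Real.sqrt_le_sqrt ((Finset.sum_le_card_nsmul _ _ 1 fun i _ => ?_).trans (by simp))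
  have h1 := hx.1 i
  have h2 := hy.1 i
  simp only [PiLp.sub_apply, Real.norm_eq_abs, sq_abs]
  nlinarith [h1.1, h1.2, h2.1, h2.2]

lemma isCompact_simplex : IsCompact (simplex d) := by
  refine Metric.isCompact_of_isClosed_isBounded isClosed_simplex ?_
  refine Metric.isBounded_iff.2 ⟨Real.sqrt d, fun x hx y hy => ?_⟩
  rw [dist_eq_norm]
  exact simplex_norm_sub_le hx hy

lemma convex_simplex : Convex ℝ (simplex d) := by
  intro x hx y hy a b ha hb hab
  rw [mem_simplex_iff] at *
  refine ⟨fun i => ?_, ?_⟩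
  · simp only [PiLp.add_apply, PiLp.smul_apply, smul_eq_mul]
    have := hx.1 i
    have := hy.1 i
    positivity
  · simp only [PiLp.add_apply, PiLp.smul_apply, smul_eq_mul, Finset.sum_add_distrib,
      ← Finset.mul_sum]
    nlinarith [hx.2, hy.2]

lemma isOpen_pos_coords :
    IsOpen {s : EuclideanSpace ℝ (Fin d) | (∀ i, 0 < s i) ∧ 0 < lastCoord s} := by
  have : {s : EuclideanSpace ℝ (Fin d) | (∀ i, 0 < s i) ∧ 0 < lastCoord s} =
      (⋂ i, {y : EuclideanSpace ℝ (Fin d) | 0 < y i}) ∩ {y | 0 < lastCoord y} := by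
    ext y; simp
  rw [this]
  exact (isOpen_iInter_of_finite fun i => isOpen_lt continuous_const (by fun_prop)).inter
    (isOpen_lt continuous_const (by fun_prop))

/-- From an interior point one can move a little along `-e_i` or `+e_0` and stay in the simplex,
which forces each barycentric coordinate to be strictly positive. -/
lemma interior_simplex [NeZero d] :
    interior (simplex d) = {s | (∀ i, 0 < s i) ∧ 0 < lastCoord s} := by
  refine Set.Subset.antisymm (fun s hs => ?_) (interior_maximal (fun s hs => ?_) isOpen_pos_coords)
  · have hev : ∀ v : EuclideanSpace ℝ (Fin d), ∀ᶠ t : ℝ in 𝓝[>] 0, s + t • v ∈ simplex d := by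
      intro v
      have hc : Tendsto (fun t : ℝ => s + t • v) (𝓝[>] 0) (𝓝 s) := by
        have : Continuous fun t : ℝ => s + t • v := by fun_prop
        simpa using (this.tendsto 0).mono_left nhdsWithin_le_nhds
      exact hc.eventually (mem_interior_iff_mem_nhds.1 hs)
    refine ⟨fun i => ?_, ?_⟩
    · obtain ⟨t, ht, ht0⟩ := ((hev (-EuclideanSpace.single i 1)).and
        self_mem_nhdsWithin).exists
      have h := simplex_coord_nonneg ht i
      simp only [smul_neg, PiLp.add_apply, PiLp.neg_apply, PiLp.smul_apply,
        PiLp.single_apply, if_true, smul_eq_mul, mul_one] at h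
      have : (0 : ℝ) < t := ht0
      linarith
    · obtain ⟨t, ht, ht0⟩ := ((hev (EuclideanSpace.single 0 1)).and
        self_mem_nhdsWithin).exists
      have h := lastCoord_nonneg ht
      simp only [lastCoord, PiLp.add_apply, PiLp.smul_apply, PiLp.single_apply,
        smul_eq_mul, Finset.sum_add_distrib, mul_ite, mul_one, mul_zero, Finset.sum_ite_eq',
        Finset.mem_univ, if_true] at h
      have : (0 : ℝ) < t := ht0
      simp only [lastCoord]
      linarith
  · exact mem_simplex_iff.2 ⟨fun i => (hs.1 i).le, by have := hs.2; simp [lastCoord] at this; linarith⟩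

lemma interior_simplex_nonempty [NeZero d] : (interior (simplex d)).Nonempty := by
  rw [interior_simplex]
  refine ⟨WithLp.toLp 2 fun _ => ((d : ℝ) + 1)⁻¹, fun i => ?_, ?_⟩
  · simp only []
    positivity
  · simp only [lastCoord, Finset.sum_const, Finset.card_univ, Fintype.card_fin, nsmul_eq_mul]
    rw [sub_pos, ← div_eq_mul_inv, div_lt_one (by positivity)]
    linarith

lemma uniqueDiffOn_simplex [NeZero d] : UniqueDiffOn ℝ (simplex d) :=
  uniqueDiffOn_convex convex_simplex interior_simplex_nonempty

/-- The frontier of a convex set is Lebesgue-null. This allows the variance to be treated at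
interior points only, where `psi` is governed by strictly positive coordinates. -/
lemma ae_mem_interior_simplex :
    ∀ᵐ s ∂(volume.restrict (simplex d)), s ∈ interior (simplex d) := by
  rw [ae_restrict_iff' measurableSet_simplex]
  have h := convex_simplex (d := d).addHaar_frontier volume
  filter_upwards [measure_eq_zero_iff_ae_notMem.1 h] with s hs hmem
  rw [isClosed_simplex.frontier_eq] at hs
  by_contra h'
  exact hs ⟨hmem, h'⟩

lemma volume_simplex_lt_top : volume (simplex d) < ⊤ := isCompact_simplex.measure_lt_top

/-! ### Integrals of Dirichlet densities -/

lemma lintegral_simplex {α : Fin d → ℝ} {β : ℝ} (hα : ∀ i, 0 < α i) (hβ : 0 < β) :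
    ∫⁻ s in simplex d, ENNReal.ofReal ((∏ i, s i ^ (α i - 1)) * lastCoord s ^ (β - 1)) =
      ENNReal.ofReal ((∏ i, Real.Gamma (α i)) * Real.Gamma β / Real.Gamma (∑ i, α i + β)) := by
  have h := lintegral_corner d α β 1 hα hβ one_pos
  rw [Real.one_rpow, one_mul] at h
  rw [← h, ← (EuclideanSpace.volume_preserving_symm_measurableEquiv_toLp
    (Fin d)).setLIntegral_comp_preimage_emb (MeasurableEquiv.measurableEmbedding _)]
  have hpre : ((MeasurableEquiv.toLp 2 (Fin d → ℝ)).symm ⁻¹' corner d 1) = simplex d := by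
    ext s
    simp [corner, mem_simplex_iff]
  rw [hpre]
  rfl

lemma dirichletDensity_nonneg {α : Fin d → ℝ} {β : ℝ} (hα : ∀ i, 0 < α i) (hβ : 0 < β)
    {s : EuclideanSpace ℝ (Fin d)} (hs : s ∈ simplex d) : 0 ≤ dirichletDensity α β s := by
  have h0 : 0 < ∑ i, α i + β :=
      add_pos_of_nonneg_of_pos (Finset.sum_nonneg fun i _ => (hα _).le) hβ
  have h1 := Real.Gamma_pos_of_pos h0
  have h2 := Real.Gamma_pos_of_pos hβ
  have h3 : 0 < ∏ i, Real.Gamma (α i) := Finset.prod_pos fun i _ => Real.Gamma_pos_of_pos (hα _)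
  have h4 : 0 ≤ ∏ i, s i ^ (α i - 1) :=
    Finset.prod_nonneg fun i _ => Real.rpow_nonneg (simplex_coord_nonneg hs i) _
  have h5 := Real.rpow_nonneg (lastCoord_nonneg hs) (β - 1)
  unfold dirichletDensity
  positivity

@[fun_prop]
lemma measurable_dirichletDensity (α : Fin d → ℝ) (β : ℝ) :
    Measurable (dirichletDensity α β) := by
  unfold dirichletDensity
  fun_prop

lemma integrableOn_dirichletDensity {α : Fin d → ℝ} {β : ℝ} (hα : ∀ i, 0 < α i) (hβ : 0 < β) :
    IntegrableOn (dirichletDensity α β) (simplex d) ∧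
      ∫ s in simplex d, dirichletDensity α β s = 1 := by
  have h0 : 0 < ∑ i, α i + β :=
      add_pos_of_nonneg_of_pos (Finset.sum_nonneg fun i _ => (hα _).le) hβ
  have h1 := Real.Gamma_pos_of_pos h0
  have h2 := Real.Gamma_pos_of_pos hβ
  have h3 : 0 < ∏ i, Real.Gamma (α i) := Finset.prod_pos fun i _ => Real.Gamma_pos_of_pos (hα _)
  have hnn : 0 ≤ᵐ[volume.restrict (simplex d)] dirichletDensity α β :=
    (ae_restrict_iff' measurableSet_simplex).2 (ae_of_all _ fun s hs =>
      dirichletDensity_nonneg hα hβ hs)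
  have hl : ∫⁻ s in simplex d, ENNReal.ofReal (dirichletDensity α β s) = 1 := by
    have : ∀ s : EuclideanSpace ℝ (Fin d), ENNReal.ofReal (dirichletDensity α β s) =
        ENNReal.ofReal (Real.Gamma (∑ i, α i + β) / (Real.Gamma β * ∏ i, Real.Gamma (α i))) *
        ENNReal.ofReal ((∏ i, s i ^ (α i - 1)) * lastCoord s ^ (β - 1)) := by
      intro s
      rw [← ENNReal.ofReal_mul (by positivity), dirichletDensity]
      congr 1
      ring
    simp_rw [this]
    rw [lintegral_const_mul _ (by fun_prop), lintegral_simplex hα hβ,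
      ← ENNReal.ofReal_mul (by positivity), ← ENNReal.ofReal_one]
    congr 1
    field_simp
  have hm : AEStronglyMeasurable (dirichletDensity α β) (volume.restrict (simplex d)) :=
    (measurable_dirichletDensity α β).aestronglyMeasurable
  refine ⟨⟨hm, ?_⟩, ?_⟩
  · rw [hasFiniteIntegral_iff_ofReal hnn, hl]
    exact ENNReal.one_lt_top
  · rw [integral_eq_lintegral_of_nonneg_ae hnn hm, hl]
    rfl

end

noncomputable section
variable {d : ℕ}

/-! ### Moments of Dirichlet distributions -/

lemma integrableOn_mul_dirichletDensity {α : Fin d → ℝ} {β : ℝ} (hα : ∀ i, 0 < α i) (hβ : 0 < β)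
    {h : EuclideanSpace ℝ (Fin d) → ℝ} (hh : ContinuousOn h (simplex d)) :
    IntegrableOn (fun x => h x * dirichletDensity α β x) (simplex d) :=
  (integrableOn_dirichletDensity hα hβ).1.continuousOn_mul hh isCompact_simplex

/-- The recursion `Γ(z + 1) = z Γ(z)` absorbs a factor `x i` into the density by raising one
parameter. Iterating it yields every moment that is needed. -/
lemma coord_mul_dirichletDensity {α : Fin d → ℝ} {β : ℝ} (hα : ∀ i, 0 < α i) (hβ : 0 < β)
    (i : Fin d) {x : EuclideanSpace ℝ (Fin d)} (hx : x ∈ simplex d) :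
    x i * dirichletDensity α β x =
      α i / (∑ j, α j + β) * dirichletDensity (Function.update α i (α i + 1)) β x := by
  have h0 : 0 < ∑ i, α i + β :=
      add_pos_of_nonneg_of_pos (Finset.sum_nonneg fun i _ => (hα _).le) hβ
  have hx0 := simplex_coord_nonneg hx i
  have hg := fun j => (Real.Gamma_pos_of_pos (hα j)).ne'
  have hsum : ∑ j, Function.update α i (α i + 1) j + β = ∑ j, α j + β + 1 := by
    rw [Finset.sum_update_of_mem (Finset.mem_univ i),
      ← Finset.add_sum_erase _ _ (Finset.mem_univ i), Finset.sdiff_singleton_eq_erase]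
    ring
  have hprod1 : ∏ j, Real.Gamma (Function.update α i (α i + 1) j) =
      α i * ∏ j, Real.Gamma (α j) := by
    rw [← Finset.mul_prod_erase _ _ (Finset.mem_univ i),
      ← Finset.mul_prod_erase _ (fun j => Real.Gamma (α j)) (Finset.mem_univ i),
      Function.update_self, Real.Gamma_add_one (hα i).ne']
    rw [mul_assoc]
    congr 2
    refine Finset.prod_congr rfl fun j hj => ?_
    rw [Function.update_of_ne (Finset.ne_of_mem_erase hj)]
  have hprod2 : ∏ j, x j ^ (Function.update α i (α i + 1) j - 1) =
      x i * ∏ j, x j ^ (α j - 1) := by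
    rw [← Finset.mul_prod_erase _ _ (Finset.mem_univ i),
      ← Finset.mul_prod_erase _ (fun j => x j ^ (α j - 1)) (Finset.mem_univ i),
      Function.update_self, ← mul_assoc]
    congr 1
    -- Here `x i` may be zero; adding exponents is still legitimate because the total exponent `α i`
    -- is nonzero.
    · rw [show α i + 1 - 1 = 1 + (α i - 1) by ring,
        Real.rpow_add' hx0 (by have := hα i; intro h; linarith), Real.rpow_one]
    · refine Finset.prod_congr rfl fun j hj => ?_
      rw [Function.update_of_ne (Finset.ne_of_mem_erase hj)]
  rw [dirichletDensity, dirichletDensity, hsum, hprod1, hprod2, Real.Gamma_add_one h0.ne']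
  have hβ' := (Real.Gamma_pos_of_pos hβ).ne'
  have hP : ∏ j, Real.Gamma (α j) ≠ 0 := Finset.prod_ne_zero_iff.2 fun j _ => hg j
  have hαi := (hα i).ne'
  field_simp

lemma integral_mul_coord_mul_dirichletDensity {α : Fin d → ℝ} {β : ℝ} (hα : ∀ i, 0 < α i)
    (hβ : 0 < β) (i : Fin d) (h : EuclideanSpace ℝ (Fin d) → ℝ) :
    ∫ x in simplex d, h x * x i * dirichletDensity α β x =
      α i / (∑ j, α j + β) *
        ∫ x in simplex d, h x * dirichletDensity (Function.update α i (α i + 1)) β x := by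
  rw [← integral_const_mul]
  refine setIntegral_congr_fun measurableSet_simplex fun x hx => ?_
  have := coord_mul_dirichletDensity hα hβ i hx
  simp only [mul_assoc, this]
  ring

lemma update_add_one_pos {α : Fin d → ℝ} (hα : ∀ i, 0 < α i) (i : Fin d) (j : Fin d) :
    0 < Function.update α i (α i + 1) j := by
  by_cases h : j = i
  · subst h; simp only [Function.update_self]; linarith [hα j]
  · rw [Function.update_of_ne h]; exact hα j

lemma sum_update_add_one (α : Fin d → ℝ) (β : ℝ) (i : Fin d) :
    ∑ j, Function.update α i (α i + 1) j + β = ∑ j, α j + β + 1 := by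
  rw [Finset.sum_update_of_mem (Finset.mem_univ i),
    ← Finset.add_sum_erase _ _ (Finset.mem_univ i), Finset.sdiff_singleton_eq_erase]
  ring

lemma integral_coord_mul_dirichletDensity {α : Fin d → ℝ} {β : ℝ} (hα : ∀ i, 0 < α i)
    (hβ : 0 < β) (i : Fin d) :
    ∫ x in simplex d, x i * dirichletDensity α β x = α i / (∑ j, α j + β) := by
  have h := integral_mul_coord_mul_dirichletDensity hα hβ i (fun _ => 1)
  simp only [one_mul] at h
  rw [h, (integrableOn_dirichletDensity (update_add_one_pos hα i) hβ).2, mul_one]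

lemma integral_coord_mul_coord_mul_dirichletDensity {α : Fin d → ℝ} {β : ℝ} (hα : ∀ i, 0 < α i)
    (hβ : 0 < β) (i j : Fin d) :
    ∫ x in simplex d, x i * x j * dirichletDensity α β x =
      α i * (α j + if i = j then 1 else 0) / ((∑ j, α j + β) * (∑ j, α j + β + 1)) := by
  rw [integral_mul_coord_mul_dirichletDensity hα hβ j (fun x => x i),
    integral_coord_mul_dirichletDensity (update_add_one_pos hα j) hβ, sum_update_add_one]
  by_cases h : i = j
  · subst h
    simp only [Function.update_self, if_true]
    rw [div_mul_div_comm]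
  · rw [Function.update_of_ne h, if_neg h, add_zero, div_mul_div_comm, mul_comm (α j)]

lemma integral_coord_pow_three_mul_dirichletDensity {α : Fin d → ℝ} {β : ℝ} (hα : ∀ i, 0 < α i)
    (hβ : 0 < β) (i : Fin d) :
    ∫ x in simplex d, x i ^ 3 * dirichletDensity α β x =
      α i * (α i + 1) * (α i + 2) /
        ((∑ j, α j + β) * (∑ j, α j + β + 1) * (∑ j, α j + β + 2)) := by
  have h := integral_mul_coord_mul_dirichletDensity hα hβ i (fun x => x i * x i)
  simp_rw [pow_succ, pow_zero, one_mul]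
  rw [h, integral_coord_mul_coord_mul_dirichletDensity (update_add_one_pos hα i) hβ,
    sum_update_add_one]
  simp only [Function.update_self, if_true]
  rw [div_mul_div_comm]
  ring_nf

lemma integral_coord_pow_four_mul_dirichletDensity {α : Fin d → ℝ} {β : ℝ} (hα : ∀ i, 0 < α i)
    (hβ : 0 < β) (i : Fin d) :
    ∫ x in simplex d, x i ^ 4 * dirichletDensity α β x =
      α i * (α i + 1) * (α i + 2) * (α i + 3) /
        ((∑ j, α j + β) * (∑ j, α j + β + 1) * (∑ j, α j + β + 2) * (∑ j, α j + β + 3)) := by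
  have h := integral_mul_coord_mul_dirichletDensity hα hβ i (fun x => x i ^ 3)
  simp_rw [pow_succ _ 3]
  rw [h, integral_coord_pow_three_mul_dirichletDensity (update_add_one_pos hα i) hβ,
    sum_update_add_one]
  simp only [Function.update_self]
  rw [div_mul_div_comm]
  ring_nf

/-! ### Moments of the Dirichlet kernel -/

section Kernel

variable {s : EuclideanSpace ℝ (Fin d)} {b : ℝ}

lemma kernel_param_pos (hs : s ∈ simplex d) (hb : 0 < b) (i : Fin d) : 0 < s i / b + 1 := by
  have := simplex_coord_nonneg hs i
  positivity

lemma kernel_param_last_pos (hs : s ∈ simplex d) (hb : 0 < b) : 0 < lastCoord s / b + 1 := by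
  have := lastCoord_nonneg hs
  positivity

lemma kernel_param_sum (s : EuclideanSpace ℝ (Fin d)) (b : ℝ) :
    ∑ i, (s i / b + 1) + (lastCoord s / b + 1) = 1 / b + (d + 1) := by
  simp only [Finset.sum_add_distrib, ← Finset.sum_div, lastCoord, Finset.sum_const,
    Finset.card_univ, Fintype.card_fin, nsmul_eq_mul, mul_one]
  ring

lemma dirichletKernel_nonneg (hs : s ∈ simplex d) (hb : 0 < b) {x : EuclideanSpace ℝ (Fin d)}
    (hx : x ∈ simplex d) : 0 ≤ dirichletKernel s b x :=
  dirichletDensity_nonneg (kernel_param_pos hs hb) (kernel_param_last_pos hs hb) hx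

lemma integrableOn_dirichletKernel (hs : s ∈ simplex d) (hb : 0 < b) :
    IntegrableOn (dirichletKernel s b) (simplex d) :=
  (integrableOn_dirichletDensity (kernel_param_pos hs hb) (kernel_param_last_pos hs hb)).1

lemma integral_dirichletKernel (hs : s ∈ simplex d) (hb : 0 < b) :
    ∫ x in simplex d, dirichletKernel s b x = 1 :=
  (integrableOn_dirichletDensity (kernel_param_pos hs hb) (kernel_param_last_pos hs hb)).2

lemma integrableOn_mul_dirichletKernel (hs : s ∈ simplex d) (hb : 0 < b)
    {h : EuclideanSpace ℝ (Fin d) → ℝ} (hh : ContinuousOn h (simplex d)) :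
    IntegrableOn (fun x => h x * dirichletKernel s b x) (simplex d) :=
  integrableOn_mul_dirichletDensity (kernel_param_pos hs hb) (kernel_param_last_pos hs hb) hh

lemma kernel_mean (hs : s ∈ simplex d) (hb : 0 < b) (i : Fin d) :
    ∫ x in simplex d, x i * dirichletKernel s b x = (s i + b) / (1 + (d + 1) * b) := by
  have h := integral_coord_mul_dirichletDensity (kernel_param_pos hs hb)
    (kernel_param_last_pos hs hb) i
  rw [kernel_param_sum] at h
  rw [show dirichletKernel s b = dirichletDensity _ _ from rfl, h]
  field_simp

/-- The numerator is the coefficient of the gradient in `biasFun`: the parameters `s i / b + 1`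
shift the mean towards the barycentre. -/
lemma kernel_mean_sub (hs : s ∈ simplex d) (hb : 0 < b) (i : Fin d) :
    ∫ x in simplex d, (x i - s i) * dirichletKernel s b x =
      b * ((1 - (d + 1) * s i) / (1 + (d + 1) * b)) := by
  simp_rw [sub_mul]
  rw [integral_sub (integrableOn_mul_dirichletKernel hs hb (by fun_prop))
    (integrableOn_mul_dirichletKernel hs hb (by fun_prop)), integral_const_mul,
    kernel_mean hs hb, integral_dirichletKernel hs hb]
  field_simp
  ring

lemma kernel_mixed_moment (hs : s ∈ simplex d) (hb : 0 < b) (i j : Fin d) :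
    ∫ x in simplex d, x i * x j * dirichletKernel s b x =
      (s i + b) * (s j + b + if i = j then b else 0) /
        ((1 + (d + 1) * b) * (1 + (d + 2) * b)) := by
  have h := integral_coord_mul_coord_mul_dirichletDensity (kernel_param_pos hs hb)
    (kernel_param_last_pos hs hb) i j
  rw [kernel_param_sum] at h
  rw [show dirichletKernel s b = dirichletDensity _ _ from rfl, h]
  split_ifs <;> field_simp <;> ring

/-- The part of order `b` carries `s i * (1_{i = j} - s j)`, the coefficient of the Hessian in
`biasFun`. -/
lemma kernel_mixed_central (hs : s ∈ simplex d) (hb : 0 < b) (i j : Fin d) :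
    ∫ x in simplex d, (x i - s i) * (x j - s j) * dirichletKernel s b x =
      b * ((s i * ((if i = j then 1 else 0) - s j) + b * (1 + (if i = j then 1 else 0)
        - (s i + s j) * (d + 2) + s i * s j * (d + 1) * (d + 2))) /
        ((1 + (d + 1) * b) * (1 + (d + 2) * b))) := by
  have hint : ∀ h : EuclideanSpace ℝ (Fin d) → ℝ, Continuous h →
      IntegrableOn (fun x => h x * dirichletKernel s b x) (simplex d) :=
    fun h hh => integrableOn_mul_dirichletKernel hs hb hh.continuousOn
  have hexp : ∀ x : EuclideanSpace ℝ (Fin d), (x i - s i) * (x j - s j) * dirichletKernel s b x =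
      x i * x j * dirichletKernel s b x - s j * (x i * dirichletKernel s b x) -
        s i * ((x j - s j) * dirichletKernel s b x) := by
    intro x; ring
  simp_rw [hexp]
  rw [integral_sub (by
      exact (hint (fun x => x i * x j) (by fun_prop)).sub
        ((hint (fun x => x i) (by fun_prop)).const_mul _))
      (by exact (hint (fun x => x j - s j) (by fun_prop)).const_mul _),
    integral_sub (hint (fun x => x i * x j) (by fun_prop))
      (by exact (hint (fun x => x i) (by fun_prop)).const_mul _),
    integral_const_mul, integral_const_mul, kernel_mean hs hb, kernel_mean_sub hs hb,
    kernel_mixed_moment hs hb]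
  split_ifs <;> field_simp <;> ring

/-- Only the factor `b ^ 2` matters: it makes the fourth moment negligible against `b` and so
controls Taylor remainders far from `s`. -/
lemma exists_kernel_fourth_central (hs : s ∈ simplex d) (i : Fin d) :
    ∃ p q r : ℝ, ∀ b : ℝ, 0 < b →
      ∫ x in simplex d, (x i - s i) ^ 4 * dirichletKernel s b x =
        b ^ 2 * ((p + b * q + b ^ 2 * r) /
          ((1 + (d + 1) * b) * (1 + (d + 2) * b) * (1 + (d + 3) * b) * (1 + (d + 4) * b))) := by
  -- The witnesses are the coefficients of `b^2`, `b^3` and `b^4` in the numerator over the common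
  -- denominator; those of `b^0` and `b^1` cancel.
  refine ⟨3 * s i ^ 2 - 6 * s i ^ 3 + 3 * s i ^ 4, 26 * s i
        - 20 * s i ^ 2 * (d + 1) - 72 * s i ^ 2 + 6 * s i ^ 3 * (d + 1) ^ 2
        + 42 * s i ^ 3 * (d + 1) + 64 * s i ^ 3 - 6 * s i ^ 4 * (d + 1) ^ 2
        - 22 * s i ^ 4 * (d + 1) - 18 * s i ^ 4, 24 - 24 * s i * (d + 1) - 72 * s i
        + 12 * s i ^ 2 * (d + 1) ^ 2 + 60 * s i ^ 2 * (d + 1) + 72 * s i ^ 2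
        - 4 * s i ^ 3 * (d + 1) ^ 3 - 24 * s i ^ 3 * (d + 1) ^ 2 - 44 * s i ^ 3 * (d + 1)
        - 24 * s i ^ 3 + s i ^ 4 * (d + 1) ^ 4 + 6 * s i ^ 4 * (d + 1) ^ 3
        + 11 * s i ^ 4 * (d + 1) ^ 2 + 6 * s i ^ 4 * (d + 1), fun b hb => ?_⟩
  have hint : ∀ h : EuclideanSpace ℝ (Fin d) → ℝ, Continuous h →
      IntegrableOn (fun x => h x * dirichletKernel s b x) (simplex d) :=
    fun h hh => integrableOn_mul_dirichletKernel hs hb hh.continuousOn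
  have h3 := integral_coord_pow_three_mul_dirichletDensity (kernel_param_pos hs hb)
    (kernel_param_last_pos hs hb) i
  have h4 := integral_coord_pow_four_mul_dirichletDensity (kernel_param_pos hs hb)
    (kernel_param_last_pos hs hb) i
  rw [kernel_param_sum] at h3 h4
  change ∫ x in simplex d, x i ^ 3 * dirichletKernel s b x = _ at h3
  change ∫ x in simplex d, x i ^ 4 * dirichletKernel s b x = _ at h4
  have h2 := kernel_mixed_moment hs hb i i
  simp only [if_true] at h2
  have hexp : ∀ x : EuclideanSpace ℝ (Fin d), (x i - s i) ^ 4 * dirichletKernel s b x =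
      x i ^ 4 * dirichletKernel s b x - (4 * s i) * (x i ^ 3 * dirichletKernel s b x)
        + (6 * s i ^ 2) * (x i * x i * dirichletKernel s b x)
        - ((4 * s i ^ 3) * (x i * dirichletKernel s b x) - s i ^ 4 * dirichletKernel s b x) := by
    intro x; ring
  have i1 := (hint (fun x => x i) (by fun_prop)).const_mul (4 * s i ^ 3)
  have i0 := (integrableOn_dirichletKernel hs hb).const_mul (s i ^ 4)
  have i2 := (hint (fun x => x i * x i) (by fun_prop)).const_mul (6 * s i ^ 2)
  have i3 := (hint (fun x => x i ^ 3) (by fun_prop)).const_mul (4 * s i)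
  have i4 := hint (fun x => x i ^ 4) (by fun_prop)
  simp_rw [hexp]
  rw [integral_sub (by exact (i4.sub i3).add i2) (by exact i1.sub i0),
    integral_add (by exact i4.sub i3) (by exact i2), integral_sub i4 i3, integral_sub i1 i0]
  simp only [integral_const_mul]
  rw [h4, h3, h2, kernel_mean hs hb, integral_dirichletKernel hs hb]
  have hr : ∀ k : ℝ, 1 / b + ((d : ℝ) + 1) + k = (1 + (d + 1 + k) * b) / b := by
    intro k; field_simp; ring
  have hr0 : 1 / b + ((d : ℝ) + 1) = (1 + (d + 1) * b) / b := by field_simp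
  have hp : ∀ k : ℝ, s i / b + 1 + k = (s i + (1 + k) * b) / b := by
    intro k; field_simp
    ring
  have hp0 : s i / b + 1 = (s i + b) / b := by field_simp
  rw [hr, hr, hr, hr0, hp, hp, hp, hp0]
  rw [show (d : ℝ) + 1 + 1 = d + 2 by ring, show (d : ℝ) + 1 + 2 = d + 3 by ring,
    show (d : ℝ) + 1 + 3 = d + 4 by ring]
  field_simp
  ring

lemma kernel_mean_sub_abs_le (hs : s ∈ simplex d) (hb : 0 < b) (i : Fin d) :
    |∫ x in simplex d, (x i - s i) * dirichletKernel s b x| ≤ (d + 1) * b := by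
  rw [kernel_mean_sub hs hb, abs_mul, abs_of_pos hb, mul_comm]
  gcongr
  rw [abs_div, abs_of_pos (by positivity : 0 < 1 + ((d : ℝ) + 1) * b)]
  have h1 := simplex_coord_nonneg hs i
  have h2 := simplex_coord_le_one hs i
  rw [div_le_iff₀ (by positivity), abs_le]
  have hd : (0 : ℝ) ≤ d := Nat.cast_nonneg d
  constructor <;> nlinarith [mul_nonneg hd hb.le, mul_nonneg hd h1, mul_nonneg hd (sub_nonneg.2 h2),
    mul_nonneg hd (mul_nonneg hd hb.le)]

lemma kernel_second_central_le (hs : s ∈ simplex d) (hb : 0 < b) (hb1 : b ≤ 1) :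
    ∫ x in simplex d, ‖x - s‖ ^ 2 * dirichletKernel s b x ≤
      d * (3 + (d + 1) * (d + 2)) * b := by
  have hint : ∀ h : EuclideanSpace ℝ (Fin d) → ℝ, Continuous h →
      IntegrableOn (fun x => h x * dirichletKernel s b x) (simplex d) :=
    fun h hh => integrableOn_mul_dirichletKernel hs hb hh.continuousOn
  have hexp : ∀ x : EuclideanSpace ℝ (Fin d), ‖x - s‖ ^ 2 * dirichletKernel s b x =
      ∑ i, (x i - s i) * (x i - s i) * dirichletKernel s b x := by
    intro x
    rw [EuclideanSpace.norm_sq_eq, Finset.sum_mul]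
    simp [sq]
  simp_rw [hexp]
  rw [integral_finsetSum _ (fun i _ => hint (fun x => (x i - s i) * (x i - s i)) (by fun_prop))]
  refine (Finset.sum_le_card_nsmul _ _ ((3 + (d + 1) * (d + 2)) * b) fun i _ => ?_).trans_eq ?_
  · rw [kernel_mixed_central hs hb, mul_comm]
    gcongr
    have h1 := simplex_coord_nonneg hs i
    have h2 := simplex_coord_le_one hs i
    have hd : (0 : ℝ) ≤ d := Nat.cast_nonneg d
    rw [div_le_iff₀ (by positivity), if_pos rfl]
    have hden : 1 ≤ (1 + ((d : ℝ) + 1) * b) * (1 + (d + 2) * b) :=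
      one_le_mul_of_one_le_of_one_le (by nlinarith [mul_nonneg hd hb.le])
        (by nlinarith [mul_nonneg hd hb.le])
    have hnum : s i * (1 - s i) + b * (1 + 1 - (s i + s i) * (d + 2)
        + s i * s i * (d + 1) * (d + 2)) ≤ 3 + (d + 1) * (d + 2) := by
      have e1 : s i * (1 - s i) ≤ 1 := by nlinarith
      have e2 : s i * s i ≤ 1 := by nlinarith
      have e3 : s i * s i * ((d + 1) * (d + 2)) ≤ 1 * (((d : ℝ) + 1) * (d + 2)) := by
        gcongr
      have e4 : 0 ≤ (s i + s i) * ((d : ℝ) + 2) := by positivity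
      have e5 : 1 + 1 - (s i + s i) * ((d : ℝ) + 2) + s i * s i * (d + 1) * (d + 2) ≤
          2 + (d + 1) * (d + 2) := by linarith
      have e6 : b * (1 + 1 - (s i + s i) * ((d : ℝ) + 2) + s i * s i * (d + 1) * (d + 2)) ≤
          1 * (2 + (d + 1) * (d + 2)) := by
        refine (mul_le_mul_of_nonneg_left e5 hb.le).trans ?_
        gcongr
      linarith
    refine hnum.trans (le_mul_of_one_le_right (by positivity) hden)
  · simp; ring

lemma tendsto_kernel_mean_sub_div (hs : s ∈ simplex d) (i : Fin d) :
    Tendsto (fun b => (∫ x in simplex d, (x i - s i) * dirichletKernel s b x) / b) (𝓝[>] 0)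
      (𝓝 (1 - (d + 1) * s i)) := by
  have hc : Tendsto (fun b : ℝ => (1 - (d + 1) * s i) / (1 + (d + 1) * b)) (𝓝[>] 0)
      (𝓝 ((1 - (d + 1) * s i) / (1 + (d + 1) * 0))) := by
    refine Tendsto.mono_left ?_ nhdsWithin_le_nhds
    exact Tendsto.div tendsto_const_nhds (Continuous.tendsto (by fun_prop) 0) (by simp)
  rw [mul_zero, add_zero, div_one] at hc
  refine hc.congr' ?_
  filter_upwards [self_mem_nhdsWithin] with b (hb : 0 < b)
  rw [kernel_mean_sub hs hb, mul_div_cancel_left₀ _ hb.ne']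

lemma tendsto_kernel_mixed_central_div (hs : s ∈ simplex d) (i j : Fin d) :
    Tendsto (fun b => (∫ x in simplex d, (x i - s i) * (x j - s j) * dirichletKernel s b x) / b)
      (𝓝[>] 0) (𝓝 (s i * ((if i = j then 1 else 0) - s j))) := by
  have hc : Tendsto (fun b : ℝ => (s i * ((if i = j then 1 else 0) - s j)
        + b * (1 + (if i = j then 1 else 0)
        - (s i + s j) * (d + 2) + s i * s j * (d + 1) * (d + 2))) /
        ((1 + (d + 1) * b) * (1 + (d + 2) * b))) (𝓝[>] 0)
      (𝓝 ((s i * ((if i = j then 1 else 0) - s j) + 0 * (1 + (if i = j then 1 else 0)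
        - (s i + s j) * (d + 2) + s i * s j * (d + 1) * (d + 2))) /
        ((1 + (d + 1) * 0) * (1 + (d + 2) * 0)))) := by
    refine Tendsto.mono_left ?_ nhdsWithin_le_nhds
    exact Tendsto.div (Continuous.tendsto (by fun_prop) 0) (Continuous.tendsto (by fun_prop) 0)
      (by simp)
  simp only [mul_zero, add_zero, zero_mul, mul_one, div_one] at hc
  refine hc.congr' ?_
  filter_upwards [self_mem_nhdsWithin] with b (hb : 0 < b)
  rw [kernel_mixed_central hs hb, mul_div_cancel_left₀ _ hb.ne']

lemma tendsto_kernel_fourth_central_div (hs : s ∈ simplex d) (i : Fin d) :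
    Tendsto (fun b => (∫ x in simplex d, (x i - s i) ^ 4 * dirichletKernel s b x) / b)
      (𝓝[>] 0) (𝓝 0) := by
  have hc : ∀ p q r : ℝ, Tendsto (fun b : ℝ => b * ((p + b * q + b ^ 2 * r) /
      ((1 + (d + 1) * b) * (1 + (d + 2) * b) * (1 + (d + 3) * b) * (1 + (d + 4) * b))))
      (𝓝[>] 0) (𝓝 (0 * ((p + 0 * q + 0 ^ 2 * r) /
      ((1 + (d + 1) * 0) * (1 + (d + 2) * 0) * (1 + (d + 3) * 0) * (1 + (d + 4) * 0))))) := by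
    intro p q r
    refine Tendsto.mono_left ?_ nhdsWithin_le_nhds
    exact tendsto_id.mul (Tendsto.div (Continuous.tendsto (by fun_prop) 0)
      (Continuous.tendsto (by fun_prop) 0) (by simp))
  simp only [zero_mul] at hc
  obtain ⟨p, q, r, h⟩ := exists_kernel_fourth_central hs i
  refine (hc p q r).congr' ?_
  filter_upwards [self_mem_nhdsWithin] with b (hb : 0 < b)
  rw [h b hb, eq_div_iff hb.ne']
  ring

lemma tendsto_kernel_norm_pow_four_div (hs : s ∈ simplex d) :
    Tendsto (fun b => (∫ x in simplex d, ‖x - s‖ ^ 4 * dirichletKernel s b x) / b)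
      (𝓝[>] 0) (𝓝 0) := by
  have h := (tendsto_finsetSum Finset.univ fun i _ =>
    tendsto_kernel_fourth_central_div hs i).const_mul (d : ℝ)
  simp only [Finset.sum_const_zero, mul_zero] at h
  refine squeeze_zero' ?_ ?_ h
  · filter_upwards [self_mem_nhdsWithin] with b (hb : 0 < b)
    refine div_nonneg (setIntegral_nonneg measurableSet_simplex fun x hx => ?_) hb.le
    exact mul_nonneg (by positivity) (dirichletKernel_nonneg hs hb hx)
  · filter_upwards [self_mem_nhdsWithin] with b (hb : 0 < b)
    rw [← Finset.sum_div, ← mul_div_assoc]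
    gcongr
    have hint : ∀ h : EuclideanSpace ℝ (Fin d) → ℝ, Continuous h →
        IntegrableOn (fun x => h x * dirichletKernel s b x) (simplex d) :=
      fun h hh => integrableOn_mul_dirichletKernel hs hb hh.continuousOn
    rw [← integral_finsetSum _ (fun i _ => hint (fun x => (x i - s i) ^ 4) (by fun_prop)),
      ← integral_const_mul]
    refine setIntegral_mono_on (hint (fun x => ‖x - s‖ ^ 4) (by fun_prop)) ?_
      measurableSet_simplex fun x hx => ?_
    · exact (integrable_finsetSum _ fun i _ =>
        hint (fun x => (x i - s i) ^ 4) (by fun_prop)).const_mul _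
    · rw [← Finset.sum_mul, ← mul_assoc]
      refine mul_le_mul_of_nonneg_right ?_ (dirichletKernel_nonneg hs hb hx)
      have h1 : ‖x - s‖ ^ 2 = ∑ i, (x i - s i) ^ 2 := by
        rw [EuclideanSpace.norm_sq_eq]; simp
      -- Cauchy-Schwarz reduces the fourth power of the norm to the fourth powers of the
      -- coordinates.
      have h2 := sq_sum_le_card_mul_sum_sq (s := Finset.univ) (f := fun i => (x i - s i) ^ 2)
      rw [← h1, ← pow_mul] at h2
      simpa [← pow_mul] using h2

end Kernel

end

noncomputable section
variable {d : ℕ}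

/-! ### Ratios of Gamma functions -/

/-- Log-convexity of Gamma at a midpoint. Applied at `z, z + 1` and at `z + 1/2, z + 3/2`, it
brackets `gammaRatio z ^ 2` between `1 / (z + 1/2)` and `1 / z`, which replaces Stirling's formula.
-/
lemma Gamma_midpoint_sq_le {s t : ℝ} (hs : 0 < s) (ht : 0 < t) :
    Real.Gamma ((s + t) / 2) ^ 2 ≤ Real.Gamma s * Real.Gamma t := by
  have h := Real.Gamma_mul_add_mul_le_rpow_Gamma_mul_rpow_Gamma hs ht
    (a := 1 / 2) (b := 1 / 2) (by norm_num) (by norm_num) (by norm_num)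
  rw [← Real.sqrt_eq_rpow, ← Real.sqrt_eq_rpow, show 1 / 2 * s + 1 / 2 * t = (s + t) / 2 by ring] at h
  have h1 := Real.Gamma_pos_of_pos hs
  have h2 := Real.Gamma_pos_of_pos ht
  have h3 := Real.Gamma_pos_of_pos (by linarith : 0 < (s + t) / 2)
  calc _ ≤ (√(Real.Gamma s) * √(Real.Gamma t)) ^ 2 := by gcongr
    _ = _ := by rw [mul_pow, Real.sq_sqrt h1.le, Real.sq_sqrt h2.le]

/-- The ratio `Γ(z + 1/2) / Γ(z + 1)`. -/
def gammaRatio (z : ℝ) : ℝ := Real.Gamma (z + 1 / 2) / Real.Gamma (z + 1)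

lemma gammaRatio_pos {z : ℝ} (hz : 0 ≤ z) : 0 < gammaRatio z :=
  div_pos (Real.Gamma_pos_of_pos (by linarith)) (Real.Gamma_pos_of_pos (by linarith))

lemma gammaRatio_sq_le {z : ℝ} (hz : 0 < z) : gammaRatio z ^ 2 ≤ 1 / z := by
  have h := Gamma_midpoint_sq_le hz (by linarith : 0 < z + 1)
  rw [show (z + (z + 1)) / 2 = z + 1 / 2 by ring] at h
  have h1 := Real.Gamma_pos_of_pos (by linarith : 0 < z + 1)
  rw [gammaRatio, div_pow, div_le_div_iff₀ (by positivity) hz, one_mul, sq (Real.Gamma (z + 1))]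
  have h2 := Real.Gamma_add_one hz.ne'
  calc _ ≤ Real.Gamma z * Real.Gamma (z + 1) * z := by gcongr
    _ = (z * Real.Gamma z) * Real.Gamma (z + 1) := by ring
    _ = _ := by rw [← h2]

lemma le_gammaRatio_sq {z : ℝ} (hz : 0 ≤ z) : 1 / (z + 1 / 2) ≤ gammaRatio z ^ 2 := by
  have hz' : 0 < z + 1 / 2 := by linarith
  have h := Gamma_midpoint_sq_le hz' (by linarith : 0 < z + 1 / 2 + 1)
  rw [show (z + 1 / 2 + (z + 1 / 2 + 1)) / 2 = z + 1 by ring, Real.Gamma_add_one hz'.ne'] at h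
  have h1 := Real.Gamma_pos_of_pos (by linarith : 0 < z + 1)
  rw [gammaRatio, div_pow, div_le_div_iff₀ hz' (by positivity)]
  linarith

/-- Legendre's duplication formula. Such quotients arise because squaring the kernel doubles each
exponent `s i / b`. -/
lemma Gamma_two_mul_add_one_div {z : ℝ} (hz : 0 ≤ z) :
    Real.Gamma (2 * z + 1) / Real.Gamma (z + 1) ^ 2 = 4 ^ z * (√Real.pi)⁻¹ * gammaRatio z := by
  have h := Real.Gamma_mul_Gamma_add_half (z + 1 / 2)
  rw [show z + 1 / 2 + 1 / 2 = z + 1 by ring, show 2 * (z + 1 / 2) = 2 * z + 1 by ring,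
    show 1 - (2 * z + 1) = -(2 * z) by ring, Real.rpow_neg (by norm_num),
    Real.rpow_mul (by norm_num), show (2 : ℝ) ^ (2 : ℝ) = 4 by norm_num] at h
  have h1 := (Real.Gamma_pos_of_pos (by linarith : 0 < z + 1)).ne'
  have h2 : (4 : ℝ) ^ z ≠ 0 := (Real.rpow_pos_of_pos (by norm_num) z).ne'
  have h3 : √Real.pi ≠ 0 := (Real.sqrt_pos.2 Real.pi_pos).ne'
  rw [gammaRatio]
  field_simp at h ⊢
  linarith

lemma tendsto_sqrt_mul_gammaRatio {a : ℝ} (ha : 0 < a) :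
    Tendsto (fun w => √w * gammaRatio (a * w)) atTop (𝓝 (√a)⁻¹) := by
  have h : Tendsto (fun w => w * gammaRatio (a * w) ^ 2) atTop (𝓝 a⁻¹) := by
    have hl : Tendsto (fun w : ℝ => (a + (1 / 2) * w⁻¹)⁻¹) atTop (𝓝 a⁻¹) := by
      have := ((tendsto_inv_atTop_zero (𝕜 := ℝ)).const_mul (1 / 2)).const_add a
      rw [mul_zero, add_zero] at this
      exact this.inv₀ ha.ne'
    refine tendsto_of_tendsto_of_tendsto_of_le_of_le' hl tendsto_const_nhds ?_ ?_
    · filter_upwards [eventually_gt_atTop 0] with w hw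
      have := le_gammaRatio_sq (z := a * w) (by positivity)
      calc _ = w * (1 / (a * w + 1 / 2)) := by field_simp
        _ ≤ _ := by gcongr
    · filter_upwards [eventually_gt_atTop 0] with w hw
      have := gammaRatio_sq_le (z := a * w) (by positivity)
      calc _ ≤ w * (1 / (a * w)) := by gcongr
        _ = _ := by field_simp
  have h2 := h.sqrt
  rw [Real.sqrt_inv] at h2
  refine h2.congr' ?_
  filter_upwards [eventually_ge_atTop 0] with w hw
  rw [Real.sqrt_mul hw, Real.sqrt_sq (gammaRatio_pos (by positivity)).le]

/-- The limiting value is also an upper bound for every `w`, which is what allows `psi` to serve as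
a dominating function. -/
lemma sqrt_mul_gammaRatio_le {a w : ℝ} (ha : 0 < a) (hw : 0 < w) :
    √w * gammaRatio (a * w) ≤ (√a)⁻¹ := by
  have h := gammaRatio_sq_le (z := a * w) (by positivity)
  rw [← Real.sqrt_inv]
  refine Real.le_sqrt_of_sq_le ?_
  rw [mul_pow, Real.sq_sqrt hw.le]
  calc _ ≤ w * (1 / (a * w)) := by gcongr
    _ = _ := by field_simp

/-- With `w = 1 / b`, peeling off the shift by `d` leaves rational factors, each tending to `1/2`
once a power of `w` is extracted, and one more duplication quotient. -/
lemma Gamma_add_nat_sq_div (d : ℕ) {w : ℝ} (hw : 0 < w) :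
    Real.Gamma (w + (d + 1)) ^ 2 / Real.Gamma (2 * w + (d + 1)) =
      w ^ d * (∏ k ∈ Finset.range d, (w + k + 1) ^ 2 / (w * (2 * w + k + 1))) *
        (4 ^ w * (√Real.pi)⁻¹ * gammaRatio w)⁻¹ := by
  induction d with
  | zero =>
    rw [← Gamma_two_mul_add_one_div hw.le, inv_div]
    simp
  | succ d ih =>
    have e1 : w + ((d + 1 : ℕ) + 1 : ℝ) = w + (d + 1) + 1 := by push_cast; ring
    have e2 : 2 * w + ((d + 1 : ℕ) + 1 : ℝ) = 2 * w + (d + 1) + 1 := by push_cast; ring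
    have p1 : 0 < w + ((d : ℝ) + 1) := by positivity
    have p2 : 0 < 2 * w + ((d : ℝ) + 1) := by positivity
    rw [e1, e2, Real.Gamma_add_one p1.ne', Real.Gamma_add_one p2.ne', mul_pow, mul_div_mul_comm, ih,
      Finset.prod_range_succ]
    have p3 := p2.ne'
    rw [← add_assoc] at p3
    field_simp
    ring

lemma tendsto_prod_range_ratio (d : ℕ) :
    Tendsto (fun w : ℝ => ∏ k ∈ Finset.range d, (w + k + 1) ^ 2 / (w * (2 * w + k + 1))) atTop
      (𝓝 ((1 / 2) ^ d)) := by
  have h : ∀ k ∈ Finset.range d, Tendsto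
      (fun w : ℝ => (w + k + 1) ^ 2 / (w * (2 * w + k + 1))) atTop (𝓝 (1 / 2)) := by
    intro k _
    have h0 : Tendsto (fun w : ℝ => ((k : ℝ) + 1) * w⁻¹) atTop (𝓝 0) := by
      simpa using (tendsto_inv_atTop_zero (𝕜 := ℝ)).const_mul ((k : ℝ) + 1)
    have h1 : Tendsto (fun w : ℝ => (1 + ((k : ℝ) + 1) * w⁻¹) ^ 2 / (2 + ((k : ℝ) + 1) * w⁻¹))
        atTop (𝓝 ((1 + 0) ^ 2 / (2 + 0))) :=
      ((h0.const_add 1).pow 2).div (h0.const_add 2) (by norm_num)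
    norm_num at h1
    refine h1.congr' ?_
    filter_upwards [eventually_gt_atTop 0] with w hw
    field_simp
    ring
  simpa using tendsto_finsetProd (Finset.range d) h

/-! ### The squared Dirichlet kernel -/

/-- The normalizing constant of the Dirichlet kernel. -/
def kernelConst (s : EuclideanSpace ℝ (Fin d)) (b : ℝ) : ℝ :=
  Real.Gamma (1 / b + (d + 1)) /
    (Real.Gamma (lastCoord s / b + 1) * ∏ i, Real.Gamma (s i / b + 1))

lemma dirichletKernel_eq (s : EuclideanSpace ℝ (Fin d)) (b : ℝ) (x : EuclideanSpace ℝ (Fin d)) :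
    dirichletKernel s b x =
      kernelConst s b * (lastCoord x ^ (lastCoord s / b) * ∏ i, x i ^ (s i / b)) := by
  simp only [dirichletKernel, dirichletDensity, kernel_param_sum, kernelConst, add_sub_cancel_right,
    mul_assoc]

lemma kernelConst_pos {s : EuclideanSpace ℝ (Fin d)} (hs : s ∈ simplex d) {b : ℝ} (hb : 0 < b) :
    0 < kernelConst s b := by
  refine div_pos (Real.Gamma_pos_of_pos (by positivity)) (mul_pos
    (Real.Gamma_pos_of_pos (kernel_param_last_pos hs hb))
    (Finset.prod_pos fun i _ => Real.Gamma_pos_of_pos (kernel_param_pos hs hb i)))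

/-- The integral of the squared Dirichlet kernel. -/
def kernelEnergy (s : EuclideanSpace ℝ (Fin d)) (b : ℝ) : ℝ :=
  kernelConst s b ^ 2 / kernelConst s (b / 2)

lemma kernelEnergy_pos {s : EuclideanSpace ℝ (Fin d)} (hs : s ∈ simplex d) {b : ℝ} (hb : 0 < b) :
    0 < kernelEnergy s b :=
  div_pos (pow_pos (kernelConst_pos hs hb) 2) (kernelConst_pos hs (half_pos hb))

/-- Doubling the exponents `s i / b` amounts to halving `b`, so the squared kernel is again a
Dirichlet kernel up to a constant. The variance is thereby turned into an average over a probability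
density. -/
lemma dirichletKernel_sq {s : EuclideanSpace ℝ (Fin d)} (hs : s ∈ simplex d) {b : ℝ} (hb : 0 < b)
    {x : EuclideanSpace ℝ (Fin d)} (hx : x ∈ simplex d) :
    dirichletKernel s b x ^ 2 = kernelEnergy s b * dirichletKernel s (b / 2) x := by
  have hpow : ∀ {y z : ℝ}, 0 ≤ y → y ^ (z / (b / 2)) = (y ^ (z / b)) ^ 2 := by
    intro y z hy
    rw [← Real.rpow_mul_natCast hy]
    congr 1
    push_cast
    field_simp
  rw [dirichletKernel_eq, dirichletKernel_eq, hpow (lastCoord_nonneg hx),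
    Finset.prod_congr rfl fun i _ => hpow (z := s i) (simplex_coord_nonneg hx i),
    Finset.prod_pow, kernelEnergy]
  have := (kernelConst_pos hs (half_pos hb)).ne'
  field_simp

/-- The powers of 4 from the duplication formula cancel because the barycentric coordinates sum to
one, and the powers of `w` balance. The part outside the last bracket does not depend on `s`, which
gives uniformity later. -/
lemma rpow_mul_kernelEnergy {s : EuclideanSpace ℝ (Fin d)} (hs : s ∈ simplex d) {w : ℝ}
    (hw : 0 < w) :
    w⁻¹ ^ ((d : ℝ) / 2) * kernelEnergy s w⁻¹ =
      (∏ k ∈ Finset.range d, (w + k + 1) ^ 2 / (w * (2 * w + k + 1))) *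
        (√w * gammaRatio w)⁻¹ * ((√Real.pi)⁻¹ ^ d) *
        ((√w * gammaRatio (lastCoord s * w)) * ∏ i, (√w * gammaRatio (s i * w))) := by
  have h1 : kernelEnergy s w⁻¹ = (Real.Gamma (w + (d + 1)) ^ 2 / Real.Gamma (2 * w + (d + 1))) *
      ((Real.Gamma (2 * (lastCoord s * w) + 1) / Real.Gamma (lastCoord s * w + 1) ^ 2) *
        ∏ i, (Real.Gamma (2 * (s i * w) + 1) / Real.Gamma (s i * w + 1) ^ 2)) := by
    have e1 : ∀ z : ℝ, z / w⁻¹ = z * w := fun z => by field_simp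
    have e2 : ∀ z : ℝ, z / (w⁻¹ / 2) = 2 * (z * w) := fun z => by field_simp
    simp only [kernelEnergy, kernelConst, e1, e2, one_mul, Finset.prod_div_distrib, Finset.prod_pow]
    have g1 : Real.Gamma (2 * w + (d + 1)) ≠ 0 := (Real.Gamma_pos_of_pos (by positivity)).ne'
    have hl := lastCoord_nonneg hs
    have g2 : Real.Gamma (2 * (lastCoord s * w) + 1) ≠ 0 :=
      (Real.Gamma_pos_of_pos (by positivity)).ne'
    have g3 : Real.Gamma (lastCoord s * w + 1) ≠ 0 :=
      (Real.Gamma_pos_of_pos (by positivity)).ne'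
    have g4 : ∏ i, Real.Gamma (2 * (s i * w) + 1) ≠ 0 := Finset.prod_ne_zero_iff.2 fun i _ => by
      have := simplex_coord_nonneg hs i
      exact (Real.Gamma_pos_of_pos (by positivity)).ne'
    have g5 : ∏ i, Real.Gamma (s i * w + 1) ≠ 0 := Finset.prod_ne_zero_iff.2 fun i _ => by
      have := simplex_coord_nonneg hs i
      exact (Real.Gamma_pos_of_pos (by positivity)).ne'
    field_simp
  have hl := lastCoord_nonneg hs
  have h2 : ∏ i, (Real.Gamma (2 * (s i * w) + 1) / Real.Gamma (s i * w + 1) ^ 2) =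
      4 ^ (∑ i, s i * w) * (√Real.pi)⁻¹ ^ d * ∏ i, gammaRatio (s i * w) := by
    rw [Finset.prod_congr rfl fun i _ => Gamma_two_mul_add_one_div
      (mul_nonneg (simplex_coord_nonneg hs i) hw.le), Finset.prod_mul_distrib,
      Finset.prod_mul_distrib, Finset.prod_const, Finset.card_univ, Fintype.card_fin,
      ← Real.rpow_sum_of_pos (by norm_num)]
  have h4 : (4 : ℝ) ^ w = 4 ^ (lastCoord s * w) * 4 ^ (∑ i, s i * w) := by
    rw [← Real.rpow_add (by norm_num), ← Finset.sum_mul, lastCoord]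
    congr 1; ring
  have hd : w⁻¹ ^ ((d : ℝ) / 2) = (√w ^ d)⁻¹ := by
    rw [Real.inv_rpow hw.le, Real.sqrt_eq_rpow, ← Real.rpow_mul_natCast hw.le]
    congr 2; ring
  have hwd : w ^ d = √w ^ d * √w ^ d := by rw [← mul_pow, Real.mul_self_sqrt hw.le]
  rw [h1, Gamma_add_nat_sq_div d hw, Gamma_two_mul_add_one_div (mul_nonneg hl hw.le), h2, hd,
    Finset.prod_mul_distrib, Finset.prod_const, Finset.card_univ, Fintype.card_fin, h4, hwd]
  have q1 : (4 : ℝ) ^ (lastCoord s * w) ≠ 0 := (Real.rpow_pos_of_pos (by norm_num) _).ne'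
  have q2 : (4 : ℝ) ^ (∑ i, s i * w) ≠ 0 := (Real.rpow_pos_of_pos (by norm_num) _).ne'
  have q3 : √Real.pi ≠ 0 := (Real.sqrt_pos.2 Real.pi_pos).ne'
  have q4 : √w ≠ 0 := (Real.sqrt_pos.2 hw).ne'
  have q5 := (gammaRatio_pos hw.le).ne'
  field_simp

lemma psi_eq {s : EuclideanSpace ℝ (Fin d)} (hs : s ∈ simplex d) :
    psi s = (1 / 2) ^ d * (√Real.pi)⁻¹ ^ d * ((√(lastCoord s))⁻¹ * ∏ i, (√(s i))⁻¹) := by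
  have hl := lastCoord_nonneg hs
  have hp : 0 ≤ ∏ i, s i := Finset.prod_nonneg fun i _ => simplex_coord_nonneg hs i
  have hpi := Real.pi_pos
  rw [psi, Real.rpow_neg (by positivity), ← Real.sqrt_eq_rpow, Real.sqrt_mul (by positivity),
    Real.sqrt_mul (by positivity), mul_inv, mul_inv, mul_assoc]
  congr 1
  · have : √((4 * Real.pi) ^ d) = (2 * √Real.pi) ^ d := by
      rw [Real.sqrt_eq_iff_mul_self_eq (by positivity) (by positivity), ← mul_pow]
      congr 1
      have := Real.mul_self_sqrt hpi.le
      nlinarith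
    rw [this, mul_pow, mul_inv, one_div, inv_pow, inv_pow]
  · rw [Finset.prod_inv_distrib]
    congr 2
    rw [Real.sqrt_eq_rpow, ← Real.finsetProd_rpow _ _ fun i _ => simplex_coord_nonneg hs i]
    simp_rw [Real.sqrt_eq_rpow]

lemma tendsto_prefactor (d : ℕ) :
    Tendsto (fun w : ℝ => (∏ k ∈ Finset.range d, (w + k + 1) ^ 2 / (w * (2 * w + k + 1))) *
        (√w * gammaRatio w)⁻¹ * ((√Real.pi)⁻¹ ^ d)) atTop
      (𝓝 ((1 / 2) ^ d * (√Real.pi)⁻¹ ^ d)) := by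
  have h := tendsto_sqrt_mul_gammaRatio one_pos
  simp only [one_mul, Real.sqrt_one, inv_one] at h
  simpa using ((tendsto_prod_range_ratio d).mul (h.inv₀ one_ne_zero)).mul_const ((√Real.pi)⁻¹ ^ d)

/-- Up to a constant, `psi` is the Dirichlet density with all parameters equal to `1/2`. -/
lemma integrableOn_psi : IntegrableOn (psi : EuclideanSpace ℝ (Fin d) → ℝ) (simplex d) := by
  have h := (integrableOn_dirichletDensity (d := d) (α := fun _ => 1 / 2) (β := 1 / 2)
    (fun _ => by norm_num) (by norm_num)).1
  set c : ℝ := Real.Gamma (∑ _i : Fin d, (1 / 2 : ℝ) + 1 / 2) /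
    (Real.Gamma (1 / 2) * ∏ _i : Fin d, Real.Gamma (1 / 2)) with hc
  have hc0 : c ≠ 0 := by
    have h1 : 0 < Real.Gamma (1 / 2) := Real.Gamma_pos_of_pos (by norm_num)
    have h2 : 0 < Real.Gamma (∑ _i : Fin d, (1 / 2 : ℝ) + 1 / 2) :=
      Real.Gamma_pos_of_pos (by positivity)
    simp only [hc, Finset.prod_const]
    positivity
  refine IntegrableOn.congr_fun (h.const_mul ((1 / 2) ^ d * (√Real.pi)⁻¹ ^ d * c⁻¹))
    (fun s hs => ?_) measurableSet_simplex
  have hsq : ∀ {a : ℝ}, 0 ≤ a → a ^ ((1 / 2 : ℝ) - 1) = (√a)⁻¹ := by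
    intro a ha
    rw [show (1 / 2 : ℝ) - 1 = -(1 / 2) by norm_num, Real.rpow_neg ha, Real.sqrt_eq_rpow]
  simp only [dirichletDensity]
  rw [psi_eq hs, ← hc, hsq (lastCoord_nonneg hs),
    Finset.prod_congr rfl fun i _ => hsq (simplex_coord_nonneg hs i)]
  field_simp

variable [NeZero d]

lemma tendsto_rpow_mul_kernelEnergy {s : EuclideanSpace ℝ (Fin d)}
    (hs : s ∈ interior (simplex d)) :
    Tendsto (fun b => b ^ ((d : ℝ) / 2) * kernelEnergy s b) (𝓝[>] 0) (𝓝 (psi s)) := by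
  have hs' := hs
  rw [interior_simplex] at hs'
  have hmem := interior_subset hs
  have h : Tendsto (fun w : ℝ => w⁻¹ ^ ((d : ℝ) / 2) * kernelEnergy s w⁻¹) atTop (𝓝 (psi s)) := by
    rw [psi_eq hmem]
    refine ((tendsto_prefactor d).mul ((tendsto_sqrt_mul_gammaRatio hs'.2).mul
      (tendsto_finsetProd Finset.univ fun i _ =>
        tendsto_sqrt_mul_gammaRatio (hs'.1 i)))).congr' ?_
    filter_upwards [eventually_gt_atTop 0] with w hw
    rw [rpow_mul_kernelEnergy hmem hw]
  refine (h.comp tendsto_inv_nhdsGT_zero).congr fun b => ?_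
  simp

lemma exists_rpow_mul_kernelEnergy_le (d : ℕ) [NeZero d] :
    ∃ C : ℝ, 0 ≤ C ∧ ∀ᶠ b : ℝ in 𝓝[>] 0, ∀ s ∈ interior (simplex d),
      b ^ ((d : ℝ) / 2) * kernelEnergy s b ≤ C * psi s := by
  have hpi := Real.sqrt_pos.2 Real.pi_pos
  have hL : (0 : ℝ) < (1 / 2) ^ d * (√Real.pi)⁻¹ ^ d := by positivity
  -- The prefactor, independent of `s`, is eventually below twice its positive limit; the remaining
  -- factors are bounded by those of `psi` for every bandwidth.
  refine ⟨2, by norm_num, ?_⟩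
  have hev := (tendsto_prefactor d).eventually (eventually_le_nhds
    (by linarith : (1 / 2) ^ d * (√Real.pi)⁻¹ ^ d < 2 * ((1 / 2) ^ d * (√Real.pi)⁻¹ ^ d)))
  filter_upwards [tendsto_inv_nhdsGT_zero.eventually (hev.and (eventually_gt_atTop 0))]
    with b hb s hs
  have hs' := hs
  rw [interior_simplex] at hs'
  have hmem := interior_subset hs
  have h := rpow_mul_kernelEnergy hmem hb.2
  rw [inv_inv] at h
  rw [h, psi_eq hmem, ← mul_assoc 2]
  have hg : ∀ {a : ℝ}, 0 < a → 0 ≤ √b⁻¹ * gammaRatio (a * b⁻¹) := fun ha =>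
    mul_nonneg (Real.sqrt_nonneg _) (gammaRatio_pos (mul_pos ha hb.2).le).le
  refine mul_le_mul hb.1 ?_ (mul_nonneg (hg hs'.2) (Finset.prod_nonneg fun i _ => hg (hs'.1 i)))
    (by positivity)
  exact mul_le_mul (sqrt_mul_gammaRatio_le hs'.2 hb.2) (Finset.prod_le_prod
    (fun i _ => hg (hs'.1 i)) fun i _ => sqrt_mul_gammaRatio_le (hs'.1 i) hb.2)
    (Finset.prod_nonneg fun i _ => hg (hs'.1 i)) (by positivity)

end

noncomputable section
variable {d : ℕ}

/-! ### Second order Taylor expansion on the simplex -/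

lemma sum_coord_smul_single (v : EuclideanSpace ℝ (Fin d)) :
    v = ∑ i, v i • EuclideanSpace.single i (1 : ℝ) := by
  ext j
  simp [Pi.single_apply]

lemma clm_apply_eq_sum (L : EuclideanSpace ℝ (Fin d) →L[ℝ] ℝ) (v : EuclideanSpace ℝ (Fin d)) :
    L v = ∑ i, v i * L (EuclideanSpace.single i 1) := by
  conv_lhs => rw [sum_coord_smul_single v]
  simp

lemma clm_apply_apply_eq_sum
    (L : EuclideanSpace ℝ (Fin d) →L[ℝ] EuclideanSpace ℝ (Fin d) →L[ℝ] ℝ)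
    (v : EuclideanSpace ℝ (Fin d)) :
    L v v = ∑ i, ∑ j, v i * v j * L (EuclideanSpace.single i 1) (EuclideanSpace.single j 1) := by
  have h : L v v = (∑ i, v i • L (EuclideanSpace.single i 1)) v := by
    conv_lhs => rw [show L v = L (∑ i, v i • EuclideanSpace.single i (1 : ℝ)) by
      rw [← sum_coord_smul_single v]]
    simp
  rw [h]
  simp only [sum_apply, smul_apply, smul_eq_mul]
  refine Finset.sum_congr rfl fun i _ => ?_
  rw [clm_apply_eq_sum (L (EuclideanSpace.single i 1)) v, Finset.mul_sum]
  exact Finset.sum_congr rfl fun j _ => by ring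

/-- Valid for every linear form `L`; it is used with the derivative of `m` at `s`, both for the
uniform bound and for the limit. -/
lemma integral_mul_kernel_sub_eq {m : EuclideanSpace ℝ (Fin d) → ℝ}
    (hmc : ContinuousOn m (simplex d)) {s : EuclideanSpace ℝ (Fin d)} (hs : s ∈ simplex d) {b : ℝ}
    (hb : 0 < b) (L : EuclideanSpace ℝ (Fin d) →L[ℝ] ℝ) :
    (∫ x in simplex d, m x * dirichletKernel s b x) - m s =
      ∑ i, L (EuclideanSpace.single i 1) * (∫ x in simplex d, (x i - s i) * dirichletKernel s b x)
      + ∫ x in simplex d, (m x - m s - L (x - s)) * dirichletKernel s b x := by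
  have i1 := integrableOn_mul_dirichletKernel hs hb hmc
  have i2 := (integrableOn_dirichletKernel hs hb).const_mul (m s)
  have i3 : ∀ i : Fin d, IntegrableOn (fun x => L (EuclideanSpace.single i 1) *
      ((x i - s i) * dirichletKernel s b x)) (simplex d) := fun i =>
    (integrableOn_mul_dirichletKernel (h := fun x => x i - s i) hs hb (by fun_prop)).const_mul _
  have hexp : ∀ x : EuclideanSpace ℝ (Fin d),
      (m x - m s - L (x - s)) * dirichletKernel s b x =
      m x * dirichletKernel s b x - m s * dirichletKernel s b x -
        ∑ i, L (EuclideanSpace.single i 1) * ((x i - s i) * dirichletKernel s b x) := by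
    intro x
    rw [clm_apply_eq_sum L (x - s), sub_mul, sub_mul, Finset.sum_mul]
    congr 1
    refine Finset.sum_congr rfl fun i _ => ?_
    simp only [PiLp.sub_apply]
    ring
  simp_rw [hexp]
  rw [integral_sub (by exact i1.sub i2) (by exact integrable_finsetSum _ fun i _ => i3 i),
    integral_sub i1 i2, integral_finsetSum _ fun i _ => i3 i]
  simp only [integral_const_mul, integral_dirichletKernel hs hb]
  ring

section Taylor

variable [NeZero d] {m : EuclideanSpace ℝ (Fin d) → ℝ} (hm : ContDiffOn ℝ 2 m (simplex d))

include hm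

lemma contDiffOn_fderivWithin_simplex :
    ContDiffOn ℝ 1 (fderivWithin ℝ m (simplex d)) (simplex d) :=
  hm.fderivWithin uniqueDiffOn_simplex (by norm_num)

lemma continuousOn_sndFDerivWithin_simplex :
    ContinuousOn (fderivWithin ℝ (fderivWithin ℝ m (simplex d)) (simplex d)) (simplex d) :=
  (contDiffOn_fderivWithin_simplex hm).continuousOn_fderivWithin uniqueDiffOn_simplex le_rfl

lemma partialDeriv_partialDeriv {s : EuclideanSpace ℝ (Fin d)} (hs : s ∈ simplex d)
    (i j : Fin d) :
    partialDeriv i (partialDeriv j m) s =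
      fderivWithin ℝ (fderivWithin ℝ m (simplex d)) (simplex d) s
        (EuclideanSpace.single i 1) (EuclideanSpace.single j 1) := by
  have h := (((contDiffOn_fderivWithin_simplex hm).differentiableOn one_ne_zero) s
    hs).hasFDerivWithinAt
  have h2 := h.clm_apply (hasFDerivWithinAt_const (EuclideanSpace.single j (1 : ℝ)) s (simplex d))
  have h3 := h2.fderivWithin (uniqueDiffOn_simplex s hs)
  unfold partialDeriv
  rw [h3]
  simp

lemma biasFun_eq {s : EuclideanSpace ℝ (Fin d)} (hs : s ∈ simplex d) :
    biasFun m s = ∑ i, (1 - ((d : ℝ) + 1) * s i) *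
        fderivWithin ℝ m (simplex d) s (EuclideanSpace.single i 1)
      + (1 / 2) * ∑ i, ∑ j, s i * ((if i = j then (1 : ℝ) else 0) - s j) *
        fderivWithin ℝ (fderivWithin ℝ m (simplex d)) (simplex d) s
          (EuclideanSpace.single i 1) (EuclideanSpace.single j 1) := by
  simp only [biasFun, partialDeriv_partialDeriv hm hs]
  rfl

lemma continuousOn_biasFun : ContinuousOn (biasFun m) (simplex d) := by
  have h1 : ContinuousOn (fderivWithin ℝ m (simplex d)) (simplex d) :=
    (contDiffOn_fderivWithin_simplex hm).continuousOn
  have h2 := continuousOn_sndFDerivWithin_simplex hm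
  refine ContinuousOn.congr ?_ fun s hs => biasFun_eq hm hs
  refine ContinuousOn.add (continuousOn_finsetSum _ fun i _ => ?_) (continuousOn_const.mul
    (continuousOn_finsetSum _ fun i _ => continuousOn_finsetSum _ fun j _ => ?_))
  · exact ContinuousOn.mul (by fun_prop) (h1.clm_apply continuousOn_const)
  · exact ContinuousOn.mul (by fun_prop) ((h2.clm_apply continuousOn_const).clm_apply
      continuousOn_const)

lemma exists_norm_fderivWithin_le :
    ∃ C : ℝ, 0 ≤ C ∧ ∀ x ∈ simplex d, ‖fderivWithin ℝ m (simplex d) x‖ ≤ C := by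
  obtain ⟨C, hC⟩ := isCompact_simplex.exists_bound_of_continuousOn
    (contDiffOn_fderivWithin_simplex hm).continuousOn
  exact ⟨max C 0, le_max_right _ _, fun x hx => (hC x hx).trans (le_max_left _ _)⟩

lemma exists_norm_sndFDerivWithin_le :
    ∃ C : ℝ, 0 ≤ C ∧ ∀ x ∈ simplex d,
      ‖fderivWithin ℝ (fderivWithin ℝ m (simplex d)) (simplex d) x‖ ≤ C := by
  have hc : ContinuousOn (fun x => ‖fderivWithin ℝ (fderivWithin ℝ m (simplex d)) (simplex d) x‖)
      (simplex d) := (continuous_norm (E := EuclideanSpace ℝ (Fin d) →L[ℝ]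
        EuclideanSpace ℝ (Fin d) →L[ℝ] ℝ)).comp_continuousOn
          (continuousOn_sndFDerivWithin_simplex hm)
  obtain ⟨C, hC⟩ := isCompact_simplex.bddAbove_image hc
  exact ⟨max C 0, le_max_right _ _, fun x hx =>
    (hC (Set.mem_image_of_mem _ hx)).trans (le_max_left _ _)⟩

lemma exists_abs_sub_le_simplex :
    ∃ C : ℝ, 0 ≤ C ∧ ∀ x ∈ simplex d, ∀ y ∈ simplex d, |m y - m x| ≤ C * ‖y - x‖ := by
  obtain ⟨C, hC0, hC⟩ := exists_norm_fderivWithin_le hm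
  refine ⟨C, hC0, fun x hx y hy => ?_⟩
  exact convex_simplex.norm_image_sub_le_of_norm_fderivWithin_le
    (hm.differentiableOn two_ne_zero) hC hx hy

/-- The mean value inequality is applied twice, to the derivative and then to `m` minus its linear
part. The sharp factor `1/2` is not needed. -/
lemma abs_taylor_one_le {C : ℝ} (hC : ∀ x ∈ simplex d,
      ‖fderivWithin ℝ (fderivWithin ℝ m (simplex d)) (simplex d) x‖ ≤ C)
    {s x : EuclideanSpace ℝ (Fin d)} (hs : s ∈ simplex d) (hx : x ∈ simplex d) :
    |m x - m s - fderivWithin ℝ m (simplex d) s (x - s)| ≤ C * ‖x - s‖ ^ 2 := by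
  have hC0 : 0 ≤ C := le_trans (by positivity) (hC s hs)
  have hseg := convex_simplex.segment_subset hs hx
  have hd : ∀ y ∈ segment ℝ s x, HasFDerivWithinAt
      (fun y => m y - fderivWithin ℝ m (simplex d) s y)
      (fderivWithin ℝ m (simplex d) y - fderivWithin ℝ m (simplex d) s) (segment ℝ s x) y := by
    intro y hy
    exact (((hm.differentiableOn two_ne_zero) y (hseg hy)).hasFDerivWithinAt.mono hseg).sub
      (ContinuousLinearMap.hasFDerivWithinAt _)
  have hb : ∀ y ∈ segment ℝ s x,
      ‖fderivWithin ℝ m (simplex d) y - fderivWithin ℝ m (simplex d) s‖ ≤ C * ‖x - s‖ := by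
    intro y hy
    refine (convex_simplex.norm_image_sub_le_of_norm_fderivWithin_le
      ((contDiffOn_fderivWithin_simplex hm).differentiableOn one_ne_zero) hC hs (hseg hy)).trans ?_
    gcongr
    exact norm_sub_le_of_mem_segment hy
  have h := (convex_segment s x).norm_image_sub_le_of_norm_hasFDerivWithin_le hd hb
    (left_mem_segment ℝ s x) (right_mem_segment ℝ s x)
  rw [Real.norm_eq_abs] at h
  rw [map_sub]
  calc _ = |m x - fderivWithin ℝ m (simplex d) s x - (m s - fderivWithin ℝ m (simplex d) s s)| := by
        congr 1; ring
    _ ≤ _ := h.trans_eq (by ring)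

/-- The derivative of the remainder is the first order remainder of the derivative of `m`, hence
`o(‖x - s‖)`; integrating along segments in the convex simplex gains one power. Boundary points are
included. -/
lemma taylor_two_isLittleO {s : EuclideanSpace ℝ (Fin d)} (hs : s ∈ simplex d) :
    (fun x => m x - m s - fderivWithin ℝ m (simplex d) s (x - s) - (1 / 2) *
      fderivWithin ℝ (fderivWithin ℝ m (simplex d)) (simplex d) s (x - s) (x - s))
      =o[𝓝[simplex d] s] fun x => ‖x - s‖ ^ 2 := by
  set D1 := fderivWithin ℝ m (simplex d) with hD1
  set D2 := fderivWithin ℝ D1 (simplex d) s with hD2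
  -- Differentiating the quadratic term produces `D2` with its arguments in both orders. Symmetry
  -- holds at boundary points too, as they are limits of interior points.
  have hsymm : ∀ v w, D2 v w = D2 w v := by
    have hcl : s ∈ closure (interior (simplex d)) := by
      rw [convex_simplex.closure_interior_eq_closure_of_nonempty_interior
        interior_simplex_nonempty]
      exact subset_closure hs
    exact (hm s hs).isSymmSndFDerivWithinAt (by simp) uniqueDiffOn_simplex hcl hs
  have hD1d := ((contDiffOn_fderivWithin_simplex hm).differentiableOn one_ne_zero s
    hs).hasFDerivWithinAt
  have hder : ∀ x ∈ simplex d, HasFDerivWithinAt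
      (fun x => m x - D1 s (x - s) - (1 / 2) * D2 (x - s) (x - s))
      (D1 x - D1 s - D2 (x - s)) (simplex d) x := by
    intro x hx
    have hid : HasFDerivWithinAt (fun x : EuclideanSpace ℝ (Fin d) => x - s)
        (ContinuousLinearMap.id ℝ _) (simplex d) x := (hasFDerivWithinAt_id x _).sub_const s
    have h1 := ((hm.differentiableOn two_ne_zero) x hx).hasFDerivWithinAt
    have h2 := (D1 s).hasFDerivAt.comp_hasFDerivWithinAt x hid
    have h3 := ((D2.hasFDerivAt.comp_hasFDerivWithinAt x hid).clm_apply hid).const_mul (1 / 2)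
    refine ((h1.sub h2).sub h3).congr_fderiv ?_
    ext v
    simp only [sub_apply, ContinuousLinearMap.comp_id, smul_apply, add_apply,
      ContinuousLinearMap.flip_apply, smul_eq_mul, Function.comp_apply]
    rw [hsymm v (x - s)]
    ring
  have hlo : (fun x => D1 x - D1 s - D2 (x - s)) =o[𝓝[simplex d] s] fun x => ‖x - s‖ ^ 1 := by
    simp only [pow_one]
    exact hD1d.isLittleO.norm_right
  have h := convex_simplex.isLittleO_pow_succ hs hder hlo
  refine h.congr_left fun x => ?_
  simp
  ring

/-- Turns the local little-o into a bound on the whole simplex by two moments of the kernel: the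
second, of order `b`, carries the small factor `ε`, and the fourth is `o(b)`. -/
lemma exists_abs_taylor_two_le {s : EuclideanSpace ℝ (Fin d)} (hs : s ∈ simplex d) {ε : ℝ}
    (hε : 0 < ε) :
    ∃ K : ℝ, ∀ x ∈ simplex d,
      |m x - m s - fderivWithin ℝ m (simplex d) s (x - s) - (1 / 2) *
        fderivWithin ℝ (fderivWithin ℝ m (simplex d)) (simplex d) s (x - s) (x - s)| ≤
      ε * ‖x - s‖ ^ 2 + K * ‖x - s‖ ^ 4 := by
  obtain ⟨C, hC0, hC⟩ := exists_norm_sndFDerivWithin_le hm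
  have h := (isLittleO_iff.1 (taylor_two_isLittleO hm hs)) hε
  rw [eventually_nhdsWithin_iff, Metric.eventually_nhds_iff] at h
  obtain ⟨δ, hδ, h⟩ := h
  -- Outside the `δ`-ball the remainder is at most `2 * C * ‖x - s‖ ^ 2`, and `1 ≤ ‖x - s‖ ^ 2 / δ ^
  -- 2`.
  refine ⟨2 * C / δ ^ 2, fun x hx => ?_⟩
  by_cases hxd : dist x s < δ
  · have h1 := h hxd hx
    rw [Real.norm_eq_abs, norm_pow, norm_norm] at h1
    refine h1.trans (le_add_of_nonneg_right (by positivity))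
  · rw [dist_eq_norm, not_lt] at hxd
    have h1 := abs_taylor_one_le hm hC hs hx
    have h2 : |(1 / 2) * fderivWithin ℝ (fderivWithin ℝ m (simplex d)) (simplex d) s
        (x - s) (x - s)| ≤ C * ‖x - s‖ ^ 2 := by
      rw [abs_mul, abs_of_pos (by norm_num : (0 : ℝ) < 1 / 2), ← Real.norm_eq_abs]
      have h3 := ContinuousLinearMap.le_opNorm₂
        (fderivWithin ℝ (fderivWithin ℝ m (simplex d)) (simplex d) s) (x - s) (x - s)
      have h4 := hC s hs
      have h5 : ‖fderivWithin ℝ (fderivWithin ℝ m (simplex d)) (simplex d) s‖ * ‖x - s‖ * ‖x - s‖ ≤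
          C * ‖x - s‖ * ‖x - s‖ := by gcongr
      have h6 : 0 ≤ C * ‖x - s‖ ^ 2 := by positivity
      nlinarith
    refine (abs_sub _ _).trans ((add_le_add h1 h2).trans ?_)
    have h3 : C * ‖x - s‖ ^ 2 + C * ‖x - s‖ ^ 2 = 2 * C / δ ^ 2 * (δ ^ 2 * ‖x - s‖ ^ 2) := by
      field_simp; ring
    rw [h3]
    refine le_add_of_nonneg_of_le (by positivity) ?_
    gcongr
    calc δ ^ 2 * ‖x - s‖ ^ 2 ≤ ‖x - s‖ ^ 2 * ‖x - s‖ ^ 2 := by gcongr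
      _ = ‖x - s‖ ^ 4 := by ring

/-! ### The smoothing bias of the Dirichlet kernel -/

lemma exists_abs_smoothing_bias_le :
    ∃ C : ℝ, 0 ≤ C ∧ ∀ s ∈ simplex d, ∀ b : ℝ, 0 < b → b ≤ 1 →
      |(∫ x in simplex d, m x * dirichletKernel s b x) - m s| ≤ C * b := by
  obtain ⟨C1, hC10, hC1⟩ := exists_norm_fderivWithin_le hm
  obtain ⟨C2, hC20, hC2⟩ := exists_norm_sndFDerivWithin_le hm
  refine ⟨d * (C1 * (d + 1)) + C2 * (d * (3 + (d + 1) * (d + 2))), by positivity,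
    fun s hs b hb hb1 => ?_⟩
  rw [integral_mul_kernel_sub_eq hm.continuousOn hs hb (fderivWithin ℝ m (simplex d) s), add_mul]
  refine (abs_add_le _ _).trans (add_le_add ?_ ?_)
  · refine (Finset.abs_sum_le_sum_abs _ _).trans
      ((Finset.sum_le_card_nsmul _ _ (C1 * ((d + 1) * b)) fun i _ => ?_).trans_eq ?_)
    · rw [abs_mul]
      gcongr
      · rw [← Real.norm_eq_abs]
        refine ((fderivWithin ℝ m (simplex d) s).le_opNorm _).trans ?_
        simpa using hC1 s hs
      · exact kernel_mean_sub_abs_le hs hb i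
    · simp; ring
  · have hint : IntegrableOn (fun x => C2 * (‖x - s‖ ^ 2 * dirichletKernel s b x)) (simplex d) :=
      (integrableOn_mul_dirichletKernel (h := fun x => ‖x - s‖ ^ 2) hs hb (by fun_prop)).const_mul _
    rw [← Real.norm_eq_abs]
    refine (norm_integral_le_of_norm_le hint ?_).trans ?_
    · refine (ae_restrict_iff' measurableSet_simplex).2 (ae_of_all _ fun x hx => ?_)
      rw [Real.norm_eq_abs, abs_mul, abs_of_nonneg (dirichletKernel_nonneg hs hb hx), ← mul_assoc]
      exact mul_le_mul_of_nonneg_right (abs_taylor_one_le hm hC2 hs hx)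
        (dirichletKernel_nonneg hs hb hx)
    · rw [integral_const_mul, mul_assoc]
      gcongr
      exact kernel_second_central_le hs hb hb1

lemma tendsto_smoothing_bias_div {s : EuclideanSpace ℝ (Fin d)} (hs : s ∈ simplex d) :
    Tendsto (fun b => ((∫ x in simplex d, m x * dirichletKernel s b x) - m s) / b) (𝓝[>] 0)
      (𝓝 (biasFun m s)) := by
  set D1 := fderivWithin ℝ m (simplex d) s with hD1
  set D2 := fderivWithin ℝ (fderivWithin ℝ m (simplex d)) (simplex d) s with hD2
  have hmc := hm.continuousOn
  set R : EuclideanSpace ℝ (Fin d) → ℝ :=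
    fun x => m x - m s - D1 (x - s) - (1 / 2) * D2 (x - s) (x - s) with hR
  have hRc : ContinuousOn R (simplex d) := by
    have h1 : Continuous fun x => D1 (x - s) := by fun_prop
    have h2 : Continuous fun x => D2 (x - s) (x - s) := by fun_prop
    exact ((hmc.sub continuousOn_const).sub h1.continuousOn).sub
      (continuousOn_const.mul h2.continuousOn)
  have hrem : Tendsto (fun b => (∫ x in simplex d, R x * dirichletKernel s b x) / b) (𝓝[>] 0)
      (𝓝 0) := by
    have hCd : (0 : ℝ) < d * (3 + (d + 1) * (d + 2)) + 1 := by positivity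
    rw [Metric.tendsto_nhds]
    intro η hη
    -- Chosen so that `ε` times the constant of `kernel_second_central_le` is at most `η / 2`; the
    -- fourth moment term receives the other half.
    set ε := η / (2 * (d * (3 + (d + 1) * (d + 2)) + 1)) with hεdef
    have hε : 0 < ε := by positivity
    obtain ⟨K, hK⟩ := exists_abs_taylor_two_le hm hs hε
    have h4 := (tendsto_kernel_norm_pow_four_div hs).const_mul K
    rw [mul_zero] at h4
    have h4' := h4.eventually (eventually_lt_nhds (by linarith : (0 : ℝ) < η / 2))
    have hb1 : ∀ᶠ b : ℝ in 𝓝[>] 0, b ≤ 1 :=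
      nhdsWithin_le_nhds (eventually_le_nhds one_pos)
    filter_upwards [self_mem_nhdsWithin, hb1, h4'] with b (hb : 0 < b) hb1 h4'
    have i2 : IntegrableOn (fun x => ε * (‖x - s‖ ^ 2 * dirichletKernel s b x)) (simplex d) :=
      (integrableOn_mul_dirichletKernel (h := fun x => ‖x - s‖ ^ 2) hs hb (by fun_prop)).const_mul _
    have i4 : IntegrableOn (fun x => K * (‖x - s‖ ^ 4 * dirichletKernel s b x)) (simplex d) :=
      (integrableOn_mul_dirichletKernel (h := fun x => ‖x - s‖ ^ 4) hs hb (by fun_prop)).const_mul _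
    have hle : |∫ x in simplex d, R x * dirichletKernel s b x| ≤
        ε * (d * (3 + (d + 1) * (d + 2)) * b) +
          K * ∫ x in simplex d, ‖x - s‖ ^ 4 * dirichletKernel s b x := by
      rw [← Real.norm_eq_abs]
      refine (norm_integral_le_of_norm_le (i2.add i4) ?_).trans ?_
      · refine (ae_restrict_iff' measurableSet_simplex).2 (ae_of_all _ fun x hx => ?_)
        rw [Real.norm_eq_abs, abs_mul, abs_of_nonneg (dirichletKernel_nonneg hs hb hx),
          Pi.add_apply, ← mul_assoc, ← mul_assoc, ← add_mul]
        exact mul_le_mul_of_nonneg_right (hK x hx) (dirichletKernel_nonneg hs hb hx)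
      · simp only [Pi.add_apply]
        rw [integral_add i2 i4, integral_const_mul, integral_const_mul]
        gcongr
        exact kernel_second_central_le hs hb hb1
    rw [Real.dist_eq, sub_zero, abs_div, abs_of_pos hb, div_lt_iff₀ hb]
    rw [← mul_div_assoc, div_lt_iff₀ hb] at h4'
    have h5 : ε * (d * (3 + (d + 1) * (d + 2)) * b) ≤ η / 2 * b := by
      have : ε * (d * (3 + (d + 1) * (d + 2))) ≤ η / 2 := by
        rw [hεdef, div_mul_eq_mul_div, div_le_div_iff₀ (by positivity) two_pos]
        nlinarith
      calc _ = ε * (d * (3 + (d + 1) * (d + 2))) * b := by ring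
        _ ≤ _ := by gcongr
    linarith
  have h1 := tendsto_finsetSum Finset.univ fun i (_ : i ∈ Finset.univ) =>
    (tendsto_kernel_mean_sub_div hs i).const_mul (D1 (EuclideanSpace.single i 1))
  have h2 := tendsto_finsetSum Finset.univ fun i (_ : i ∈ Finset.univ) =>
    tendsto_finsetSum Finset.univ fun j (_ : j ∈ Finset.univ) =>
      (tendsto_kernel_mixed_central_div hs i j).const_mul
        (D2 (EuclideanSpace.single i 1) (EuclideanSpace.single j 1))
  have h := (h1.add (h2.const_mul (1 / 2))).add hrem
  have hlim : ∑ i, D1 (EuclideanSpace.single i 1) * (1 - (↑d + 1) * s i) +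
      1 / 2 * ∑ i, ∑ j, D2 (EuclideanSpace.single i 1) (EuclideanSpace.single j 1) *
        (s i * ((if i = j then 1 else 0) - s j)) + 0 = biasFun m s := by
    rw [biasFun_eq hm hs, add_zero]
    congr 1
    · exact Finset.sum_congr rfl fun i _ => mul_comm _ _
    · congr 1
      exact Finset.sum_congr rfl fun i _ => Finset.sum_congr rfl fun j _ => mul_comm _ _
  rw [hlim] at h
  refine h.congr' ?_
  filter_upwards [self_mem_nhdsWithin] with b (hb : 0 < b)
  have i2 : ∀ i j : Fin d, IntegrableOn (fun x =>
      D2 (EuclideanSpace.single i 1) (EuclideanSpace.single j 1) *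
        ((x i - s i) * (x j - s j) * dirichletKernel s b x)) (simplex d) := fun i j =>
    (integrableOn_mul_dirichletKernel (h := fun x => (x i - s i) * (x j - s j)) hs hb
      (by fun_prop)).const_mul _
  have iR := integrableOn_mul_dirichletKernel hs hb hRc
  have hexp : ∀ x : EuclideanSpace ℝ (Fin d), (m x - m s - D1 (x - s)) * dirichletKernel s b x =
      1 / 2 * ∑ i, ∑ j, D2 (EuclideanSpace.single i 1) (EuclideanSpace.single j 1) *
        ((x i - s i) * (x j - s j) * dirichletKernel s b x) + R x * dirichletKernel s b x := by
    intro x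
    have : ∑ i, ∑ j, D2 (EuclideanSpace.single i 1) (EuclideanSpace.single j 1) *
        ((x i - s i) * (x j - s j) * dirichletKernel s b x) =
        D2 (x - s) (x - s) * dirichletKernel s b x := by
      rw [clm_apply_apply_eq_sum D2 (x - s), Finset.sum_mul]
      refine Finset.sum_congr rfl fun i _ => ?_
      rw [Finset.sum_mul]
      refine Finset.sum_congr rfl fun j _ => ?_
      simp only [PiLp.sub_apply]
      ring
    rw [this, hR]
    ring
  rw [integral_mul_kernel_sub_eq hm.continuousOn hs hb D1]
  simp_rw [hexp]
  rw [integral_add (by exact (integrable_finsetSum _ fun i _ =>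
      integrable_finsetSum _ fun j _ => i2 i j).const_mul _) iR, integral_const_mul,
    integral_finsetSum _ fun i _ => integrable_finsetSum _ fun j _ => i2 i j]
  simp_rw [integral_finsetSum _ fun j _ => i2 _ j, integral_const_mul, ← mul_div_assoc,
    ← Finset.sum_div]
  ring

end Taylor

end

noncomputable section
variable {d : ℕ}

/-! ### Partitions of the simplex -/

/-- The sets `B i` are compact and partition the simplex up to null sets. -/
structure IsCellPartition {ι : Type*} (B : ι → Set (EuclideanSpace ℝ (Fin d))) : Prop where
  compact : ∀ i, IsCompact (B i)
  disjoint_interior : ∀ i j, i ≠ j → interior (B i) ∩ interior (B j) = ∅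
  cover : ⋃ i, B i = simplex d
  frontier_null : ∀ i, volume (frontier (B i)) = 0

namespace IsCellPartition

variable {ι : Type*} {B : ι → Set (EuclideanSpace ℝ (Fin d))}

lemma subset_simplex (hB : IsCellPartition B) (i : ι) : B i ⊆ simplex d :=
  (Set.subset_iUnion B i).trans hB.cover.subset

lemma measurableSet (hB : IsCellPartition B) (i : ι) : MeasurableSet (B i) :=
  (hB.compact i).measurableSet

/-- A common point of two cells lies on the frontier of one of them, since the interiors are
disjoint, and the frontiers are null. -/
lemma aedisjoint (hB : IsCellPartition B) {i j : ι} (hij : i ≠ j) :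
    AEDisjoint volume (B i) (B j) := by
  refine measure_mono_null (t := frontier (B i) ∪ frontier (B j)) (fun x hx => ?_)
    (measure_union_null (hB.frontier_null i) (hB.frontier_null j))
  rw [(hB.compact i).isClosed.frontier_eq, (hB.compact j).isClosed.frontier_eq]
  by_contra h
  simp only [Set.mem_union, Set.mem_sdiff, not_or, not_and, not_not] at h
  have : x ∈ interior (B i) ∩ interior (B j) := ⟨h.1 hx.1, h.2 hx.2⟩
  rw [hB.disjoint_interior i j hij] at this
  exact this

lemma sum_integral [Fintype ι] (hB : IsCellPartition B) {h : EuclideanSpace ℝ (Fin d) → ℝ}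
    (hh : IntegrableOn h (simplex d)) :
    ∑ i, ∫ x in B i, h x = ∫ x in simplex d, h x := by
  rw [← hB.cover] at hh ⊢
  rw [integral_iUnion_ae (fun i => (hB.measurableSet i).nullMeasurableSet)
    (fun i j hij => hB.aedisjoint hij) hh, tsum_fintype]

end IsCellPartition

/-! ### Cell weights -/

/-- Cauchy-Schwarz against the constant one: the quadratic `t ↦ ∫ (h - t)^2` is nonnegative, so its
discriminant is nonpositive. -/
lemma sq_setIntegral_le {B : Set (EuclideanSpace ℝ (Fin d))} (hfin : volume B ≠ ⊤)
    {h : EuclideanSpace ℝ (Fin d) → ℝ} (h1 : IntegrableOn h B)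
    (h2 : IntegrableOn (fun x => h x ^ 2) B) :
    (∫ x in B, h x) ^ 2 ≤ volume.real B * ∫ x in B, h x ^ 2 := by
  have key : ∀ t : ℝ, 0 ≤ volume.real B * (t * t) + (-2 * ∫ x in B, h x) * t +
      ∫ x in B, h x ^ 2 := by
    intro t
    have hexp : ∀ x, (h x - t) ^ 2 = h x ^ 2 - 2 * t * h x + t ^ 2 := fun x => by ring
    have hnn : 0 ≤ ∫ x in B, (h x - t) ^ 2 := integral_nonneg fun x => sq_nonneg _
    have hc : IntegrableOn (fun _ : EuclideanSpace ℝ (Fin d) => t ^ 2) B := integrableOn_const hfin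
    simp_rw [hexp] at hnn
    rw [integral_add (by exact h2.sub (h1.const_mul _)) hc, integral_sub h2 (h1.const_mul _),
      integral_const_mul, setIntegral_const, smul_eq_mul] at hnn
    linarith
  have h := discrim_le_zero key
  rw [discrim] at h
  linarith

section Cell

variable {s : EuclideanSpace ℝ (Fin d)} {b : ℝ} {B : Set (EuclideanSpace ℝ (Fin d))}

lemma volume_ne_top_of_subset_simplex (hBS : B ⊆ simplex d) : volume B ≠ ⊤ :=
  ((measure_mono hBS).trans_lt volume_simplex_lt_top).ne

lemma integrableOn_dirichletKernel_sq (hs : s ∈ simplex d) (hb : 0 < b) :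
    IntegrableOn (fun x => dirichletKernel s b x ^ 2) (simplex d) :=
  IntegrableOn.congr_fun
    ((integrableOn_dirichletKernel hs (half_pos hb)).const_mul (kernelEnergy s b))
    (fun _ hx => (dirichletKernel_sq hs hb hx).symm) measurableSet_simplex

lemma setIntegral_dirichletKernel_sq (hs : s ∈ simplex d) (hb : 0 < b) (hBm : MeasurableSet B)
    (hBS : B ⊆ simplex d) :
    ∫ x in B, dirichletKernel s b x ^ 2 =
      kernelEnergy s b * ∫ x in B, dirichletKernel s (b / 2) x := by
  rw [← integral_const_mul]
  exact setIntegral_congr_fun hBm fun x hx => dirichletKernel_sq hs hb (hBS hx)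

lemma setIntegral_dirichletKernel_nonneg (hs : s ∈ simplex d) (hb : 0 < b)
    (hBm : MeasurableSet B) (hBS : B ⊆ simplex d) : 0 ≤ ∫ x in B, dirichletKernel s b x :=
  setIntegral_nonneg hBm fun _ hx => dirichletKernel_nonneg hs hb (hBS hx)

lemma sq_setIntegral_dirichletKernel_le (hs : s ∈ simplex d) (hb : 0 < b) (hBm : MeasurableSet B)
    (hBS : B ⊆ simplex d) :
    (∫ x in B, dirichletKernel s b x) ^ 2 ≤
      volume.real B * (kernelEnergy s b * ∫ x in B, dirichletKernel s (b / 2) x) := by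
  rw [← setIntegral_dirichletKernel_sq hs hb hBm hBS]
  exact sq_setIntegral_le (volume_ne_top_of_subset_simplex hBS)
    ((integrableOn_dirichletKernel hs hb).mono_set hBS)
    ((integrableOn_dirichletKernel_sq hs hb).mono_set hBS)

lemma abs_lastCoord_sub_le (y z : EuclideanSpace ℝ (Fin d)) :
    |lastCoord y - lastCoord z| ≤ d * ‖y - z‖ := by
  have : lastCoord y - lastCoord z = -∑ i, (y - z) i := by
    simp [lastCoord, Finset.sum_sub_distrib]
  rw [this, abs_neg]
  refine (Finset.abs_sum_le_sum_abs _ _).trans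
    ((Finset.sum_le_card_nsmul _ _ ‖y - z‖ fun i _ => ?_).trans_eq (by simp))
  rw [← Real.norm_eq_abs]
  exact PiLp.norm_apply_le _ i

/-- As `z` is at least `c`, `y ≤ z + D ≤ (1 + D / c) z ≤ exp (D / c) z`; then raise to the power
`e`. -/
lemma rpow_le_exp_mul_rpow {y z c D e : ℝ} (hy : 0 ≤ y) (hc : 0 < c) (hz : c ≤ z) (he : 0 ≤ e)
    (hyz : |y - z| ≤ D) : y ^ e ≤ Real.exp (D / c * e) * z ^ e := by
  have hD : 0 ≤ D := (abs_nonneg _).trans hyz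
  have h1 : y ≤ Real.exp (D / c) * z := by
    have h2 := Real.add_one_le_exp (D / c)
    have h3 : D ≤ D / c * z := by
      rw [div_mul_eq_mul_div, le_div_iff₀ hc]
      gcongr
    have h4 := (abs_le.1 hyz).2
    nlinarith [hc.trans_le hz]
  calc y ^ e ≤ (Real.exp (D / c) * z) ^ e := by gcongr
    _ = _ := by
      rw [Real.mul_rpow (Real.exp_pos _).le (hc.le.trans hz), ← Real.exp_mul]

/-- A multiplicative Lipschitz estimate: the exponents of the kernel sum to `1 / b`, so the factors
of all coordinates combine into one exponential. It is close to 1 when the distance `a` is small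
compared with `b * c`. -/
lemma dirichletKernel_le_exp_mul [NeZero d] (hs : s ∈ simplex d) (hb : 0 < b)
    {y z : EuclideanSpace ℝ (Fin d)} (hy : y ∈ simplex d) {c a : ℝ} (hc : 0 < c)
    (hz : ∀ i, c ≤ z i) (hzl : c ≤ lastCoord z) (hyz : ‖y - z‖ ≤ a) :
    dirichletKernel s b y ≤ Real.exp (d * a / (b * c)) * dirichletKernel s b z := by
  have hd1 : (1 : ℝ) ≤ d := by exact_mod_cast NeZero.one_le
  have ha : 0 ≤ a := (norm_nonneg _).trans hyz
  have hl := rpow_le_exp_mul_rpow (e := lastCoord s / b) (lastCoord_nonneg hy) hc hzl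
    (div_nonneg (lastCoord_nonneg hs) hb.le)
    ((abs_lastCoord_sub_le y z).trans (mul_le_mul_of_nonneg_left hyz (by positivity)))
  have hi : ∀ i, y i ^ (s i / b) ≤ Real.exp (d * a / c * (s i / b)) * z i ^ (s i / b) := by
    intro i
    refine rpow_le_exp_mul_rpow (simplex_coord_nonneg hy i) hc (hz i)
      (div_nonneg (simplex_coord_nonneg hs i) hb.le) ?_
    have : |(y - z) i| ≤ ‖y - z‖ := by
      rw [← Real.norm_eq_abs]; exact PiLp.norm_apply_le _ i
    rw [PiLp.sub_apply] at this
    nlinarith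
  have hp := Finset.prod_le_prod (s := Finset.univ)
    (fun i _ => Real.rpow_nonneg (simplex_coord_nonneg hy i) (s i / b)) fun i _ => hi i
  rw [Finset.prod_mul_distrib, ← Real.exp_sum, ← Finset.mul_sum, ← Finset.sum_div] at hp
  have hzp : 0 ≤ ∏ i, z i ^ (s i / b) :=
    Finset.prod_nonneg fun i _ => Real.rpow_nonneg (hc.le.trans (hz i)) _
  have hexp : Real.exp (d * a / (b * c)) = Real.exp (d * a / c * (lastCoord s / b)) *
      Real.exp (d * a / c * ((∑ i, s i) / b)) := by
    rw [← Real.exp_add, lastCoord]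
    congr 1
    field_simp
    ring
  have hk := kernelConst_pos hs hb
  rw [dirichletKernel_eq, dirichletKernel_eq, hexp]
  calc _ ≤ kernelConst s b * ((Real.exp (d * a / c * (lastCoord s / b)) *
          lastCoord z ^ (lastCoord s / b)) * (Real.exp (d * a / c * ((∑ i, s i) / b)) *
          ∏ i, z i ^ (s i / b))) := by
        gcongr
        · exact Finset.prod_nonneg fun i _ => Real.rpow_nonneg (simplex_coord_nonneg hy i) _
        · exact mul_nonneg (Real.exp_pos _).le (Real.rpow_nonneg (hc.le.trans hzl) _)
    _ = _ := by ring

/-- On cells whose diameter is small compared to `b`, away from the boundary of the simplex, the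
Cauchy-Schwarz inequality is nearly an equality. -/
lemma le_sq_setIntegral_dirichletKernel [NeZero d] (hs : s ∈ simplex d) (hb : 0 < b)
    (hBm : MeasurableSet B) (hBS : B ⊆ simplex d) {c a : ℝ} (hc : 0 < c)
    (hBc : ∀ z ∈ B, (∀ i, c ≤ z i) ∧ c ≤ lastCoord z) (hdiam : ∀ y ∈ B, ∀ z ∈ B, ‖y - z‖ ≤ a) :
    Real.exp (-(4 * (d * a / (b * c)))) * (volume.real B *
      (kernelEnergy s b * ∫ x in B, dirichletKernel s (b / 2) x)) ≤
      (∫ x in B, dirichletKernel s b x) ^ 2 := by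
  rcases B.eq_empty_or_nonempty with rfl | ⟨z, hz⟩
  · simp
  set τ := d * a / (b * c) with hτ
  have hfin := volume_ne_top_of_subset_simplex hBS
  have hup : ∀ y ∈ B, dirichletKernel s b y ≤ Real.exp τ * dirichletKernel s b z := fun y hy =>
    dirichletKernel_le_exp_mul hs hb (hBS hy) hc (hBc z hz).1 (hBc z hz).2 (hdiam y hy z hz)
  have hlo : ∀ y ∈ B, Real.exp (-τ) * dirichletKernel s b z ≤ dirichletKernel s b y := by
    intro y hy
    have h := dirichletKernel_le_exp_mul hs hb (hBS hz) hc (hBc y hy).1 (hBc y hy).2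
      (hdiam z hz y hy)
    rw [Real.exp_neg, inv_mul_le_iff₀ (Real.exp_pos _)]
    exact h
  set k := dirichletKernel s b z with hk
  have hk0 : 0 ≤ k := dirichletKernel_nonneg hs hb (hBS hz)
  have hV : 0 ≤ volume.real B := measureReal_nonneg
  have h1 : volume.real B * (Real.exp (-τ) * k) ≤ ∫ x in B, dirichletKernel s b x := by
    have := setIntegral_mono_on (integrableOn_const (C := Real.exp (-τ) * k) hfin)
      ((integrableOn_dirichletKernel hs hb).mono_set hBS) hBm hlo
    rwa [setIntegral_const, smul_eq_mul] at this
  have h2 : kernelEnergy s b * ∫ x in B, dirichletKernel s (b / 2) x ≤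
      volume.real B * (Real.exp τ * k) ^ 2 := by
    rw [← setIntegral_dirichletKernel_sq hs hb hBm hBS]
    have := setIntegral_mono_on ((integrableOn_dirichletKernel_sq hs hb).mono_set hBS)
      (integrableOn_const (C := (Real.exp τ * k) ^ 2) hfin) hBm fun y hy =>
        pow_le_pow_left₀ (dirichletKernel_nonneg hs hb (hBS hy)) (hup y hy) 2
    rwa [setIntegral_const, smul_eq_mul] at this
  -- The constant 4 arises as `2 + 2`: the bound on the energy costs `exp (2 * τ)`, and the squared
  -- lower bound on the kernel costs `exp (-(2 * τ))`.
  calc _ ≤ Real.exp (-(4 * τ)) * (volume.real B * (volume.real B * (Real.exp τ * k) ^ 2)) := by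
        gcongr
    _ = (volume.real B * (Real.exp (-τ) * k)) ^ 2 := by
        have : Real.exp (-(4 * τ)) = Real.exp (-τ) ^ 4 := by
          rw [← Real.exp_nat_mul]; congr 1; push_cast; ring
        rw [this, Real.exp_neg]
        have := (Real.exp_pos τ).ne'
        field_simp
    _ ≤ _ := by
        gcongr

end Cell

lemma kernel_first_abs_le {s : EuclideanSpace ℝ (Fin d)} {b : ℝ} (hs : s ∈ simplex d) (hb : 0 < b)
    (hb1 : b ≤ 1) :
    ∫ x in simplex d, ‖x - s‖ * dirichletKernel s b x ≤
      (1 + d * (3 + (d + 1) * (d + 2))) * √b := by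
  have hsb : 0 < √b := Real.sqrt_pos.2 hb
  have i0 := (integrableOn_dirichletKernel hs hb).const_mul √b
  have i2 : IntegrableOn (fun x => (√b)⁻¹ * (‖x - s‖ ^ 2 * dirichletKernel s b x)) (simplex d) :=
    (integrableOn_mul_dirichletKernel (h := fun x => ‖x - s‖ ^ 2) hs hb (by fun_prop)).const_mul _
  have h := setIntegral_mono_on (integrableOn_mul_dirichletKernel (h := fun x => ‖x - s‖) hs hb
    (by fun_prop)) (i0.add i2) measurableSet_simplex fun x hx => by
      have hk := dirichletKernel_nonneg hs hb hx
      -- An AM-GM bound balanced at the scale `√b` of the kernel, so that both terms integrate to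
      -- order `√b`.
      have : ‖x - s‖ ≤ √b + (√b)⁻¹ * ‖x - s‖ ^ 2 := by
        rw [← sub_nonneg]
        have h1 : √b + (√b)⁻¹ * ‖x - s‖ ^ 2 - ‖x - s‖ =
            (√b)⁻¹ * ((√b - ‖x - s‖ / 2) ^ 2 + 3 / 4 * ‖x - s‖ ^ 2) := by
          field_simp
          ring
        rw [h1]
        positivity
      simp only [Pi.add_apply]
      rw [← mul_assoc, ← add_mul]
      exact mul_le_mul_of_nonneg_right this hk
  refine h.trans ?_
  simp only [Pi.add_apply]
  rw [integral_add i0 i2, integral_const_mul, integral_const_mul, integral_dirichletKernel hs hb]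
  have h2 := kernel_second_central_le hs hb hb1
  calc _ ≤ √b * 1 + (√b)⁻¹ * (d * (3 + (d + 1) * (d + 2)) * b) := by gcongr
    _ = _ := by
      have : b = √b * √b := (Real.mul_self_sqrt hb.le).symm
      conv_lhs => rw [this]
      rw [Real.sqrt_mul_self hsb.le]
      field_simp

/-! ### Cell volumes -/

section Volume

variable {f v : EuclideanSpace ℝ (Fin d) → ℝ} {L L' : NNReal} {f₀ v₀ N a : ℝ}
  {B : Set (EuclideanSpace ℝ (Fin d))}

lemma mul_volume_le (hf : LipschitzOnWith L f (simplex d)) (hf₀ : 0 < f₀)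
    (hff : ∀ x ∈ simplex d, f₀ ≤ f x) (hN : 0 < N) (hBm : MeasurableSet B) (hBS : B ⊆ simplex d)
    (hmass : |(∫ t in B, f t) - N⁻¹| ≤ N⁻¹ * a) : N * volume.real B ≤ (1 + a) / f₀ := by
  have hfin := volume_ne_top_of_subset_simplex hBS
  have hfi : IntegrableOn f B :=
    (hf.continuousOn.integrableOn_compact isCompact_simplex).mono_set hBS
  have h := setIntegral_mono_on (integrableOn_const (C := f₀) hfin) hfi hBm
    fun x hx => hff x (hBS hx)
  rw [setIntegral_const, smul_eq_mul] at h
  have h2 := (abs_le.1 hmass).2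
  rw [le_div_iff₀ hf₀]
  calc N * volume.real B * f₀ = N * (volume.real B * f₀) := by ring
    _ ≤ N * (N⁻¹ * (1 + a)) := mul_le_mul_of_nonneg_left (by linarith) hN.le
    _ = _ := by field_simp

/-- A cell has `f`-mass close to `1 / N` and `f` is close to `f s` on it, so its volume is close to
`1 / (N * f s)`. The error is linear in `a + ‖x - s‖`, ready for integration against the kernel. The
same `a` bounds the diameter and the relative mass error. -/
lemma abs_mul_volume_sub_le (hf : LipschitzOnWith L f (simplex d)) (hf₀ : 0 < f₀)
    (hff : ∀ x ∈ simplex d, f₀ ≤ f x) (hN : 0 < N) (ha1 : a ≤ 1) (hBm : MeasurableSet B)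
    (hBS : B ⊆ simplex d) (hdiam : ∀ y ∈ B, ∀ z ∈ B, ‖y - z‖ ≤ a)
    (hmass : |(∫ t in B, f t) - N⁻¹| ≤ N⁻¹ * a) {s x : EuclideanSpace ℝ (Fin d)}
    (hs : s ∈ simplex d) (hx : x ∈ B) :
    |N * volume.real B - 1 / f s| ≤ (2 * L / f₀ + 1) / f₀ * (a + ‖x - s‖) := by
  have ha : 0 ≤ a := (norm_nonneg _).trans (hdiam x hx x hx)
  have hfin := volume_ne_top_of_subset_simplex hBS
  have hfi : IntegrableOn f B :=
    (hf.continuousOn.integrableOn_compact isCompact_simplex).mono_set hBS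
  have hV : 0 ≤ volume.real B := measureReal_nonneg
  have hvol : N * volume.real B ≤ 2 / f₀ :=
    (mul_volume_le hf hf₀ hff hN hBm hBS hmass).trans (by gcongr; linarith)
  have hfs := hf₀.trans_le (hff s hs)
  have hint : |(∫ t in B, f t) - volume.real B * f s| ≤ L * (a + ‖x - s‖) * volume.real B := by
    have h1 : (∫ t in B, f t) - volume.real B * f s = ∫ t in B, (f t - f s) := by
      rw [integral_sub hfi (integrableOn_const hfin), setIntegral_const, smul_eq_mul]
    rw [h1, ← Real.norm_eq_abs]
    refine norm_setIntegral_le_of_norm_le_const hfin.lt_top fun t ht => ?_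
    have h2 := hf.dist_le_mul t (hBS ht) s hs
    rw [dist_eq_norm, dist_eq_norm] at h2
    refine h2.trans ?_
    gcongr
    calc ‖t - s‖ = ‖(t - x) + (x - s)‖ := by congr 1; abel
      _ ≤ ‖t - x‖ + ‖x - s‖ := norm_add_le _ _
      _ ≤ _ := by gcongr; exact hdiam t ht x hx
  have hmain : |N * volume.real B * f s - 1| ≤ (2 * L / f₀ + 1) * (a + ‖x - s‖) := by
    have h1 : N * volume.real B * f s - 1 = N * ((∫ t in B, f t) - N⁻¹) -
        N * ((∫ t in B, f t) - volume.real B * f s) := by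
      field_simp; ring
    rw [h1]
    refine (abs_sub _ _).trans ?_
    rw [abs_mul, abs_mul, abs_of_pos hN]
    calc _ ≤ N * (N⁻¹ * a) + N * (L * (a + ‖x - s‖) * volume.real B) := by gcongr
      _ = a + L * (a + ‖x - s‖) * (N * volume.real B) := by field_simp
      _ ≤ (a + ‖x - s‖) + L * (a + ‖x - s‖) * (2 / f₀) := by
          gcongr
          linarith [norm_nonneg (x - s)]
      _ = _ := by ring
  have h3 : N * volume.real B - 1 / f s = (N * volume.real B * f s - 1) / f s := by field_simp
  rw [h3, abs_div, abs_of_pos hfs, div_mul_eq_mul_div]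
  have := hff s hs
  gcongr

lemma abs_mul_volume_mul_sub_le (hf : LipschitzOnWith L f (simplex d)) (hf₀ : 0 < f₀)
    (hff : ∀ x ∈ simplex d, f₀ ≤ f x) (hv : LipschitzOnWith L' v (simplex d))
    (hv0 : ∀ x, 0 ≤ v x) (hvv : ∀ x ∈ simplex d, v x ≤ v₀)
    (hN : 0 < N) (ha1 : a ≤ 1) (hBm : MeasurableSet B)
    (hBS : B ⊆ simplex d) (hdiam : ∀ y ∈ B, ∀ z ∈ B, ‖y - z‖ ≤ a)
    (hmass : |(∫ t in B, f t) - N⁻¹| ≤ N⁻¹ * a) {s x x₀ : EuclideanSpace ℝ (Fin d)}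
    (hs : s ∈ simplex d) (hx : x ∈ B) (hx₀ : x₀ ∈ B) :
    |N * volume.real B * v x₀ - v s / f s| ≤
      (v₀ * ((2 * L / f₀ + 1) / f₀) + L' / f₀) * (a + ‖x - s‖) := by
  have h1 := abs_mul_volume_sub_le hf hf₀ hff hN ha1 hBm hBS hdiam hmass hs hx
  have hfs := hf₀.trans_le (hff s hs)
  have h2 : |v x₀ - v s| ≤ L' * (a + ‖x - s‖) := by
    have h2 := hv.dist_le_mul x₀ (hBS hx₀) s hs
    rw [dist_eq_norm, dist_eq_norm] at h2
    refine h2.trans ?_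
    gcongr
    calc ‖x₀ - s‖ = ‖(x₀ - x) + (x - s)‖ := by congr 1; abel
      _ ≤ ‖x₀ - x‖ + ‖x - s‖ := norm_add_le _ _
      _ ≤ _ := by gcongr; exact hdiam x₀ hx₀ x hx
  have h3 : N * volume.real B * v x₀ - v s / f s =
      v x₀ * (N * volume.real B - 1 / f s) + (v x₀ - v s) * (1 / f s) := by
    field_simp; ring
  rw [h3]
  refine (abs_add_le _ _).trans ?_
  rw [abs_mul, abs_mul, abs_of_nonneg (hv0 x₀), abs_of_pos (by positivity : 0 < 1 / f s), add_mul]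
  have hv1 := hvv x₀ (hBS hx₀)
  have hv2 := (hv0 x₀).trans hv1
  have hfle := hff s hs
  refine add_le_add ?_ ?_
  · rw [mul_assoc]; gcongr
  · have := (abs_nonneg _).trans h2
    calc _ ≤ L' * (a + ‖x - s‖) * (1 / f₀) := by gcongr
      _ = _ := by ring

end Volume

/-! ### The variance of the estimator at a fixed point -/

section Variance

variable {f v : EuclideanSpace ℝ (Fin d) → ℝ} {L L' : NNReal} {f₀ v₀ N a : ℝ}

/-- Cauchy-Schwarz on every cell, after which the `b / 2`-masses of the cells sum to one. Needing
nothing about the position of `s`, this provides the domination of the variance. -/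
lemma sum_sq_weight_le (hf : LipschitzOnWith L f (simplex d)) (hf₀ : 0 < f₀)
    (hff : ∀ x ∈ simplex d, f₀ ≤ f x) (hv0 : ∀ x, 0 ≤ v x) (hvv : ∀ x ∈ simplex d, v x ≤ v₀)
    (hN : 0 < N) {n : ℕ} {B : Fin n → Set (EuclideanSpace ℝ (Fin d))} (hB : IsCellPartition B)
    {x : Fin n → EuclideanSpace ℝ (Fin d)} (hx : ∀ i, x i ∈ B i) (ha1 : a ≤ 1)
    (hmass : ∀ i, |(∫ t in B i, f t) - N⁻¹| ≤ N⁻¹ * a) {s : EuclideanSpace ℝ (Fin d)}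
    (hs : s ∈ simplex d) {b : ℝ} (hb : 0 < b) :
    N * ∑ i, v (x i) * (∫ y in B i, dirichletKernel s b y) ^ 2 ≤
      2 * v₀ / f₀ * kernelEnergy s b := by
  have hE := kernelEnergy_pos hs hb
  have hsum := hB.sum_integral (integrableOn_dirichletKernel hs (half_pos hb))
  rw [integral_dirichletKernel hs (half_pos hb)] at hsum
  rw [← mul_one (2 * v₀ / f₀ * kernelEnergy s b), ← hsum, Finset.mul_sum, Finset.mul_sum]
  refine Finset.sum_le_sum fun i _ => ?_
  have hvol : N * volume.real (B i) ≤ 2 / f₀ :=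
    (mul_volume_le hf hf₀ hff hN (hB.measurableSet i) (hB.subset_simplex i) (hmass i)).trans
      (by gcongr; linarith)
  have hq := setIntegral_dirichletKernel_nonneg hs (half_pos hb) (hB.measurableSet i)
    (hB.subset_simplex i)
  have hcs := sq_setIntegral_dirichletKernel_le hs hb (hB.measurableSet i) (hB.subset_simplex i)
  have hvi := hvv (x i) (hB.subset_simplex i (hx i))
  have hvi0 := hv0 (x i)
  have hv00 := hvi0.trans hvi
  calc _ ≤ N * (v (x i) * (volume.real (B i) *
        (kernelEnergy s b * ∫ x in B i, dirichletKernel s (b / 2) x))) := by gcongr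
    _ = v (x i) * (N * volume.real (B i)) *
        (kernelEnergy s b * ∫ x in B i, dirichletKernel s (b / 2) x) := by ring
    _ ≤ v₀ * (2 / f₀) * (kernelEnergy s b * ∫ x in B i, dirichletKernel s (b / 2) x) := by gcongr
    _ = _ := by ring

/-- The normalized contribution of a cell to the variance. -/
def cellTerm (s : EuclideanSpace ℝ (Fin d)) (b N v : ℝ) (B : Set (EuclideanSpace ℝ (Fin d))) : ℝ :=
  N * (v * (∫ y in B, dirichletKernel s b y) ^ 2) / kernelEnergy s b

/-! ### The contribution of a single cell to the variance. -/

section CellTerm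

variable {B : Set (EuclideanSpace ℝ (Fin d))} {s x₀ : EuclideanSpace ℝ (Fin d)} {b : ℝ}

lemma cellTerm_nonneg (hs : s ∈ simplex d) (hb : 0 < b) (hN : 0 < N) {w : ℝ} (hw : 0 ≤ w) :
    0 ≤ cellTerm s b N w B := by
  have := kernelEnergy_pos hs hb
  unfold cellTerm
  positivity

lemma cellTerm_le (hs : s ∈ simplex d) (hb : 0 < b) (hN : 0 < N) {w : ℝ} (hw : 0 ≤ w)
    (hBm : MeasurableSet B) (hBS : B ⊆ simplex d) :
    cellTerm s b N w B ≤ N * volume.real B * w * ∫ y in B, dirichletKernel s (b / 2) y := by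
  have hE := kernelEnergy_pos hs hb
  have hcs := sq_setIntegral_dirichletKernel_le hs hb hBm hBS
  rw [cellTerm, div_le_iff₀ hE]
  calc _ ≤ N * (w * (volume.real B *
        (kernelEnergy s b * ∫ y in B, dirichletKernel s (b / 2) y))) := by gcongr
    _ = _ := by ring

lemma le_cellTerm [NeZero d] (hs : s ∈ simplex d) (hb : 0 < b) (hN : 0 < N) {w : ℝ} (hw : 0 ≤ w)
    (hBm : MeasurableSet B) (hBS : B ⊆ simplex d) {c : ℝ} (hc : 0 < c)
    (hBc : ∀ z ∈ B, (∀ i, c ≤ z i) ∧ c ≤ lastCoord z) (hdiam : ∀ y ∈ B, ∀ z ∈ B, ‖y - z‖ ≤ a) :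
    (1 - 4 * (d * a / (b * c))) *
      (N * volume.real B * w * ∫ y in B, dirichletKernel s (b / 2) y) ≤ cellTerm s b N w B := by
  have hE := kernelEnergy_pos hs hb
  have hlow := le_sq_setIntegral_dirichletKernel hs hb hBm hBS hc hBc hdiam
  have hQ0 := setIntegral_dirichletKernel_nonneg hs (half_pos hb) hBm hBS
  have hV : 0 ≤ volume.real B := measureReal_nonneg
  refine (mul_le_mul_of_nonneg_right (Real.one_sub_le_exp_neg (4 * (d * a / (b * c))))
    (by positivity)).trans ?_
  rw [cellTerm, le_div_iff₀ hE]
  calc _ = N * (w * (Real.exp (-(4 * (d * a / (b * c)))) * (volume.real B *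
        (kernelEnergy s b * ∫ y in B, dirichletKernel s (b / 2) y)))) := by ring
    _ ≤ _ := by gcongr

/-- Two errors add up: the loss in Cauchy-Schwarz, of relative size `4 * (d * a / (b * c))`, and the
variation of the target `h` over the cell, bounded through `K`. -/
lemma abs_cellTerm_sub_le_of_near [NeZero d] (hs : s ∈ simplex d) (hb : 0 < b) (hN : 0 < N)
    {w h K M : ℝ} (hw : 0 ≤ w) (hBm : MeasurableSet B) (hBS : B ⊆ simplex d) {c : ℝ} (hc : 0 < c)
    (hBc : ∀ z ∈ B, (∀ i, c ≤ z i) ∧ c ≤ lastCoord z) (ha0 : 0 ≤ a)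
    (hdiam : ∀ y ∈ B, ∀ z ∈ B, ‖y - z‖ ≤ a) (hM : N * volume.real B * w ≤ M)
    (hK : ∀ y ∈ B, |N * volume.real B * w - h| ≤ K * (a + ‖y - s‖)) :
    |cellTerm s b N w B - h * ∫ y in B, dirichletKernel s (b / 2) y| ≤
      (K * a + M * (4 * (d * a / (b * c)))) * (∫ y in B, dirichletKernel s (b / 2) y) +
        K * ∫ y in B, ‖y - s‖ * dirichletKernel s (b / 2) y := by
  have hb2 := half_pos hb
  have hiq := (integrableOn_dirichletKernel hs hb2).mono_set hBS
  have hir := (integrableOn_mul_dirichletKernel (h := fun y => ‖y - s‖) hs hb2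
    (by fun_prop)).mono_set hBS
  have hQ0 := setIntegral_dirichletKernel_nonneg hs hb2 hBm hBS
  have hV : 0 ≤ volume.real B := measureReal_nonneg
  have hτ0 : 0 ≤ d * a / (b * c) := by positivity
  have hup := cellTerm_le hs hb hN hw hBm hBS
  have hlo := le_cellTerm hs hb hN hw hBm hBS hc hBc hdiam
  have hP0 : 0 ≤ N * volume.real B * w := by positivity
  have hPh : |N * volume.real B * w - h| * (∫ y in B, dirichletKernel s (b / 2) y) ≤
      K * a * (∫ y in B, dirichletKernel s (b / 2) y) +
        K * ∫ y in B, ‖y - s‖ * dirichletKernel s (b / 2) y := by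
    have h := setIntegral_mono_on (hiq.const_mul |N * volume.real B * w - h|)
      ((hiq.const_mul (K * a)).add (hir.const_mul K)) hBm
      fun y hy => by
        have h2 := mul_le_mul_of_nonneg_right (hK y hy) (dirichletKernel_nonneg hs hb2 (hBS hy))
        refine h2.trans_eq ?_
        simp only [Pi.add_apply]
        ring
    simp only [Pi.add_apply] at h
    rwa [integral_add (by exact hiq.const_mul _) (by exact hir.const_mul _), integral_const_mul,
      integral_const_mul, integral_const_mul] at h
  generalize (∫ y in B, dirichletKernel s (b / 2) y) = Q at *
  generalize N * volume.real B * w = P at *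
  generalize cellTerm s b N w B = T at *
  generalize d * a / (b * c) = τ at *
  have hTP : |T - P * Q| ≤ M * (4 * τ) * Q := by
    have h1 : P * (Q * (4 * τ)) ≤ M * (Q * (4 * τ)) := by gcongr
    have h2 : 0 ≤ P * (Q * (4 * τ)) := by positivity
    rw [abs_le]
    constructor <;> linarith
  calc |T - h * Q| = |(T - P * Q) + (P - h) * Q| := by congr 1; ring
    _ ≤ |T - P * Q| + |P - h| * Q := by
        refine (abs_add_le _ _).trans_eq ?_
        rw [abs_mul _ Q, abs_of_nonneg hQ0]
    _ ≤ M * (4 * τ) * Q + (K * a * Q + K * _) := add_le_add hTP hPh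
    _ = _ := by ring

/-- Far from `s` no comparison is needed: both quantities are at most `M` times the kernel mass of
the cell, and Markov's inequality makes that small. -/
lemma abs_cellTerm_sub_le_of_far (hs : s ∈ simplex d) (hb : 0 < b) (hN : 0 < N)
    {w h M : ℝ} (hw : 0 ≤ w) (hBm : MeasurableSet B) (hBS : B ⊆ simplex d) {r : ℝ} (hr : 0 < r)
    (hfar : ∀ y ∈ B, r ≤ ‖y - s‖) (hM : N * volume.real B * w ≤ M) (hh0 : 0 ≤ h) (hhM : h ≤ M) :
    |cellTerm s b N w B - h * ∫ y in B, dirichletKernel s (b / 2) y| ≤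
      M / r * ∫ y in B, ‖y - s‖ * dirichletKernel s (b / 2) y := by
  have hb2 := half_pos hb
  have hiq := (integrableOn_dirichletKernel hs hb2).mono_set hBS
  have hir := (integrableOn_mul_dirichletKernel (h := fun y => ‖y - s‖) hs hb2
    (by fun_prop)).mono_set hBS
  have hQ0 := setIntegral_dirichletKernel_nonneg hs hb2 hBm hBS
  have hup := cellTerm_le hs hb hN hw hBm hBS
  have hT0 := cellTerm_nonneg (B := B) hs hb hN hw
  have hQR : r * (∫ y in B, dirichletKernel s (b / 2) y) ≤
      ∫ y in B, ‖y - s‖ * dirichletKernel s (b / 2) y := by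
    have h := setIntegral_mono_on (hiq.const_mul r) hir hBm fun y hy =>
        mul_le_mul_of_nonneg_right (hfar y hy) (dirichletKernel_nonneg hs hb2 (hBS hy))
    rwa [integral_const_mul] at h
  generalize (∫ y in B, dirichletKernel s (b / 2) y) = Q at *
  generalize (∫ y in B, ‖y - s‖ * dirichletKernel s (b / 2) y) = R at *
  generalize N * volume.real B * w = P at *
  generalize cellTerm s b N w B = T at *
  have hM0 := hh0.trans hhM
  have e1 : T ≤ M * Q := hup.trans (by gcongr)
  have e2 : h * Q ≤ M * Q := by gcongr
  have e3 : 0 ≤ h * Q := by positivity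
  have e4 : M * Q ≤ M / r * R := by
    rw [div_mul_eq_mul_div, le_div_iff₀ hr, mul_assoc, mul_comm Q]
    gcongr
  refine le_trans ?_ e4
  rw [abs_le]; constructor <;> linarith

end CellTerm

lemma abs_sum_cellTerm_sub_le [NeZero d] (hf : LipschitzOnWith L f (simplex d)) (hf₀ : 0 < f₀)
    (hff : ∀ x ∈ simplex d, f₀ ≤ f x) (hv : LipschitzOnWith L' v (simplex d))
    (hv0 : ∀ x, 0 ≤ v x) (hvv : ∀ x ∈ simplex d, v x ≤ v₀)
    (hN : 0 < N) {n : ℕ} {B : Fin n → Set (EuclideanSpace ℝ (Fin d))} (hB : IsCellPartition B)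
    {x : Fin n → EuclideanSpace ℝ (Fin d)} (hx : ∀ i, x i ∈ B i) (ha0 : 0 ≤ a) (ha1 : a ≤ 1)
    (hdiam : ∀ i, ∀ y ∈ B i, ∀ z ∈ B i, ‖y - z‖ ≤ a)
    (hmass : ∀ i, |(∫ t in B i, f t) - N⁻¹| ≤ N⁻¹ * a) {s : EuclideanSpace ℝ (Fin d)}
    (hs : s ∈ simplex d) {b : ℝ} (hb : 0 < b) (hb1 : b ≤ 1) {η c : ℝ} (hη : 0 < η) (hc : 0 < c)
    (haη : a ≤ η / 2)
    (hnear : ∀ z ∈ simplex d, ‖z - s‖ < η → (∀ i, c ≤ z i) ∧ c ≤ lastCoord z) :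
    |∑ i, cellTerm s b N (v (x i)) (B i) - v s / f s| ≤
      (v₀ * ((2 * L / f₀ + 1) / f₀) + L' / f₀) * a + 2 * v₀ / f₀ * (4 * (d * a / (b * c))) +
      ((v₀ * ((2 * L / f₀ + 1) / f₀) + L' / f₀) + 2 * v₀ / f₀ / (η / 2)) *
        ((1 + d * (3 + (d + 1) * (d + 2))) * √(b / 2)) := by
  have hv00 : 0 ≤ v₀ := (hv0 s).trans (hvv s hs)
  have hb2 := half_pos hb
  have hfs := hf₀.trans_le (hff s hs)
  have hiq := integrableOn_dirichletKernel hs hb2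
  have hir := integrableOn_mul_dirichletKernel (h := fun y => ‖y - s‖) hs hb2 (by fun_prop)
  have hQsum : ∑ i, ∫ y in B i, dirichletKernel s (b / 2) y = 1 := by
    rw [hB.sum_integral hiq, integral_dirichletKernel hs hb2]
  have hRsum : ∑ i, ∫ y in B i, ‖y - s‖ * dirichletKernel s (b / 2) y ≤
      (1 + d * (3 + (d + 1) * (d + 2))) * √(b / 2) := by
    rw [hB.sum_integral hir]
    exact kernel_first_abs_le hs hb2 (by linarith)
  have hK : ∀ i, ∀ y ∈ B i, |N * volume.real (B i) * v (x i) - v s / f s| ≤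
      (v₀ * ((2 * L / f₀ + 1) / f₀) + L' / f₀) * (a + ‖y - s‖) := fun i y hy =>
    abs_mul_volume_mul_sub_le hf hf₀ hff hv hv0 hvv hN ha1 (hB.measurableSet i)
      (hB.subset_simplex i) (hdiam i) (hmass i) hs hy (hx i)
  have hM : ∀ i, N * volume.real (B i) * v (x i) ≤ 2 * v₀ / f₀ := by
    intro i
    have hvol : N * volume.real (B i) ≤ 2 / f₀ :=
      (mul_volume_le hf hf₀ hff hN (hB.measurableSet i) (hB.subset_simplex i) (hmass i)).trans
        (by gcongr; linarith)
    refine (mul_le_mul hvol (hvv (x i) (hB.subset_simplex i (hx i))) (hv0 _)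
      (by positivity)).trans_eq (by ring)
  have hhM : v s / f s ≤ 2 * v₀ / f₀ := by
    calc v s / f s ≤ v₀ / f₀ := div_le_div₀ hv00 (hvv s hs) hf₀ (hff s hs)
      _ ≤ 2 * v₀ / f₀ := by gcongr; linarith
  have hK0 : 0 ≤ v₀ * ((2 * L / f₀ + 1) / f₀) + L' / f₀ := by positivity
  have hM0 : 0 ≤ 2 * v₀ / f₀ := by positivity
  have hτ0 : 0 ≤ d * a / (b * c) := by positivity
  generalize v₀ * ((2 * L / f₀ + 1) / f₀) + L' / f₀ = K at *
  generalize 2 * v₀ / f₀ = M at *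
  have hcell : ∀ i, |cellTerm s b N (v (x i)) (B i) -
      v s / f s * ∫ y in B i, dirichletKernel s (b / 2) y| ≤
      (K * a + M * (4 * (d * a / (b * c)))) * (∫ y in B i, dirichletKernel s (b / 2) y) +
        (K + M / (η / 2)) * ∫ y in B i, ‖y - s‖ * dirichletKernel s (b / 2) y := by
    intro i
    have hBm := hB.measurableSet i
    have hBS := hB.subset_simplex i
    have hQ0 := setIntegral_dirichletKernel_nonneg hs hb2 hBm hBS
    have hR0 : 0 ≤ ∫ y in B i, ‖y - s‖ * dirichletKernel s (b / 2) y :=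
      setIntegral_nonneg hBm fun y hy =>
        mul_nonneg (norm_nonneg _) (dirichletKernel_nonneg hs hb2 (hBS hy))
    -- A cell either lies in the `η`-ball, where coordinates are at least `c`, or stays at distance
    -- at least `η / 2` from `s`, as its diameter is at most `η / 2`.
    by_cases hn : ∀ y ∈ B i, ‖y - s‖ < η
    · refine (abs_cellTerm_sub_le_of_near hs hb hN (hv0 _) hBm hBS hc
        (fun z hz => hnear z (hBS hz) (hn z hz)) ha0 (hdiam i) (hM i) (hK i)).trans ?_
      exact add_le_add le_rfl (mul_le_mul_of_nonneg_right
        (le_add_of_nonneg_right (div_nonneg hM0 (half_pos hη).le)) hR0)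
    · push Not at hn
      obtain ⟨y₀, hy₀, hfar⟩ := hn
      refine (abs_cellTerm_sub_le_of_far hs hb hN (hv0 _) hBm hBS (half_pos hη) (fun y hy => ?_)
        (hM i) (div_nonneg (hv0 s) hfs.le) hhM).trans ?_
      · have h1 := hdiam i y₀ hy₀ y hy
        have h2 : ‖y₀ - s‖ ≤ ‖y₀ - y‖ + ‖y - s‖ := by
          calc ‖y₀ - s‖ = ‖(y₀ - y) + (y - s)‖ := by congr 1; abel
            _ ≤ _ := norm_add_le _ _
        linarith
      · refine le_add_of_nonneg_of_le (mul_nonneg (add_nonneg (mul_nonneg hK0 ha0)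
          (mul_nonneg hM0 (mul_nonneg zero_le_four hτ0))) hQ0) ?_
        exact mul_le_mul_of_nonneg_right (le_add_of_nonneg_left hK0) hR0
  have hsplit : ∑ i, cellTerm s b N (v (x i)) (B i) - v s / f s =
      ∑ i, (cellTerm s b N (v (x i)) (B i) -
        v s / f s * ∫ y in B i, dirichletKernel s (b / 2) y) := by
    rw [Finset.sum_sub_distrib, ← Finset.mul_sum, hQsum, mul_one]
  rw [hsplit]
  refine (Finset.abs_sum_le_sum_abs _ _).trans ((Finset.sum_le_sum fun i _ => hcell i).trans ?_)
  rw [Finset.sum_add_distrib, ← Finset.mul_sum, ← Finset.mul_sum, hQsum, mul_one]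
  exact add_le_add le_rfl (mul_le_mul_of_nonneg_left hRsum
    (add_nonneg hK0 (div_nonneg hM0 (half_pos hη).le)))

end Variance

end

noncomputable section
variable {d : ℕ}

/-! ### Bias-variance decomposition -/

section Decomposition

variable {n : ℕ}

/-- The bias of the estimator at the point `s`. -/
def gmBias (m : EuclideanSpace ℝ (Fin d) → ℝ) (x : Fin n → EuclideanSpace ℝ (Fin d))
    (B : Fin n → Set (EuclideanSpace ℝ (Fin d))) (b : ℝ) (s : EuclideanSpace ℝ (Fin d)) : ℝ :=
  ∑ i, m (x i) * (∫ y in B i, dirichletKernel s b y) - m s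

/-- The variance of the estimator at the point `s`. -/
def gmVariance (v : EuclideanSpace ℝ (Fin d) → ℝ) (x : Fin n → EuclideanSpace ℝ (Fin d))
    (B : Fin n → Set (EuclideanSpace ℝ (Fin d))) (b : ℝ) (s : EuclideanSpace ℝ (Fin d)) : ℝ :=
  ∑ i, v (x i) * (∫ y in B i, dirichletKernel s b y) ^ 2

lemma continuousOn_kernelConst {b : ℝ} (hb : 0 < b) :
    ContinuousOn (fun s : EuclideanSpace ℝ (Fin d) => kernelConst s b) (simplex d) := by
  have hG : ∀ h : EuclideanSpace ℝ (Fin d) → ℝ, Continuous h → (∀ s ∈ simplex d, 0 < h s) →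
      ContinuousOn (fun s => Real.Gamma (h s)) (simplex d) := by
    intro h hc hpos s hs
    have h1 : ContinuousAt Real.Gamma (h s) :=
      (Real.differentiableAt_Gamma fun k hk => by
        have := hpos s hs
        have : (0 : ℝ) ≤ k := Nat.cast_nonneg k
        linarith).continuousAt
    exact (h1.comp hc.continuousAt).continuousWithinAt
  refine continuousOn_const.div ((hG (fun s => lastCoord s / b + 1) (by fun_prop)
    fun s hs => kernel_param_last_pos hs hb).mul (continuousOn_finsetProd _ fun i _ =>
      hG (fun s => s i / b + 1) (by fun_prop) fun s hs => kernel_param_pos hs hb i)) ?_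
  intro s hs
  exact (mul_pos (Real.Gamma_pos_of_pos (kernel_param_last_pos hs hb))
    (Finset.prod_pos fun i _ => Real.Gamma_pos_of_pos (kernel_param_pos hs hb i))).ne'

/-- The normalizing constant, continuous on the simplex because Gamma is evaluated at positive
arguments, is factored out; the remaining integrand is jointly measurable. -/
lemma aestronglyMeasurable_setIntegral_dirichletKernel {b : ℝ} (hb : 0 < b)
    (B : Set (EuclideanSpace ℝ (Fin d))) :
    AEStronglyMeasurable (fun s => ∫ y in B, dirichletKernel s b y)
      (volume.restrict (simplex d)) := by
  have h1 : ∀ s : EuclideanSpace ℝ (Fin d), ∫ y in B, dirichletKernel s b y =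
      kernelConst s b * ∫ y in B, (lastCoord y ^ (lastCoord s / b) * ∏ i, y i ^ (s i / b)) := by
    intro s
    simp_rw [dirichletKernel_eq, integral_const_mul]
  simp_rw [h1]
  refine ((continuousOn_kernelConst hb).aestronglyMeasurable measurableSet_simplex).mul ?_
  have hm : Measurable (fun p : EuclideanSpace ℝ (Fin d) × EuclideanSpace ℝ (Fin d) =>
      lastCoord p.2 ^ (lastCoord p.1 / b) * ∏ i, p.2 i ^ (p.1 i / b)) := by fun_prop
  exact (hm.stronglyMeasurable.integral_prod_right
    (ν := volume.restrict B)).aestronglyMeasurable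

lemma setIntegral_dirichletKernel_le_one {s : EuclideanSpace ℝ (Fin d)} (hs : s ∈ simplex d)
    {b : ℝ} (hb : 0 < b) {B : Set (EuclideanSpace ℝ (Fin d))} (hBS : B ⊆ simplex d) :
    ∫ y in B, dirichletKernel s b y ≤ 1 := by
  rw [← integral_dirichletKernel hs hb]
  refine setIntegral_mono_set (integrableOn_dirichletKernel hs hb) ?_ hBS.eventuallyLE
  exact (ae_restrict_iff' measurableSet_simplex).2
    (ae_of_all _ fun x hx => dirichletKernel_nonneg hs hb hx)

lemma integrableOn_simplex_of_bound {h : EuclideanSpace ℝ (Fin d) → ℝ}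
    (hm : AEStronglyMeasurable h (volume.restrict (simplex d))) (C : ℝ)
    (hC : ∀ s ∈ simplex d, |h s| ≤ C) : IntegrableOn h (simplex d) :=
  Integrable.mono' (integrableOn_const (C := C) volume_simplex_lt_top.ne) hm
    ((ae_restrict_iff' measurableSet_simplex).2 (ae_of_all _ hC))

variable {B : Fin n → Set (EuclideanSpace ℝ (Fin d))} {b : ℝ}

lemma aestronglyMeasurable_gmBias {m : EuclideanSpace ℝ (Fin d) → ℝ}
    (hm : ContinuousOn m (simplex d)) (x : Fin n → EuclideanSpace ℝ (Fin d)) (hb : 0 < b) :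
    AEStronglyMeasurable (gmBias m x B b) (volume.restrict (simplex d)) :=
  (Finset.aestronglyMeasurable_fun_sum _ fun i _ =>
    (aestronglyMeasurable_setIntegral_dirichletKernel hb (B i)).const_mul _).sub
    (hm.aestronglyMeasurable measurableSet_simplex)

lemma aestronglyMeasurable_gmVariance (v : EuclideanSpace ℝ (Fin d) → ℝ)
    (x : Fin n → EuclideanSpace ℝ (Fin d)) (hb : 0 < b) :
    AEStronglyMeasurable (gmVariance v x B b) (volume.restrict (simplex d)) :=
  Finset.aestronglyMeasurable_fun_sum _ fun i _ =>
    ((aestronglyMeasurable_setIntegral_dirichletKernel hb (B i)).pow 2).const_mul _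

lemma integrableOn_gmBias_sq {m : EuclideanSpace ℝ (Fin d) → ℝ} (hm : ContinuousOn m (simplex d))
    (hB : IsCellPartition B) (x : Fin n → EuclideanSpace ℝ (Fin d)) (hb : 0 < b) :
    IntegrableOn (fun s => gmBias m x B b s ^ 2) (simplex d) := by
  obtain ⟨C, hC⟩ := isCompact_simplex.exists_bound_of_continuousOn hm
  refine integrableOn_simplex_of_bound ((aestronglyMeasurable_gmBias hm x hb).pow 2)
    ((∑ i, |m (x i)| + C) ^ 2) fun s hs => ?_
  rw [abs_pow]
  refine pow_le_pow_left₀ (abs_nonneg _) ((abs_sub _ _).trans (add_le_add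
    ((Finset.abs_sum_le_sum_abs _ _).trans (Finset.sum_le_sum fun i _ => ?_)) (hC s hs))) 2
  rw [abs_mul, abs_of_nonneg (setIntegral_dirichletKernel_nonneg hs hb (hB.measurableSet i)
    (hB.subset_simplex i))]
  exact mul_le_of_le_one_right (abs_nonneg _)
    (setIntegral_dirichletKernel_le_one hs hb (hB.subset_simplex i))

lemma integrableOn_gmVariance (v : EuclideanSpace ℝ (Fin d) → ℝ)
    (hB : IsCellPartition B) (x : Fin n → EuclideanSpace ℝ (Fin d)) (hb : 0 < b) :
    IntegrableOn (gmVariance v x B b) (simplex d) := by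
  refine integrableOn_simplex_of_bound (aestronglyMeasurable_gmVariance v x hb)
    (∑ i, |v (x i)|) fun s hs => ?_
  refine (Finset.abs_sum_le_sum_abs _ _).trans (Finset.sum_le_sum fun i _ => ?_)
  have h0 := setIntegral_dirichletKernel_nonneg hs hb (hB.measurableSet i) (hB.subset_simplex i)
  rw [abs_mul, abs_of_nonneg (pow_nonneg h0 2)]
  exact mul_le_of_le_one_right (abs_nonneg _) (pow_le_one₀ h0
    (setIntegral_dirichletKernel_le_one hs hb (hB.subset_simplex i)))

lemma gmVariance_nonneg {v : EuclideanSpace ℝ (Fin d) → ℝ} (hv : ∀ x, 0 ≤ v x)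
    (x : Fin n → EuclideanSpace ℝ (Fin d)) (s : EuclideanSpace ℝ (Fin d)) :
    0 ≤ gmVariance v x B b s :=
  Finset.sum_nonneg fun _ _ => mul_nonneg (hv _) (sq_nonneg _)

/-- The discretization error is an average of `m (x i) - m y` over points of a common cell, with
total kernel mass one. -/
lemma abs_gmBias_sub_le {m : EuclideanSpace ℝ (Fin d) → ℝ} (hm : ContinuousOn m (simplex d))
    {K a : ℝ} (hK : 0 ≤ K) (hmK : ∀ x ∈ simplex d, ∀ y ∈ simplex d, |m y - m x| ≤ K * ‖y - x‖)
    (hB : IsCellPartition B) {x : Fin n → EuclideanSpace ℝ (Fin d)} (hx : ∀ i, x i ∈ B i)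
    (hdiam : ∀ i, ∀ y ∈ B i, ∀ z ∈ B i, ‖y - z‖ ≤ a) {s : EuclideanSpace ℝ (Fin d)}
    (hs : s ∈ simplex d) (hb : 0 < b) :
    |gmBias m x B b s - ((∫ y in simplex d, m y * dirichletKernel s b y) - m s)| ≤ K * a := by
  have hi := integrableOn_dirichletKernel hs hb
  have hmi := integrableOn_mul_dirichletKernel hs hb hm
  have heq : gmBias m x B b s - ((∫ y in simplex d, m y * dirichletKernel s b y) - m s) =
      ∑ i, ∫ y in B i, (m (x i) - m y) * dirichletKernel s b y := by
    simp_rw [sub_mul]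
    rw [Finset.sum_congr rfl fun i _ => integral_sub
      ((hi.mono_set (hB.subset_simplex i)).const_mul (m (x i)))
      (hmi.mono_set (hB.subset_simplex i)), Finset.sum_sub_distrib, hB.sum_integral hmi]
    simp_rw [integral_const_mul]
    rw [gmBias]
    ring
  have hsum := hB.sum_integral hi
  rw [integral_dirichletKernel hs hb] at hsum
  rw [heq, ← mul_one (K * a), ← hsum, Finset.mul_sum]
  refine (Finset.abs_sum_le_sum_abs _ _).trans (Finset.sum_le_sum fun i _ => ?_)
  rw [← integral_const_mul, ← Real.norm_eq_abs]
  refine norm_integral_le_of_norm_le ((hi.mono_set (hB.subset_simplex i)).const_mul _)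
    ((ae_restrict_iff' (hB.measurableSet i)).2 (ae_of_all _ fun y hy => ?_))
  have hyS := hB.subset_simplex i hy
  have hk := dirichletKernel_nonneg hs hb hyS
  rw [Real.norm_eq_abs, abs_mul, abs_of_nonneg hk]
  refine mul_le_mul_of_nonneg_right ?_ hk
  exact (hmK y hyS (x i) (hB.subset_simplex i (hx i))).trans
    (mul_le_mul_of_nonneg_left (hdiam i (x i) (hx i) y hy) hK)

end Decomposition

/-! ### The mean squared error as squared bias plus variance. -/

section MeanSquaredError

lemma squaredError_eq {Ω : Type*} {m : EuclideanSpace ℝ (Fin d) → ℝ}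
    {x : (n : ℕ) → Fin n → EuclideanSpace ℝ (Fin d)}
    {B : (n : ℕ) → Fin n → Set (EuclideanSpace ℝ (Fin d))} {ε : (n : ℕ) → Fin n → Ω → ℝ}
    (n : ℕ) (b : ℝ) (s : EuclideanSpace ℝ (Fin d)) (ω : Ω) :
    squaredError m x B ε n b s ω = (gmBias m (x n) (B n) b s +
      ∑ i, (∫ y in B n i, dirichletKernel s b y) * ε n i ω) ^ 2 := by
  rw [squaredError, sq_abs, gmEstimator, gmBias]
  congr 1
  simp only [response, add_mul, Finset.sum_add_distrib]
  rw [Finset.sum_congr rfl fun i _ => mul_comm (ε n i ω) _]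
  ring

variable {Ω : Type*} [MeasurableSpace Ω] {P : Measure Ω} [IsProbabilityMeasure P]
  {σ m : EuclideanSpace ℝ (Fin d) → ℝ} {x : (n : ℕ) → Fin n → EuclideanSpace ℝ (Fin d)}
  {B : (n : ℕ) → Fin n → Set (EuclideanSpace ℝ (Fin d))} {ε : (n : ℕ) → Fin n → Ω → ℝ}

lemma integrable_squaredError (hε : ErrorAssumption P σ x ε) (n : ℕ) (b : ℝ)
    (s : EuclideanSpace ℝ (Fin d)) : Integrable (squaredError m x B ε n b s) P := by
  have hL : ∀ i, MemLp (fun ω => (∫ y in B n i, dirichletKernel s b y) * ε n i ω) 2 P :=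
    fun i => (hε.memLp n i).const_mul _
  have hXL : MemLp (fun ω => ∑ i, (∫ y in B n i, dirichletKernel s b y) * ε n i ω) 2 P :=
    memLp_finsetSum _ fun i _ => hL i
  have h : MemLp (fun ω => gmBias m (x n) (B n) b s +
      ∑ i, (∫ y in B n i, dirichletKernel s b y) * ε n i ω) 2 P :=
    MemLp.add (f := fun _ => gmBias m (x n) (B n) b s) (memLp_const _) hXL
  exact h.integrable_sq.congr (ae_of_all _ fun ω => (squaredError_eq n b s ω).symm)

lemma mse_eq (hε : ErrorAssumption P σ x ε) (n : ℕ) (b : ℝ) (s : EuclideanSpace ℝ (Fin d)) :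
    mse P m x B ε n b s =
      gmBias m (x n) (B n) b s ^ 2 + gmVariance (fun y => σ y ^ 2) (x n) (B n) b s := by
  set w : Fin n → ℝ := fun i => ∫ y in B n i, dirichletKernel s b y with hw
  have hL : ∀ i, MemLp (fun ω => w i * ε n i ω) 2 P := fun i => (hε.memLp n i).const_mul _
  have hXL : MemLp (fun ω => ∑ i, w i * ε n i ω) 2 P := memLp_finsetSum _ fun i _ => hL i
  have hX0 : ∫ ω, ∑ i, w i * ε n i ω ∂P = 0 := by
    rw [integral_finsetSum _ fun i _ => (hL i).integrable (by norm_num)]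
    simp [integral_const_mul, hε.mean_zero]
  have hX2 : ∫ ω, (∑ i, w i * ε n i ω) ^ 2 ∂P =
      gmVariance (fun y => σ y ^ 2) (x n) (B n) b s := by
    have h1 := variance_of_integral_eq_zero hXL.aestronglyMeasurable.aemeasurable hX0
    rw [← h1, variance_fun_sum hL]
    simp_rw [covariance_const_mul_left, covariance_const_mul_right]
    refine Finset.sum_congr rfl fun i _ => ?_
    rw [Finset.sum_eq_single i (fun j _ hj => by rw [hε.uncorrelated n i j hj.symm]; simp)
      (by simp), covariance_self (hε.memLp n i).aestronglyMeasurable.aemeasurable, hε.variance_eq]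
    ring
  rw [mse]
  simp_rw [squaredError_eq, add_sq]
  rw [integral_add (by
      exact (integrable_const _).add ((hXL.integrable (by norm_num)).const_mul _)) (by
      exact hXL.integrable_sq), integral_add (integrable_const _) (by
      exact (hXL.integrable (by norm_num)).const_mul _), integral_const_mul, hX0, hX2]
  simp

end MeanSquaredError

end

noncomputable section
variable {d : ℕ}

/-! ### Asymptotics of the integrated squared bias and of the integrated variance -/

lemma PartitionAssumption.isCellPartition {f : EuclideanSpace ℝ (Fin d) → ℝ} {C₀ : ℝ}
    {x : (n : ℕ) → Fin n → EuclideanSpace ℝ (Fin d)}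
    {B : (n : ℕ) → Fin n → Set (EuclideanSpace ℝ (Fin d))}
    (h : PartitionAssumption f C₀ x B) {n : ℕ} (hn : 0 < n) : IsCellPartition (B n) :=
  ⟨h.compact n hn, h.disjoint_interior n hn, h.cover n hn, h.frontier_null n hn⟩

lemma PartitionAssumption.design_mem {f : EuclideanSpace ℝ (Fin d) → ℝ} {C₀ : ℝ}
    {x : (n : ℕ) → Fin n → EuclideanSpace ℝ (Fin d)}
    {B : (n : ℕ) → Fin n → Set (EuclideanSpace ℝ (Fin d))}
    (h : PartitionAssumption f C₀ x B) {n : ℕ} (hn : 0 < n) (i : Fin n) : x n i ∈ B n i :=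
  interior_subset (h.mem_interior n hn i)

/-- Puts both bounds in terms of a single `a = |C₀| n^{-1/d}`. The absolute value is taken because
no sign is assumed for `C₀`. -/
lemma PartitionAssumption.eventually_diam_mass {f : EuclideanSpace ℝ (Fin d) → ℝ} {C₀ : ℝ}
    {x : (n : ℕ) → Fin n → EuclideanSpace ℝ (Fin d)}
    {B : (n : ℕ) → Fin n → Set (EuclideanSpace ℝ (Fin d))}
    (h : PartitionAssumption f C₀ x B) :
    ∀ᶠ n : ℕ in atTop, (∀ i, ∀ y ∈ B n i, ∀ z ∈ B n i,
        ‖y - z‖ ≤ |C₀| * (n : ℝ) ^ (-(1 / (d : ℝ)))) ∧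
      ∀ i, |(∫ t in B n i, f t) - (n : ℝ)⁻¹| ≤
        (n : ℝ)⁻¹ * (|C₀| * (n : ℝ) ^ (-(1 / (d : ℝ)))) := by
  filter_upwards [h.diam_le, h.mass, eventually_gt_atTop 0] with n h1 h2 hn
  have hn' : (0 : ℝ) < n := by exact_mod_cast hn
  refine ⟨fun i y hy z hz => (h1 i y hy z hz).trans ?_, fun i => (h2 i).trans ?_⟩
  · gcongr
    exact le_abs_self _
  · rw [show -1 - 1 / (d : ℝ) = -1 + -(1 / (d : ℝ)) by ring, Real.rpow_add hn', Real.rpow_neg_one]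
    calc C₀ * ((n : ℝ)⁻¹ * (n : ℝ) ^ (-(1 / (d : ℝ)))) ≤
        |C₀| * ((n : ℝ)⁻¹ * (n : ℝ) ^ (-(1 / (d : ℝ)))) := by gcongr; exact le_abs_self _
      _ = _ := by ring

lemma BandwidthAssumption.tendsto_nhdsGT {b : ℕ → ℝ} (hb : BandwidthAssumption d b) :
    Tendsto b atTop (𝓝[>] 0) :=
  tendsto_nhdsWithin_iff.2 ⟨hb.tendsto_zero, (eventually_gt_atTop 0).mono fun n hn => hb.pos n hn⟩

lemma BandwidthAssumption.eventually_le_one {b : ℕ → ℝ} (hb : BandwidthAssumption d b) :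
    ∀ᶠ n in atTop, b n ≤ 1 :=
  hb.tendsto_zero.eventually (eventually_le_nhds one_pos)

lemma tendsto_const_mul_rpow_neg_inv [NeZero d] (C : ℝ) :
    Tendsto (fun n : ℕ => C * (n : ℝ) ^ (-(1 / (d : ℝ)))) atTop (𝓝 0) := by
  have hd : (0 : ℝ) < d := by exact_mod_cast NeZero.pos d
  simpa using ((tendsto_rpow_neg_atTop (by positivity : 0 < 1 / (d : ℝ))).comp
    tendsto_natCast_atTop_atTop).const_mul C

lemma exists_near_interior [NeZero d] {s : EuclideanSpace ℝ (Fin d)}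
    (hs : s ∈ interior (simplex d)) :
    ∃ η c : ℝ, 0 < η ∧ 0 < c ∧ ∀ z : EuclideanSpace ℝ (Fin d), ‖z - s‖ < η →
      (∀ i, c ≤ z i) ∧ c ≤ lastCoord z := by
  rw [interior_simplex] at hs
  have hev : ∀ᶠ c : ℝ in 𝓝[>] 0, (∀ i, c < s i) ∧ c < lastCoord s :=
    nhdsWithin_le_nhds ((eventually_all.2 fun i => eventually_lt_nhds (hs.1 i)).and
      (eventually_lt_nhds hs.2))
  obtain ⟨c, hc, hc0⟩ := (hev.and self_mem_nhdsWithin).exists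
  have hz : ∀ᶠ z in 𝓝 s, (∀ i, c < z i) ∧ c < lastCoord z := by
    refine (eventually_all.2 fun i => ?_).and ?_
    · exact (show Continuous fun z : EuclideanSpace ℝ (Fin d) => z i by fun_prop).continuousAt
        |>.eventually (eventually_gt_nhds (hc.1 i))
    · exact continuous_lastCoord.continuousAt.eventually (eventually_gt_nhds hc.2)
  obtain ⟨η, hη, h⟩ := Metric.eventually_nhds_iff.1 hz
  refine ⟨η, c, hη, hc0, fun z hzs => ?_⟩
  have := h (by rwa [dist_eq_norm])
  exact ⟨fun i => (this.1 i).le, this.2.le⟩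

section Asymptotic

variable [NeZero d] {f σ m : EuclideanSpace ℝ (Fin d) → ℝ} {C₀ : ℝ}
  {x : (n : ℕ) → Fin n → EuclideanSpace ℝ (Fin d)}
  {B : (n : ℕ) → Fin n → Set (EuclideanSpace ℝ (Fin d))} {b : ℕ → ℝ}

lemma tendsto_integral_gmBias_sq_div (hm : ContDiffOn ℝ 2 m (simplex d))
    (hB : PartitionAssumption f C₀ x B) (hb : BandwidthAssumption d b) :
    Tendsto (fun n => (∫ s in simplex d, gmBias m (x n) (B n) (b n) s ^ 2) / b n ^ 2) atTop
      (𝓝 (biasConst m)) := by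
  obtain ⟨K, hK0, hK⟩ := exists_abs_sub_le_simplex hm
  obtain ⟨C, hC0, hC⟩ := exists_abs_smoothing_bias_le hm
  set a : ℕ → ℝ := fun n => |C₀| * (n : ℝ) ^ (-(1 / (d : ℝ))) with ha
  have hab : Tendsto (fun n => K * (a n / b n)) atTop (𝓝 0) := by
    have := hb.inv_mul_tendsto_zero.const_mul (K * |C₀|)
    rw [mul_zero] at this
    exact this.congr fun n => by rw [ha]; ring
  have hclose : ∀ᶠ n : ℕ in atTop, ∀ s ∈ simplex d, |gmBias m (x n) (B n) (b n) s / b n -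
      ((∫ y in simplex d, m y * dirichletKernel s (b n) y) - m s) / b n| ≤ K * (a n / b n) := by
    filter_upwards [hB.eventually_diam_mass, eventually_gt_atTop 0] with n h1 hn s hs
    have hbn := hb.pos n hn
    have h := abs_gmBias_sub_le hm.continuousOn hK0 hK (hB.isCellPartition hn)
      (hB.design_mem hn) h1.1 hs hbn
    rw [← sub_div, abs_div, abs_of_pos hbn, ← mul_div_assoc]
    gcongr
  have hptw : ∀ s ∈ simplex d, Tendsto (fun n => gmBias m (x n) (B n) (b n) s / b n) atTop
      (𝓝 (biasFun m s)) := by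
    intro s hs
    have h1 := (tendsto_smoothing_bias_div hm hs).comp hb.tendsto_nhdsGT
    have h2 : Tendsto (fun n => gmBias m (x n) (B n) (b n) s / b n -
        ((∫ y in simplex d, m y * dirichletKernel s (b n) y) - m s) / b n) atTop (𝓝 0) := by
      refine squeeze_zero_norm' ?_ hab
      filter_upwards [hclose] with n hn
      exact hn s hs
    simpa using h2.add h1
  -- `C` bounds the smoothing bias divided by `b n`, and 1 eventually bounds the discretization
  -- error divided by `b n`.
  have hdom : ∀ᶠ n : ℕ in atTop, ∀ s ∈ simplex d,
      |gmBias m (x n) (B n) (b n) s / b n| ≤ C + 1 := by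
    filter_upwards [hclose, hb.eventually_le_one, eventually_gt_atTop 0,
      hab.eventually (eventually_le_nhds one_pos)] with n h1 h2 hn h3 s hs
    have hbn := hb.pos n hn
    have h4 : |((∫ y in simplex d, m y * dirichletKernel s (b n) y) - m s) / b n| ≤ C := by
      rw [abs_div, abs_of_pos hbn, div_le_iff₀ hbn]
      exact hC s hs (b n) hbn h2
    have h5 := abs_sub_abs_le_abs_sub (gmBias m (x n) (B n) (b n) s / b n)
      (((∫ y in simplex d, m y * dirichletKernel s (b n) y) - m s) / b n)
    have h6 := h1 s hs
    linarith
  have hlim := tendsto_integral_filter_of_dominated_convergence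
    (μ := volume.restrict (simplex d)) (l := atTop)
    (F := fun (n : ℕ) s => (gmBias m (x n) (B n) (b n) s / b n) ^ 2)
    (f := fun s => biasFun m s ^ 2) (fun _ => (C + 1) ^ 2) ?_ ?_
    (integrableOn_const volume_simplex_lt_top.ne) ?_
  · refine hlim.congr fun n => ?_
    simp_rw [div_pow, integral_div]
  · filter_upwards [eventually_gt_atTop 0] with n hn
    simp_rw [div_eq_mul_inv]
    exact ((aestronglyMeasurable_gmBias hm.continuousOn (x n) (hb.pos n hn)).mul_const _).pow 2
  · filter_upwards [hdom] with n hn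
    refine (ae_restrict_iff' measurableSet_simplex).2 (ae_of_all _ fun s hs => ?_)
    rw [norm_pow]
    exact pow_le_pow_left₀ (norm_nonneg _) (hn s hs) 2
  · exact (ae_restrict_iff' measurableSet_simplex).2 (ae_of_all _ fun s hs => (hptw s hs).pow 2)

/-- The energy contributes `psi s` and the sum of cell terms contributes `σ s ^ 2 / f s`. The
interior point provides the margin `c` needed for near equality in Cauchy-Schwarz. -/
lemma tendsto_gmVariance (hf : ∃ L, LipschitzOnWith L f (simplex d))
    (hσ : ∃ L, LipschitzOnWith L (fun y => σ y ^ 2) (simplex d)) (hbd : BoundsAssumption f σ)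
    (hB : PartitionAssumption f C₀ x B) (hb : BandwidthAssumption d b)
    {s : EuclideanSpace ℝ (Fin d)} (hs : s ∈ interior (simplex d)) :
    Tendsto (fun n : ℕ => n * b n ^ ((d : ℝ) / 2) *
      gmVariance (fun y => σ y ^ 2) (x n) (B n) (b n) s) atTop (𝓝 (psi s * σ s ^ 2 / f s)) := by
  obtain ⟨L, hL⟩ := hf
  obtain ⟨L', hL'⟩ := hσ
  obtain ⟨f₀, hf₀, hff⟩ := hbd.lower_f
  obtain ⟨v₀, hv₀, hvv⟩ := hbd.upper_variance
  obtain ⟨η, c, hη, hc, hnear⟩ := exists_near_interior hs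
  have hmem := interior_subset hs
  set a : ℕ → ℝ := fun n => |C₀| * (n : ℝ) ^ (-(1 / (d : ℝ))) with ha
  have ha0 : Tendsto a atTop (𝓝 0) := tendsto_const_mul_rpow_neg_inv |C₀|
  have hab : Tendsto (fun n => d * a n / (b n * c)) atTop (𝓝 0) := by
    have := hb.inv_mul_tendsto_zero.const_mul (d * |C₀| / c)
    rw [mul_zero] at this
    refine this.congr fun n => ?_
    rw [ha]
    ring
  have hsb : Tendsto (fun n => √(b n / 2)) atTop (𝓝 0) := by
    simpa using (hb.tendsto_zero.div_const 2).sqrt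
  have hcell : Tendsto (fun n : ℕ => ∑ i, cellTerm s (b n) n (σ (x n i) ^ 2) (B n i)) atTop
      (𝓝 (σ s ^ 2 / f s)) := by
    rw [tendsto_iff_norm_sub_tendsto_zero]
    have hlim := ((ha0.const_mul (v₀ * ((2 * L / f₀ + 1) / f₀) + L' / f₀)).add
      ((hab.const_mul 4).const_mul (2 * v₀ / f₀))).add
      ((hsb.const_mul (1 + d * (3 + (d + 1) * (d + 2) : ℝ))).const_mul
        ((v₀ * ((2 * L / f₀ + 1) / f₀) + L' / f₀) + 2 * v₀ / f₀ / (η / 2)))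
    simp only [mul_zero, add_zero] at hlim
    refine squeeze_zero' (Eventually.of_forall fun n => norm_nonneg _) ?_ hlim
    filter_upwards [hB.eventually_diam_mass, eventually_gt_atTop 0, hb.eventually_le_one,
      ha0.eventually (eventually_le_nhds one_pos),
      ha0.eventually (eventually_le_nhds (half_pos hη))] with n h1 hn h2 h3 h4
    exact abs_sum_cellTerm_sub_le hL hf₀ hff hL' (fun y => sq_nonneg (σ y)) hvv
      (Nat.cast_pos.2 hn) (hB.isCellPartition hn) (hB.design_mem hn)
      (by simp only [ha]; positivity) h3 h1.1 h1.2 hmem (hb.pos n hn) h2 hη hc h4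
      fun z _ hz => hnear z hz
  have hE := (tendsto_rpow_mul_kernelEnergy hs).comp hb.tendsto_nhdsGT
  have h := hE.mul hcell
  rw [← mul_div_assoc] at h
  refine h.congr' ?_
  filter_upwards [eventually_gt_atTop 0] with n hn
  have hEn := (kernelEnergy_pos hmem (hb.pos n hn)).ne'
  simp only [Function.comp_apply, cellTerm, ← Finset.sum_div, ← Finset.mul_sum, gmVariance]
  field_simp

lemma tendsto_integral_gmVariance (hf : ∃ L, LipschitzOnWith L f (simplex d))
    (hσ : ∃ L, LipschitzOnWith L (fun y => σ y ^ 2) (simplex d)) (hbd : BoundsAssumption f σ)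
    (hB : PartitionAssumption f C₀ x B) (hb : BandwidthAssumption d b) :
    Tendsto (fun n : ℕ => n * b n ^ ((d : ℝ) / 2) *
      ∫ s in simplex d, gmVariance (fun y => σ y ^ 2) (x n) (B n) (b n) s) atTop
      (𝓝 (varConst f σ)) := by
  have hf' := hf
  obtain ⟨L, hL⟩ := hf
  obtain ⟨f₀, hf₀, hff⟩ := hbd.lower_f
  obtain ⟨v₀, hv₀, hvv⟩ := hbd.upper_variance
  obtain ⟨C, hC0, hC⟩ := exists_rpow_mul_kernelEnergy_le d
  have ha0 : Tendsto (fun n : ℕ => |C₀| * (n : ℝ) ^ (-(1 / (d : ℝ)))) atTop (𝓝 0) :=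
    tendsto_const_mul_rpow_neg_inv |C₀|
  have hlim := tendsto_integral_filter_of_dominated_convergence
    (μ := volume.restrict (simplex d)) (l := atTop)
    (F := fun (n : ℕ) s => n * b n ^ ((d : ℝ) / 2) *
      gmVariance (fun y => σ y ^ 2) (x n) (B n) (b n) s)
    (f := fun s => psi s * σ s ^ 2 / f s) (fun s => 2 * v₀ / f₀ * C * psi s) ?_ ?_
    (integrableOn_psi.const_mul _) ?_
  · refine hlim.congr fun n => ?_
    rw [integral_const_mul]
  · filter_upwards [eventually_gt_atTop 0] with n hn
    exact (aestronglyMeasurable_gmVariance _ (x n) (hb.pos n hn)).const_mul _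
  · filter_upwards [hB.eventually_diam_mass, eventually_gt_atTop 0,
      ha0.eventually (eventually_le_nhds one_pos), hb.tendsto_nhdsGT.eventually hC]
      with n h1 hn h3 h4
    filter_upwards [ae_mem_interior_simplex] with s hs
    have hbn := hb.pos n hn
    have h5 := sum_sq_weight_le hL hf₀ hff (fun y => sq_nonneg (σ y)) hvv
      (Nat.cast_pos.2 hn) (hB.isCellPartition hn) (hB.design_mem hn) h3 h1.2
      (interior_subset hs) hbn
    have h6 := gmVariance_nonneg (b := b n) (B := B n) (fun y => sq_nonneg (σ y)) (x n) s
    rw [Real.norm_eq_abs, abs_of_nonneg (by positivity)]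
    calc _ = b n ^ ((d : ℝ) / 2) *
          (n * gmVariance (fun y => σ y ^ 2) (x n) (B n) (b n) s) := by ring
      _ ≤ b n ^ ((d : ℝ) / 2) * (2 * v₀ / f₀ * kernelEnergy s (b n)) :=
          mul_le_mul_of_nonneg_left h5 (Real.rpow_nonneg hbn.le _)
      _ = 2 * v₀ / f₀ * (b n ^ ((d : ℝ) / 2) * kernelEnergy s (b n)) := by ring
      _ ≤ 2 * v₀ / f₀ * (C * psi s) :=
          mul_le_mul_of_nonneg_left (h4 s hs) (by positivity)
      _ = _ := by ring
  · filter_upwards [ae_mem_interior_simplex] with s hs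
    exact tendsto_gmVariance hf' hσ hbd hB hb hs

omit [NeZero d] in
lemma integrableOn_psi_mul_div (hf : ∃ L, LipschitzOnWith L f (simplex d))
    (hσ : ∃ L, LipschitzOnWith L (fun y => σ y ^ 2) (simplex d)) (hbd : BoundsAssumption f σ) :
    IntegrableOn (fun s => psi s * σ s ^ 2 / f s) (simplex d) := by
  obtain ⟨L, hL⟩ := hf
  obtain ⟨L', hL'⟩ := hσ
  obtain ⟨f₀, hf₀, hff⟩ := hbd.lower_f
  have hc : ContinuousOn (fun s => σ s ^ 2 / f s) (simplex d) :=
    hL'.continuousOn.div hL.continuousOn fun s hs => (hf₀.trans_le (hff s hs)).ne'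
  refine IntegrableOn.congr_fun (integrableOn_psi.continuousOn_mul hc isCompact_simplex)
    (fun s _ => ?_) measurableSet_simplex
  ring

variable {Ω : Type*} [MeasurableSpace Ω] {P : Measure Ω} [IsProbabilityMeasure P]
  {ε : (n : ℕ) → Fin n → Ω → ℝ}

omit [NeZero d] in
lemma integrableOn_mse (hm : ContinuousOn m (simplex d)) (hB : PartitionAssumption f C₀ x B)
    (hε : ErrorAssumption P σ x ε) {n : ℕ} (hn : 0 < n) {β : ℝ} (hβ : 0 < β) :
    IntegrableOn (mse P m x B ε n β) (simplex d) := by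
  refine ((integrableOn_gmBias_sq hm (hB.isCellPartition hn) (x n) hβ).add
    (integrableOn_gmVariance (fun y => σ y ^ 2) (hB.isCellPartition hn) (x n) hβ)).congr
    (ae_of_all _ fun s => (mse_eq hε n β s).symm)

omit [NeZero d] in
lemma mise_eq (hm : ContinuousOn m (simplex d)) (hB : PartitionAssumption f C₀ x B)
    (hε : ErrorAssumption P σ x ε) {n : ℕ} (hn : 0 < n) {β : ℝ} (hβ : 0 < β) :
    mise P m x B ε n β = (∫ s in simplex d, gmBias m (x n) (B n) β s ^ 2) +
      ∫ s in simplex d, gmVariance (fun y => σ y ^ 2) (x n) (B n) β s := by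
  rw [mise, ← integral_add (integrableOn_gmBias_sq hm (hB.isCellPartition hn) (x n) hβ)
    (integrableOn_gmVariance (fun y => σ y ^ 2) (hB.isCellPartition hn) (x n) hβ)]
  exact integral_congr_ae (ae_of_all _ fun s => mse_eq hε n β s)

lemma exists_mise_expansion (hreg : RegularityAssumption f σ m) (hbd : BoundsAssumption f σ)
    (hB : PartitionAssumption f C₀ x B) (hε : ErrorAssumption P σ x ε)
    (hb : BandwidthAssumption d b) :
    ∃ r₁ r₂ : ℕ → ℝ, r₁ =o[atTop] (fun n => b n ^ 2) ∧
      r₂ =o[atTop] (fun n => (n : ℝ)⁻¹ * b n ^ (-((d : ℝ) / 2))) ∧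
      ∀ n : ℕ, 0 < n → mise P m x B ε n (b n) =
        b n ^ 2 * biasConst m + (n : ℝ)⁻¹ * b n ^ (-((d : ℝ) / 2)) * varConst f σ
          + r₁ n + r₂ n := by
  refine ⟨fun n => (∫ s in simplex d, gmBias m (x n) (B n) (b n) s ^ 2) - b n ^ 2 * biasConst m,
    fun n => (∫ s in simplex d, gmVariance (fun y => σ y ^ 2) (x n) (B n) (b n) s) -
      (n : ℝ)⁻¹ * b n ^ (-((d : ℝ) / 2)) * varConst f σ, ?_, ?_, fun n hn => ?_⟩
  · have h := tendsto_integral_gmBias_sq_div hreg.contDiff_m hB hb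
    rw [isLittleO_iff_tendsto' ((eventually_gt_atTop 0).mono fun n hn h0 =>
      absurd h0 (pow_pos (hb.pos n hn) 2).ne')]
    have h2 := h.sub_const (biasConst m)
    rw [sub_self] at h2
    refine h2.congr' ?_
    filter_upwards [eventually_gt_atTop 0] with n hn
    have := (hb.pos n hn).ne'
    field_simp
  · have h := tendsto_integral_gmVariance hreg.lipschitz_f hreg.lipschitz_variance hbd hB hb
    have hpos : ∀ n : ℕ, 0 < n → 0 < (n : ℝ)⁻¹ * b n ^ (-((d : ℝ) / 2)) := fun n hn =>
      mul_pos (inv_pos.2 (Nat.cast_pos.2 hn)) (Real.rpow_pos_of_pos (hb.pos n hn) _)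
    rw [isLittleO_iff_tendsto' ((eventually_gt_atTop 0).mono fun n hn h0 =>
      absurd h0 (hpos n hn).ne')]
    have h2 := h.sub_const (varConst f σ)
    rw [sub_self] at h2
    refine h2.congr' ?_
    filter_upwards [eventually_gt_atTop 0] with n hn
    rw [sub_div, mul_div_cancel_left₀ _ (hpos n hn).ne', Real.rpow_neg (hb.pos n hn).le]
    have h3 : (n : ℝ) ≠ 0 := (Nat.cast_pos.2 hn).ne'
    have h4 := (Real.rpow_pos_of_pos (hb.pos n hn) ((d : ℝ) / 2)).ne'
    field_simp
  · rw [mise_eq hreg.contDiff_m.continuousOn hB hε hn (hb.pos n hn)]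
    ring

end Asymptotic

end

noncomputable section
variable {d : ℕ}

/-! ### The optimal bandwidth -/

/-- The leading term of the mean integrated squared error. -/
def leadingRisk (d : ℕ) (G V : ℝ) (n : ℕ) (b : ℝ) : ℝ :=
  b ^ 2 * G + (n : ℝ)⁻¹ * b ^ (-((d : ℝ) / 2)) * V

/-- With `t = log u` the two exponentials have opposite slopes at zero, so linear terms cancel. The
exponential with nonnegative exponent supplies the quadratic term: `2 t^2` for `t ≥ 0`, and `D t^2 /
2` for `t ≤ 0`, where `1 ≤ D` enters. -/
lemma sq_log_div_two_le {D u : ℝ} (hD : 1 ≤ D) (hu : 0 < u) :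
    1 + 4 / D + Real.log u ^ 2 / 2 ≤ u ^ 2 + 4 / D * u ^ (-(D / 2)) := by
  have h1 : u ^ 2 = Real.exp (2 * Real.log u) := by
    rw [two_mul, Real.exp_add, Real.exp_log hu, sq]
  have h2 : u ^ (-(D / 2)) = Real.exp (-(D / 2) * Real.log u) := by
    rw [Real.rpow_def_of_pos hu, mul_comm]
  rw [h1, h2]
  generalize Real.log u = t
  have hD0 : 0 < D := by linarith
  have hlin : 4 / D * (-(D / 2) * t + 1) = 4 / D - 2 * t := by field_simp; ring
  rcases le_total 0 t with ht | ht
  · have e1 := Real.quadratic_le_exp_of_nonneg (by linarith : 0 ≤ 2 * t)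
    have e2 := mul_le_mul_of_nonneg_left (Real.add_one_le_exp (-(D / 2) * t))
      (by positivity : 0 ≤ 4 / D)
    rw [hlin] at e2
    nlinarith [sq_nonneg t]
  · have e1 := Real.add_one_le_exp (2 * t)
    have e2 := mul_le_mul_of_nonneg_left
      (Real.quadratic_le_exp_of_nonneg (by nlinarith : 0 ≤ -(D / 2) * t))
      (by positivity : 0 ≤ 4 / D)
    have e3 : 4 / D * (1 + -(D / 2) * t + (-(D / 2) * t) ^ 2 / 2) =
        4 / D - 2 * t + D * t ^ 2 / 2 := by field_simp; ring
    rw [e3] at e2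
    nlinarith [mul_nonneg (by linarith : 0 ≤ D - 1) (sq_nonneg t)]

section Optimal

variable {G V : ℝ}

lemma leadingRisk_pos (hG : 0 < G) (hV : 0 < V) (n : ℕ) {b : ℝ} (hb : 0 < b) :
    0 < leadingRisk d G V n b := by
  unfold leadingRisk
  have := Real.rpow_pos_of_pos hb (-((d : ℝ) / 2))
  positivity

lemma optBandwidth_pos (hd : 1 ≤ d) (hG : 0 < G) (hV : 0 < V) {n : ℕ} (hn : 0 < n) :
    0 < optBandwidth d G V n := by
  have : (0 : ℝ) < n := Nat.cast_pos.2 hn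
  have : (0 : ℝ) < d := Nat.cast_pos.2 hd
  unfold optBandwidth
  positivity

/-- The first order condition for the minimum: it fixes the ratio of the variance term to the
squared bias term at `4 / d`. -/
lemma inv_mul_rpow_optBandwidth (hd : 1 ≤ d) (hG : 0 < G) (hV : 0 < V) {n : ℕ} (hn : 0 < n) :
    (n : ℝ)⁻¹ * optBandwidth d G V n ^ (-((d : ℝ) / 2)) * V =
      4 / d * G * optBandwidth d G V n ^ 2 := by
  have hn' : (0 : ℝ) < n := Nat.cast_pos.2 hn
  have hd' : (0 : ℝ) < d := Nat.cast_pos.2 hd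
  have hX : 0 < (d : ℝ) / 4 * (V / G) := by positivity
  have hpos := optBandwidth_pos hd hG hV hn
  have hkey : optBandwidth d G V n ^ 2 * optBandwidth d G V n ^ ((d : ℝ) / 2) =
      (n : ℝ)⁻¹ * ((d : ℝ) / 4 * (V / G)) := by
    rw [← Real.rpow_natCast, ← Real.rpow_add hpos, optBandwidth,
      Real.mul_rpow (by positivity) (by positivity), ← Real.rpow_mul hn'.le,
      ← Real.rpow_mul hX.le]
    have e1 : -(2 / ((d : ℝ) + 4)) * (((2 : ℕ) : ℝ) + d / 2) = -1 := by
      push_cast; field_simp; ring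
    have e2 : 2 / ((d : ℝ) + 4) * (((2 : ℕ) : ℝ) + d / 2) = 1 := by
      push_cast; field_simp; ring
    rw [e1, e2, Real.rpow_neg_one, Real.rpow_one]
  rw [Real.rpow_neg hpos.le]
  have h := (Real.rpow_pos_of_pos hpos ((d : ℝ) / 2)).ne'
  field_simp at hkey ⊢
  linarith

lemma leadingRisk_mul_optBandwidth (hd : 1 ≤ d) (hG : 0 < G) (hV : 0 < V) {n : ℕ} (hn : 0 < n)
    {u : ℝ} (hu : 0 < u) :
    leadingRisk d G V n (u * optBandwidth d G V n) =
      G * optBandwidth d G V n ^ 2 * (u ^ 2 + 4 / d * u ^ (-((d : ℝ) / 2))) := by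
  have hpos := optBandwidth_pos hd hG hV hn
  have h := inv_mul_rpow_optBandwidth hd hG hV hn
  rw [leadingRisk, Real.mul_rpow hu.le hpos.le, mul_pow]
  calc _ = u ^ 2 * optBandwidth d G V n ^ 2 * G + u ^ (-((d : ℝ) / 2)) *
        ((n : ℝ)⁻¹ * optBandwidth d G V n ^ (-((d : ℝ) / 2)) * V) := by ring
    _ = _ := by rw [h]; ring

lemma leadingRisk_optBandwidth (hd : 1 ≤ d) (hG : 0 < G) (hV : 0 < V) {n : ℕ} (hn : 0 < n) :
    leadingRisk d G V n (optBandwidth d G V n) =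
      G * optBandwidth d G V n ^ 2 * (1 + 4 / d) := by
  have := leadingRisk_mul_optBandwidth hd hG hV hn one_pos
  simpa using this

lemma leadingRisk_optBandwidth_eq (hd : 1 ≤ d) (hG : 0 < G) (hV : 0 < V) {n : ℕ} (hn : 0 < n) :
    leadingRisk d G V n (optBandwidth d G V n) = (n : ℝ) ^ (-(4 / ((d : ℝ) + 4)))
      * ((1 + (d : ℝ) / 4) / ((d : ℝ) / 4) ^ ((d : ℝ) / ((d : ℝ) + 4)))
      * (V ^ (4 / ((d : ℝ) + 4)) / G ^ (-((d : ℝ) / ((d : ℝ) + 4)))) := by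
  have hn' : (0 : ℝ) < n := Nat.cast_pos.2 hn
  have hd' : (0 : ℝ) < d := Nat.cast_pos.2 hd
  have hd4 : (0 : ℝ) < d / 4 := by positivity
  have hX : 0 < (d : ℝ) / 4 * (V / G) := by positivity
  rw [leadingRisk_optBandwidth hd hG hV hn, optBandwidth, mul_pow, ← Real.rpow_mul_natCast hn'.le,
    ← Real.rpow_mul_natCast hX.le]
  rw [show -(2 / ((d : ℝ) + 4)) * ((2 : ℕ) : ℝ) = -(4 / (d + 4)) by push_cast; ring,
    show 2 / ((d : ℝ) + 4) * ((2 : ℕ) : ℝ) = 4 / (d + 4) by push_cast; ring,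
    Real.mul_rpow hd4.le (by positivity), Real.div_rpow hV.le hG.le]
  have e : (d : ℝ) / (d + 4) = 1 - 4 / (d + 4) := by field_simp; ring
  rw [Real.rpow_neg hG.le, e, Real.rpow_sub hd4, Real.rpow_sub hG, Real.rpow_one, Real.rpow_one]
  have p1 := (Real.rpow_pos_of_pos hd4 (4 / ((d : ℝ) + 4))).ne'
  have p2 := (Real.rpow_pos_of_pos hG (4 / ((d : ℝ) + 4))).ne'
  field_simp
  ring

lemma bandwidthAssumption_optBandwidth (hd : 1 ≤ d) (hd3 : d ≤ 3) (hG : 0 < G) (hV : 0 < V) :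
    BandwidthAssumption d (optBandwidth d G V) := by
  have hd' : (0 : ℝ) < d := Nat.cast_pos.2 hd
  have hd3' : (d : ℝ) ≤ 3 := by exact_mod_cast hd3
  refine ⟨fun n hn => optBandwidth_pos hd hG hV hn, ?_, ?_⟩
  · have h := ((tendsto_rpow_neg_atTop (by positivity : 0 < 2 / ((d : ℝ) + 4))).comp
      tendsto_natCast_atTop_atTop).mul_const (((d : ℝ) / 4 * (V / G)) ^ (2 / ((d : ℝ) + 4)))
    rw [zero_mul] at h
    exact h
  -- The only place where `d ≤ 3` matters: `2 / (d + 4) < 1 / d` means `d < 4`.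
  · have hexp : 0 < 1 / (d : ℝ) - 2 / (d + 4) := by
      rw [sub_pos, div_lt_div_iff₀ (by positivity) hd']
      linarith
    have h := ((tendsto_rpow_neg_atTop hexp).comp tendsto_natCast_atTop_atTop).const_mul
      ((((d : ℝ) / 4 * (V / G)) ^ (2 / ((d : ℝ) + 4)))⁻¹)
    rw [mul_zero] at h
    refine h.congr' ?_
    filter_upwards [eventually_gt_atTop 0] with n hn
    have hn' : (0 : ℝ) < n := Nat.cast_pos.2 hn
    rw [optBandwidth, mul_inv, ← Real.rpow_neg hn'.le, neg_neg, Function.comp_apply,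
      show -(1 / (d : ℝ) - 2 / (d + 4)) = 2 / (d + 4) + -(1 / d) by ring, Real.rpow_add hn']
    ring

lemma leadingRisk_optBandwidth_le (hd : 1 ≤ d) (hG : 0 < G) (hV : 0 < V) {n : ℕ} (hn : 0 < n)
    {b : ℝ} (hb : 0 < b) :
    leadingRisk d G V n (optBandwidth d G V n) *
        (1 + Real.log (b / optBandwidth d G V n) ^ 2 / 2 / (1 + 4 / d)) ≤
      leadingRisk d G V n b := by
  have hpos := optBandwidth_pos hd hG hV hn
  have hd' : (0 : ℝ) < d := Nat.cast_pos.2 hd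
  have h1 := sq_log_div_two_le (D := d) (by exact_mod_cast hd) (div_pos hb hpos)
  have h2 := leadingRisk_mul_optBandwidth hd hG hV hn (div_pos hb hpos)
  rw [div_mul_cancel₀ _ hpos.ne'] at h2
  rw [h2, leadingRisk_optBandwidth hd hG hV hn, mul_assoc]
  refine mul_le_mul_of_nonneg_left (le_trans (le_of_eq ?_) h1) (by positivity)
  field_simp

/-- Everything is transferred from `R` to the leading risk, where `leadingRisk_optBandwidth_le`
applies. For uniqueness, a risk ratio tending to one forces the squared logarithm of the bandwidth
ratio to vanish. -/
lemma isAsymptoticallyOptimal_optBandwidth (hd : 1 ≤ d) (hd3 : d ≤ 3) (hG : 0 < G) (hV : 0 < V)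
    {R : ℕ → ℝ → ℝ} (hR : ∀ b : ℕ → ℝ, BandwidthAssumption d b →
      Tendsto (fun n => R n (b n) / leadingRisk d G V n (b n)) atTop (𝓝 1)) :
    IsAsymptoticallyOptimal d R (optBandwidth d G V) := by
  have hadm := bandwidthAssumption_optBandwidth hd hd3 hG hV
  have hRo := hR _ hadm
  refine ⟨hadm, fun b hb δ hδ => ?_, fun b hb hratio => ?_⟩
  · have hRb := hR b hb
    have hq := (hRo.div hRb one_ne_zero).eventually
      (eventually_le_nhds (by linarith : (1 : ℝ) / 1 < 1 + δ))
    filter_upwards [hq, hRb.eventually (eventually_gt_nhds one_pos), eventually_gt_atTop 0]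
      with n h1 h2 hn
    have hΦo := leadingRisk_pos (d := d) hG hV n (hadm.pos n hn)
    have hΦb := leadingRisk_pos (d := d) hG hV n (hb.pos n hn)
    have hle := leadingRisk_optBandwidth_le hd hG hV hn (hb.pos n hn)
    have hle' : leadingRisk d G V n (optBandwidth d G V n) ≤ leadingRisk d G V n (b n) := by
      refine le_trans (le_mul_of_one_le_right hΦo.le ?_) hle
      have : 0 ≤ Real.log (b n / optBandwidth d G V n) ^ 2 / 2 / (1 + 4 / d) := by positivity
      linarith
    have e1 : R n (b n) = R n (b n) / leadingRisk d G V n (b n) * leadingRisk d G V n (b n) :=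
      (div_mul_cancel₀ _ hΦb.ne').symm
    rw [Pi.div_apply, div_le_iff₀ h2, div_le_iff₀ hΦo] at h1
    rw [e1, ← mul_assoc]
    refine h1.trans (mul_le_mul_of_nonneg_left hle' ?_)
    positivity
  · have hRb := hR b hb
    have hΦ : Tendsto (fun n => leadingRisk d G V n (b n) /
        leadingRisk d G V n (optBandwidth d G V n)) atTop (𝓝 1) := by
      have h := hratio.mul (hRo.div hRb one_ne_zero)
      rw [div_one, mul_one] at h
      refine h.congr' ?_
      filter_upwards [hRb.eventually (eventually_gt_nhds one_pos),
        hRo.eventually (eventually_gt_nhds one_pos), eventually_gt_atTop 0] with n h2 h3 hn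
      have hΦo := leadingRisk_pos (d := d) hG hV n (hadm.pos n hn)
      have hΦb := leadingRisk_pos (d := d) hG hV n (hb.pos n hn)
      have h2' : R n (b n) ≠ 0 := fun h => by simp [h] at h2
      have h3' : R n (optBandwidth d G V n) ≠ 0 := fun h => by simp [h] at h3
      rw [Pi.div_apply]
      field_simp
    have hd' : (0 : ℝ) < d := Nat.cast_pos.2 hd
    have hsq : Tendsto (fun n => Real.log (b n / optBandwidth d G V n) ^ 2) atTop (𝓝 0) := by
      have hub : Tendsto (fun n => 2 * (1 + 4 / (d : ℝ)) * (leadingRisk d G V n (b n) /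
          leadingRisk d G V n (optBandwidth d G V n) - 1)) atTop (𝓝 0) := by
        simpa using (hΦ.sub_const 1).const_mul (2 * (1 + 4 / (d : ℝ)))
      refine squeeze_zero' (Eventually.of_forall fun n => sq_nonneg _) ?_ hub
      filter_upwards [eventually_gt_atTop 0] with n hn
      have hΦo := leadingRisk_pos (d := d) hG hV n (hadm.pos n hn)
      have hle := leadingRisk_optBandwidth_le hd hG hV hn (hb.pos n hn)
      rw [mul_comm, ← le_div_iff₀ hΦo] at hle
      have h4 : Real.log (b n / optBandwidth d G V n) ^ 2 = 2 * (1 + 4 / (d : ℝ)) *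
          (1 + Real.log (b n / optBandwidth d G V n) ^ 2 / 2 / (1 + 4 / d) - 1) := by
        field_simp
        ring
      rw [h4]
      gcongr
    have hlog : Tendsto (fun n => Real.log (b n / optBandwidth d G V n)) atTop (𝓝 0) := by
      have h := hsq.sqrt
      simp only [Real.sqrt_sq_eq_abs, Real.sqrt_zero] at h
      exact tendsto_zero_iff_abs_tendsto_zero _ |>.2 h
    have h := (Real.continuous_exp.tendsto 0).comp hlog
    rw [Real.exp_zero] at h
    refine h.congr' ?_
    filter_upwards [eventually_gt_atTop 0] with n hn
    exact Real.exp_log (div_pos (hb.pos n hn) (hadm.pos n hn))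

/-- Positivity of `G` and `V` makes both `b^2` and the variance scale `O` of the leading risk, so
both remainders are negligible against it. -/
lemma tendsto_div_leadingRisk (hG : 0 < G) (hV : 0 < V) {b r₁ r₂ R : ℕ → ℝ}
    (hb : BandwidthAssumption d b) (h1 : r₁ =o[atTop] fun n => b n ^ 2)
    (h2 : r₂ =o[atTop] fun n : ℕ => (n : ℝ)⁻¹ * b n ^ (-((d : ℝ) / 2)))
    (hR : ∀ n : ℕ, 0 < n → R n = b n ^ 2 * G + (n : ℝ)⁻¹ * b n ^ (-((d : ℝ) / 2)) * V
      + r₁ n + r₂ n) :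
    Tendsto (fun n => R n / leadingRisk d G V n (b n)) atTop (𝓝 1) := by
  have hO1 : (fun n => b n ^ 2) =O[atTop] fun n => leadingRisk d G V n (b n) := by
    refine IsBigO.of_bound G⁻¹ ?_
    filter_upwards [eventually_gt_atTop 0] with n hn
    have hΦ := leadingRisk_pos (d := d) hG hV n (hb.pos n hn)
    have := Real.rpow_pos_of_pos (hb.pos n hn) (-((d : ℝ) / 2))
    rw [Real.norm_of_nonneg (sq_nonneg _), Real.norm_of_nonneg hΦ.le, inv_mul_eq_div G,
      le_div_iff₀ hG, leadingRisk]
    exact le_add_of_nonneg_right (by positivity)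
  have hO2 : (fun n : ℕ => (n : ℝ)⁻¹ * b n ^ (-((d : ℝ) / 2))) =O[atTop]
      fun n => leadingRisk d G V n (b n) := by
    refine IsBigO.of_bound V⁻¹ ?_
    filter_upwards [eventually_gt_atTop 0] with n hn
    have hΦ := leadingRisk_pos (d := d) hG hV n (hb.pos n hn)
    have := Real.rpow_pos_of_pos (hb.pos n hn) (-((d : ℝ) / 2))
    rw [Real.norm_of_nonneg (by positivity), Real.norm_of_nonneg hΦ.le, inv_mul_eq_div V,
      le_div_iff₀ hV, leadingRisk]
    exact le_add_of_nonneg_left (by positivity)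
  have h := ((h1.trans_isBigO hO1).add (h2.trans_isBigO hO2)).tendsto_div_nhds_zero.const_add 1
  rw [add_zero] at h
  refine h.congr' ?_
  filter_upwards [eventually_gt_atTop 0] with n hn
  have hΦ := leadingRisk_pos (d := d) hG hV n (hb.pos n hn)
  rw [eq_div_iff hΦ.ne', add_mul, div_mul_cancel₀ _ hΦ.ne', hR n hn, leadingRisk]
  ring

end Optimal

end

/-! ### Assembly of the expansion, the optimal bandwidth and the optimal risk. -/

theorem theorem1 (d : ℕ) (hd : 1 ≤ d) (f σ m : EuclideanSpace ℝ (Fin d) → ℝ) (C₀ : ℝ)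
    (hreg : RegularityAssumption f σ m) (hbd : BoundsAssumption f σ) :
    IntegrableOn (fun s => biasFun m s ^ 2) (simplex d) ∧
    IntegrableOn (fun s => psi s * σ s ^ 2 / f s) (simplex d) ∧
    ∃ C : ℝ, ∀ {Ω : Type*} [MeasurableSpace Ω] (P : Measure Ω) [IsProbabilityMeasure P]
      (x : (n : ℕ) → Fin n → EuclideanSpace ℝ (Fin d))
      (B : (n : ℕ) → Fin n → Set (EuclideanSpace ℝ (Fin d)))
      (ε : (n : ℕ) → Fin n → Ω → ℝ),
      IsDesignDensity f x → PartitionAssumption f C₀ x B → ErrorAssumption P σ x ε →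
      -- the mean integrated squared error is an integral of integrable functions
      (∀ n : ℕ, 0 < n → ∀ b : ℝ, 0 < b →
        (∀ s ∈ simplex d, Integrable (squaredError m x B ε n b s) P) ∧
        IntegrableOn (mse P m x B ε n b) (simplex d)) ∧
      -- the expansion of the mean integrated squared error
      (∀ b : ℕ → ℝ, BandwidthAssumption d b →
        ∃ r₁ r₂ r₃ r₄ : ℕ → ℝ,
          r₁ =o[atTop] (fun n => b n ^ 2) ∧
          r₂ =o[atTop] (fun n => (n : ℝ) ^ (-(1 / (d : ℝ))) * b n) ∧
          IsBigOWith C atTop r₃ (fun n => (n : ℝ) ^ (-(2 / (d : ℝ)))) ∧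
          r₄ =o[atTop] (fun n => (n : ℝ)⁻¹ * b n ^ (-((d : ℝ) / 2))) ∧
          ∀ n : ℕ, 0 < n →
            mise P m x B ε n (b n) =
              b n ^ 2 * biasConst m + (n : ℝ)⁻¹ * b n ^ (-((d : ℝ) / 2)) * varConst f σ
                + r₁ n + r₂ n + r₃ n + r₄ n) ∧
      -- the optimal bandwidth and the optimal mean integrated squared error
      (d ≤ 3 → 0 < biasConst m → 0 < varConst f σ →
        IsAsymptoticallyOptimal d (mise P m x B ε)
          (optBandwidth d (biasConst m) (varConst f σ)) ∧
        (fun n : ℕ =>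
          mise P m x B ε n (optBandwidth d (biasConst m) (varConst f σ) n)
            - (n : ℝ) ^ (-(4 / ((d : ℝ) + 4)))
              * ((1 + (d : ℝ) / 4) / ((d : ℝ) / 4) ^ ((d : ℝ) / ((d : ℝ) + 4)))
              * (varConst f σ ^ (4 / ((d : ℝ) + 4))
                  / biasConst m ^ (-((d : ℝ) / ((d : ℝ) + 4)))))
          =o[atTop] (fun n : ℕ => (n : ℝ) ^ (-(4 / ((d : ℝ) + 4))))) := by
  have : NeZero d := ⟨by omega⟩
  -- The constant of the `O(n^{-2/d})` term can be 0, because that remainder is taken to be zero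
  -- below.
  refine ⟨((continuousOn_biasFun hreg.contDiff_m).pow 2).integrableOn_compact isCompact_simplex,
    integrableOn_psi_mul_div hreg.lipschitz_f hreg.lipschitz_variance hbd, 0, ?_⟩
  intro Ω _ P _ x B ε _ hB hε
  refine ⟨fun n hn b hb => ⟨fun s _ => integrable_squaredError hε n b s,
    integrableOn_mse hreg.contDiff_m.continuousOn hB hε hn hb⟩, fun b hb => ?_,
    fun hd3 hG hV => ?_⟩
  · obtain ⟨r₁, r₂, h1, h2, h⟩ := exists_mise_expansion hreg hbd hB hε hb
    -- since `n^{-1/d} = o(b)`, the design error is absorbed by `o(b²)`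
    refine ⟨r₁, fun _ => 0, fun _ => 0, r₂, h1, isLittleO_zero _ _, ?_, h2, fun n hn => ?_⟩
    · exact IsBigOWith.of_bound (by simp)
    · rw [h n hn]
      ring
  · have hR : ∀ b : ℕ → ℝ, BandwidthAssumption d b →
        Tendsto (fun n => mise P m x B ε n (b n) /
          leadingRisk d (biasConst m) (varConst f σ) n (b n)) atTop (𝓝 1) := by
      intro b hb
      obtain ⟨r₁, r₂, h1, h2, h⟩ := exists_mise_expansion hreg hbd hB hε hb
      exact tendsto_div_leadingRisk hG hV hb h1 h2 h
    refine ⟨isAsymptoticallyOptimal_optBandwidth hd hd3 hG hV hR, ?_⟩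
    have hadm := bandwidthAssumption_optBandwidth hd hd3 hG hV
    have h := (hR _ hadm).sub_const 1
    rw [sub_self] at h
    have hpos : ∀ n : ℕ, 0 < n → (n : ℝ) ^ (-(4 / ((d : ℝ) + 4))) ≠ 0 := fun n hn =>
      (Real.rpow_pos_of_pos (Nat.cast_pos.2 hn) _).ne'
    rw [isLittleO_iff_tendsto' ((eventually_gt_atTop 0).mono fun n hn h0 =>
      absurd h0 (hpos n hn))]
    -- The multiplier is the leading risk at the optimal bandwidth divided by `n^{-4/(d+4)}`, which
    -- converts the relative error into the normalized remainder.
    have h' := h.mul_const (((1 + (d : ℝ) / 4) / ((d : ℝ) / 4) ^ ((d : ℝ) / ((d : ℝ) + 4)))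
      * (varConst f σ ^ (4 / ((d : ℝ) + 4)) / biasConst m ^ (-((d : ℝ) / ((d : ℝ) + 4)))))
    rw [zero_mul] at h'
    refine h'.congr' ?_
    filter_upwards [eventually_gt_atTop 0] with n hn
    have hΦ := (leadingRisk_pos (d := d) hG hV n (hadm.pos n hn)).ne'
    have heq := leadingRisk_optBandwidth_eq hd hG hV hn
    have hn0 := hpos n hn
    rw [eq_div_iff hn0, ← heq, mul_assoc, mul_comm (_ * _) ((n : ℝ) ^ (-(4 / ((d : ℝ) + 4)))),
      ← mul_assoc ((n : ℝ) ^ (-(4 / ((d : ℝ) + 4)))), ← heq, sub_mul, one_mul,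
      div_mul_cancel₀ _ hΦ]
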